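/- Let $k$ be a field, $n\ge 1$ and $\Lambda_n=k[x]/(x^n)$. For a ring $R$ let $\mathrm{mod}\,R$ be the category of left $R$-modules of finite length. For $0\le i\le n$ let $[i]=\Lambda_n/(x^i)$, the indecomposable $\Lambda_n$-module of length $i$ (with $[0]=0$). Let $\mathcal S(n)$ be the category of pairs $(X,Y)$, where $Y$ is a $\Lambda_n$-module of finite length and $X$ is a submodule of $Y$; a morphism $(X,Y)\to(X',Y')$ is a linear map $Y\to Y'$ which sends $X$ into $X'$. A pair is of the form $([i],[j])$, with $0\le i\le j\le n$, if $X\cong[i]$ and $Y\cong[j]$. Let $\Pi_{n-1}$ be the preprojective algebra over $k$ of type $\mathbb A_{n-1}$. Put $E=\bigoplus_{i=1}^n[i]$ and let $A_n=\mathrm{End}_{\Lambda_n}(E)^{\mathrm{op}}$ be the Auslander algebra of $\Lambda_n$, with $e(i)\in A_n$ the idempotent given by the projection onto the summand $[i]$. There is an isomorphism of $k$-algebras $\Pi_{n-1}\cong A_n/\langle e(n)\rangle$ which sends the idempotent of the vertex $i$ to the residue class of $e(i)$, for $1\le i\le n-1$. Fix any isomorphism of $k$-algebras $\Pi_{n-1}\cong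 A_n/\langle e(n)\rangle$ and use it to identify the two algebras. Let $\mathrm{mod}\,T_2(\Lambda_n)$ be the category of maps in $\mathrm{mod}\,\Lambda_n$, and consider the functors $\iota,\epsilon\colon\mathcal S(n)\to\mathrm{mod}\,T_2(\Lambda_n)$, where $\iota(X,Y)$ is the inclusion $X\to Y$ and $\epsilon(X,Y)$ is the projection $Y\to Y/X$; $\alpha\colon\mathrm{mod}\,T_2(\Lambda_n)\to\mathrm{mod}\,A_n$, where $\alpha(f)$ is the cokernel of $\mathrm{Hom}_{\Lambda_n}(E,f)$; $\delta\colon\mathrm{mod}\,A_n\to\mathrm{mod}\,\Pi_{n-1}$, where $\delta(M)=M/A_ne(n)M$. Put $F=\delta\alpha\iota$ (Li–Zhang) and $G=\delta\alpha\epsilon$ (Auslander–Reiten). For a class $\mathcal K$ of objects of an additive category $\mathcal A$ let $\langle\mathcal K\rangle$ be the ideal of all morphisms which factor through a finite direct sum of objects in $\mathcal K$, and let $\mathcal A/\mathcal K$ be the category with the same objects and with the morphisms of $\mathcal A$ modulo $\langle\mathcal K\rangle$. An additive functor is *objective* if every morphism which it sends to $0$ factors through an object which it sends to $0$; the *index*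 of a dense objective functor is the number of isomorphism classes of indecomposable objects which it sends to $0$. **Theorem 1.** Let $\mathcal U$ be the class of objects of $\mathcal S(n)$ of the form $([i],[j])$ with $i=j$ or $j=n$, and let $\mathcal V$ be the class of those with $i=j$ or $i=0$. 1. $F$ and $G$ are full, dense, objective additive functors $\mathcal S(n)\to\mathrm{mod}\,\Pi_{n-1}$ of index $2n$. The morphisms which $F$ sends to $0$ form the ideal $\langle\mathcal U\rangle$ and those which $G$ sends to $0$ form the ideal $\langle\mathcal V\rangle$. Thus $F$ and $G$ induce additive equivalences $\mathcal S(n)/\mathcal U\simeq\mathrm{mod}\,\Pi_{n-1}$ and $\mathcal S(n)/\mathcal V\simeq\mathrm{mod}\,\Pi_{n-1}$. 2. In particular, $\mathcal S(n)/\mathcal U$ and $\mathcal S(n)/\mathcal V$ are abelian categories with enough projective objects. 3. Up to isomorphism, the indecomposable projective objects of $\mathcal S(n)/\mathcal U$ are the objects of the form $([0],[j])$ with $1\le j\le n-1$, and those of $\mathcal S(n)/\mathcal V$ are the objects of the form $([i],[n])$ with $1\le i\le n-1$. -/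

import Mathlib

open CategoryTheory CategoryTheory.Limits

namespace SubmoduleCat

universe u v

noncomputable section

/-! ## Ideals generated by objects, factor categories, objective functors -/

section FactorCategory

variable {C : Type*} [Category C] [Preadditive C] [HasFiniteBiproducts C]

/-- The ideal `⟨K⟩`: the morphisms which factor through a finite direct sum of objects in `K`. -/
def InIdeal (K : ObjectProperty C) {X Y : C} (f : X ⟶ Y) : Prop :=
  ∃ (m : ℕ) (A : Fin m → C), (∀ i, K (A i)) ∧
    ∃ (g : X ⟶ ⨁ A) (h : (⨁ A) ⟶ Y), g ≫ h = f

theorem inIdeal_sum (K : ObjectProperty C) {X Y : C} {J : Type} [Fintype J] (A : J → C)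
    (hA : ∀ i, K (A i)) (g : ∀ i, X ⟶ A i) (h : ∀ i, A i ⟶ Y) :
    InIdeal K (∑ i, g i ≫ h i) := by
  let e := Fintype.equivFin J
  refine ⟨Fintype.card J, fun i => A (e.symm i), fun i => hA _,
    biproduct.lift (fun i => g (e.symm i)), biproduct.desc (fun i => h (e.symm i)), ?_⟩
  rw [biproduct.lift_desc]
  exact Equiv.sum_comp e.symm (fun i => g i ≫ h i)

theorem InIdeal.exists_sum {K : ObjectProperty C} {X Y : C} {f : X ⟶ Y} (hf : InIdeal K f) :
    ∃ (m : ℕ) (A : Fin m → C) (_ : ∀ i, K (A i)) (g : ∀ i, X ⟶ A i) (h : ∀ i, A i ⟶ Y),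
      f = ∑ i, g i ≫ h i := by
  obtain ⟨m, A, hA, g, h, rfl⟩ := hf
  refine ⟨m, A, hA, fun i => g ≫ biproduct.π A i, fun i => biproduct.ι A i ≫ h, ?_⟩
  have := biproduct.total (f := A)
  calc g ≫ h = g ≫ 𝟙 _ ≫ h := by rw [Category.id_comp]
    _ = _ := by rw [← this]; simp only [Preadditive.sum_comp, Preadditive.comp_sum, Category.assoc]

theorem InIdeal.zero (K : ObjectProperty C) (X Y : C) : InIdeal K (0 : X ⟶ Y) :=
  ⟨0, Fin.elim0, fun i => i.elim0, 0, 0, by simp⟩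

theorem InIdeal.comp_left {K : ObjectProperty C} {W X Y : C} (w : W ⟶ X) {f : X ⟶ Y}
    (hf : InIdeal K f) : InIdeal K (w ≫ f) := by
  obtain ⟨m, A, hA, g, h, rfl⟩ := hf
  exact ⟨m, A, hA, w ≫ g, h, by simp⟩

theorem InIdeal.comp_right {K : ObjectProperty C} {X Y Z : C} {f : X ⟶ Y}
    (hf : InIdeal K f) (w : Y ⟶ Z) : InIdeal K (f ≫ w) := by
  obtain ⟨m, A, hA, g, h, rfl⟩ := hf
  exact ⟨m, A, hA, g, h ≫ w, by simp⟩

theorem InIdeal.neg {K : ObjectProperty C} {X Y : C} {f : X ⟶ Y}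
    (hf : InIdeal K f) : InIdeal K (-f) := by
  obtain ⟨m, A, hA, g, h, rfl⟩ := hf
  exact ⟨m, A, hA, g, -h, by simp⟩

theorem InIdeal.add {K : ObjectProperty C} {X Y : C} {f f' : X ⟶ Y}
    (hf : InIdeal K f) (hf' : InIdeal K f') : InIdeal K (f + f') := by
  obtain ⟨m, A, hA, g, h, rfl⟩ := hf.exists_sum
  obtain ⟨m', A', hA', g', h', rfl⟩ := hf'.exists_sum
  have := inIdeal_sum K (J := Fin m ⊕ Fin m') (Sum.elim A A')
    (by rintro (i | i); exacts [hA i, hA' i])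
    (fun i => match i with | .inl i => g i | .inr i => g' i)
    (fun i => match i with | .inl i => h i | .inr i => h' i)
  simpa [Fintype.sum_sum_type] using this

/-- Congruence of morphisms modulo the ideal `⟨K⟩`. -/
def idealRel (K : ObjectProperty C) : HomRel C := fun _ _ f g => InIdeal K (f - g)

instance (K : ObjectProperty C) : Congruence (idealRel K) where
  equivalence := {
    refl := fun f => by simpa [idealRel] using InIdeal.zero K _ _
    symm := fun {f g} h => by simpa [idealRel] using InIdeal.neg h
    trans := fun {f g h} h₁ h₂ => by simpa [idealRel] using InIdeal.add h₁ h₂ }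
  comp_left {_ _ _} w {_ _} h := by
    simpa [idealRel, Preadditive.comp_sub] using InIdeal.comp_left w h
  comp_right {_ _ _ _ _} w h := by
    simpa [idealRel, Preadditive.sub_comp] using InIdeal.comp_right h w

theorem idealRel_add (K : ObjectProperty C) ⦃X Y : C⦄ (f₁ f₂ g₁ g₂ : X ⟶ Y)
    (h : idealRel K f₁ f₂) (h' : idealRel K g₁ g₂) : idealRel K (f₁ + g₁) (f₂ + g₂) := by
  have := InIdeal.add h h'
  rwa [show f₁ - f₂ + (g₁ - g₂) = f₁ + g₁ - (f₂ + g₂) by abel] at this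

/-- The factor category `C / K`: same objects, morphisms modulo the ideal `⟨K⟩`. -/
abbrev FactorCat (K : ObjectProperty C) := CategoryTheory.Quotient (idealRel K)

/-- The additive structure of `C / K` induced by that of `C`. -/
instance factorPreadditive (K : ObjectProperty C) : Preadditive (FactorCat K) :=
  CategoryTheory.Quotient.preadditive _ (idealRel_add K)

/-- The projection functor `C ⥤ C / K`. -/
abbrev factorFunctor (K : ObjectProperty C) : C ⥤ FactorCat K :=
  CategoryTheory.Quotient.functor (idealRel K)

instance (K : ObjectProperty C) : (factorFunctor K).Additive :=
  CategoryTheory.Quotient.functor_additive _ (idealRel_add K)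

instance (K : ObjectProperty C) : HasFiniteBiproducts (FactorCat K) where
  out n := ⟨fun A => by
    let B : Fin n → C := fun i => (A i).as
    exact hasBiproduct_of_total ((factorFunctor K).mapBicone (biproduct.bicone B)) (by
      have := (factorFunctor K).congr_map (biproduct.total (f := B))
      rw [Functor.map_sum, CategoryTheory.Functor.map_id] at this
      simp only [Functor.map_comp] at this
      exact this)⟩

instance (K : ObjectProperty C) : HasBinaryBiproducts (FactorCat K) :=
  hasBinaryBiproducts_of_finite_biproducts _

end FactorCategory

section Objective

variable {C D : Type*} [Category C] [Preadditive C] [Category D] [Preadditive D]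

/-- `F` is objective: every morphism killed by `F` factors through an object killed by `F`. -/
def IsObjective (F : C ⥤ D) : Prop :=
  ∀ ⦃X Y : C⦄ (f : X ⟶ Y), F.map f = 0 →
    ∃ (A : C) (g : X ⟶ A) (h : A ⟶ Y), IsZero (F.obj A) ∧ g ≫ h = f

/-- The index of a dense objective functor: the number of isomorphism classes of
indecomposable objects killed by it. -/
def index [HasBinaryBiproducts C] (F : C ⥤ D) : ℕ∞ :=
  Set.encard {c : Quotient (isIsomorphicSetoid C) |
    ∃ A : C, Indecomposable A ∧ IsZero (F.obj A) ∧ Quotient.mk (isIsomorphicSetoid C) A = c}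

end Objective

/-! ## Modules of finite length -/

/-- The property of being a module of finite length. -/
def finLen (R : Type u) [Ring R] : ObjectProperty (ModuleCat.{u} R) := fun M => IsFiniteLength R M

/-- `mod R`: the category of left `R`-modules of finite length. -/
abbrev FinMod (R : Type u) [Ring R] := (finLen R).FullSubcategory

/-- A finite length module as an object of `mod R`. -/
abbrev FinMod.of (R : Type u) [Ring R] (M : Type u) [AddCommGroup M] [Module R M]
    (h : IsFiniteLength R M) : FinMod R := ⟨ModuleCat.of R M, h⟩

/-- A linear map as a morphism of `mod R`. -/
abbrev FinMod.ofHom {R : Type u} [Ring R] {M N : FinMod R} (f : M.obj →ₗ[R] N.obj) : M ⟶ N :=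
  ObjectProperty.homMk (ModuleCat.ofHom f)

/-- The linear map underlying a morphism of `mod R`. -/
abbrev FinMod.lin {R : Type u} [Ring R] {M N : FinMod R} (f : M ⟶ N) : M.obj →ₗ[R] N.obj :=
  f.hom.hom

theorem finLen_submodule {R M : Type*} [Ring R] [AddCommGroup M] [Module R M]
    (h : IsFiniteLength R M) (N : Submodule R M) : IsFiniteLength R N := by
  rw [isFiniteLength_iff_isNoetherian_isArtinian] at h ⊢
  obtain ⟨_, _⟩ := h
  exact ⟨inferInstance, inferInstance⟩

theorem finLen_quotient {R M : Type*} [Ring R] [AddCommGroup M] [Module R M]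
    (h : IsFiniteLength R M) (N : Submodule R M) : IsFiniteLength R (M ⧸ N) := by
  rw [isFiniteLength_iff_isNoetherian_isArtinian] at h ⊢
  obtain ⟨_, _⟩ := h
  exact ⟨inferInstance, inferInstance⟩

theorem finLen_pi {R : Type*} [Ring R] {ι : Type*} [Finite ι] (M : ι → Type*)
    [∀ i, AddCommGroup (M i)] [∀ i, Module R (M i)]
    (h : ∀ i, IsFiniteLength R (M i)) : IsFiniteLength R (∀ i, M i) := by
  simp only [isFiniteLength_iff_isNoetherian_isArtinian] at h ⊢
  have := fun i => (h i).1
  have := fun i => (h i).2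
  exact ⟨inferInstance, inferInstance⟩

theorem finLen_tower (R : Type*) {S M : Type*} [Ring R] [Ring S] [AddCommGroup M] [Module R M]
    [Module S M] [SMul R S] [IsScalarTower R S M] (h : IsFiniteLength R M) :
    IsFiniteLength S M := by
  rw [isFiniteLength_iff_isNoetherian_isArtinian] at h ⊢
  obtain ⟨_, _⟩ := h
  exact ⟨isNoetherian_of_tower R ‹_›, isArtinian_of_tower R ‹_›⟩

/-! ## The category of pairs `(X, Y)` with `X` a submodule of `Y` -/

/-- A pair `(X, Y)`: a module `Y` of finite length and a submodule `X` of `Y`. -/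
structure Pair (R : Type u) [Ring R] where
  /-- the ambient module `Y` -/
  amb : FinMod R
  /-- the submodule `X` -/
  sub : Submodule R amb.obj

namespace Pair

section

variable {R : Type u} [CommRing R]

/-- Morphisms `(X, Y) → (X', Y')`: linear maps `Y → Y'` which send `X` into `X'`. -/
@[ext]
structure Hom (P Q : Pair R) where
  /-- the underlying linear map -/
  lin : P.amb.obj →ₗ[R] Q.amb.obj
  map_sub : P.sub ≤ Q.sub.comap lin

instance : Category (Pair R) where
  Hom P Q := Hom P Q
  id P := ⟨LinearMap.id, fun _ h => h⟩
  comp f g := ⟨g.lin ∘ₗ f.lin, fun _ h => g.map_sub (f.map_sub h)⟩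

@[ext]
theorem hom_ext {P Q : Pair R} {f g : P ⟶ Q} (h : f.lin = g.lin) : f = g := Hom.ext h

@[simp] theorem id_lin (P : Pair R) : Hom.lin (𝟙 P) = LinearMap.id := rfl

@[simp] theorem comp_lin {P Q T : Pair R} (f : P ⟶ Q) (g : Q ⟶ T) :
    Hom.lin (f ≫ g) = g.lin ∘ₗ f.lin := rfl

instance (P Q : Pair R) : Add (P ⟶ Q) :=
  ⟨fun f g => ⟨f.lin + g.lin, fun _ h => Q.sub.add_mem (f.map_sub h) (g.map_sub h)⟩⟩
instance (P Q : Pair R) : Zero (P ⟶ Q) := ⟨⟨0, fun _ _ => Q.sub.zero_mem⟩⟩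
instance (P Q : Pair R) : Neg (P ⟶ Q) :=
  ⟨fun f => ⟨-f.lin, fun _ h => Q.sub.neg_mem (f.map_sub h)⟩⟩

@[simp] theorem add_lin {P Q : Pair R} (f g : P ⟶ Q) : (f + g).lin = f.lin + g.lin := rfl
@[simp] theorem zero_lin {P Q : Pair R} : (0 : P ⟶ Q).lin = 0 := rfl
@[simp] theorem neg_lin {P Q : Pair R} (f : P ⟶ Q) : (-f).lin = -f.lin := rfl

instance (P Q : Pair R) : AddCommGroup (P ⟶ Q) where
  add_assoc f g h := by ext1; simp [add_assoc]
  zero_add f := by ext1; simp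
  add_zero f := by ext1; simp
  add_comm f g := by ext1; simp [add_comm]
  neg_add_cancel f := by ext1; simp
  nsmul := nsmulRec
  zsmul := zsmulRec

instance : Preadditive (Pair R) where
  add_comp P Q T f g h := by ext1; simp [LinearMap.comp_add]
  comp_add P Q T f g h := by ext1; simp [LinearMap.add_comp]

/-- Taking underlying linear maps, as an additive map. -/
def linHom (P Q : Pair R) : (P ⟶ Q) →+ (P.amb.obj →ₗ[R] Q.amb.obj) where
  toFun f := f.lin
  map_zero' := rfl
  map_add' _ _ := rfl

/-- The direct sum of finitely many pairs, with its structure maps. -/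
def biconePi {n : ℕ} (A : Fin n → Pair R) : Bicone A where
  pt := ⟨FinMod.of R (∀ i, (A i).amb.obj) (finLen_pi _ fun i => (A i).amb.property),
    Submodule.pi Set.univ fun i => (A i).sub⟩
  π i := ⟨LinearMap.proj i, fun _ h => h i trivial⟩
  ι i := ⟨LinearMap.single R (fun i => (A i).amb.obj) i, fun x h j _ => by
    by_cases hij : j = i
    · subst hij; simpa using h
    · simp [hij]⟩
  ι_π i j := by
    split_ifs with h
    · subst h
      ext x
      change (Pi.single i x : ∀ i, (A i).amb.obj) i = x
      simp
    · ext x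
      change (Pi.single i x : ∀ i, (A i).amb.obj) j = 0
      exact Pi.single_eq_of_ne (M := fun i => (A i).amb.obj) (Ne.symm h) x

instance : HasFiniteBiproducts (Pair R) where
  out n := ⟨fun A => hasBiproduct_of_total (biconePi A) (by
    apply hom_ext
    change linHom _ _ _ = _
    rw [map_sum]
    refine LinearMap.ext fun x => ?_
    rw [LinearMap.sum_apply]
    change ∑ i, (Pi.single i ((x : ∀ i, (A i).amb.obj) i) : ∀ i, (A i).amb.obj) = x
    exact Finset.univ_sum_single _)⟩

instance : HasBinaryBiproducts (Pair R) := hasBinaryBiproducts_of_finite_biproducts _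

/-- The functor `ι`, which sends `(X, Y)` to the inclusion map `X → Y`. The category of
modules over the triangular matrix ring `T₂(R)` is the category of maps in `mod R`. -/
def incl : Pair R ⥤ Arrow (FinMod R) where
  obj P := Arrow.mk (Y := P.amb) (X := FinMod.of R P.sub (finLen_submodule P.amb.property _))
    (FinMod.ofHom P.sub.subtype)
  map {P Q} f := Arrow.homMk
    (FinMod.ofHom (f.lin.restrict f.map_sub)) (FinMod.ofHom f.lin) rfl

/-- The functor `ε`, which sends `(X, Y)` to the canonical projection `Y → Y / X`. -/
def proj : Pair R ⥤ Arrow (FinMod R) where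
  obj P := Arrow.mk (X := P.amb)
    (Y := FinMod.of R (P.amb.obj ⧸ P.sub) (finLen_quotient P.amb.property _))
    (FinMod.ofHom P.sub.mkQ)
  map {P Q} f := Arrow.homMk
    (FinMod.ofHom f.lin) (FinMod.ofHom (P.sub.mapQ Q.sub f.lin f.map_sub)) rfl
  map_id P := by
    ext x
    · rfl
    · obtain ⟨x, rfl⟩ := P.sub.mkQ_surjective x
      rfl
  map_comp {P Q T} f g := by
    ext x
    · rfl
    · obtain ⟨x, rfl⟩ := P.sub.mkQ_surjective x
      rfl

end

end Pair

/-! ## The functor `α = Cok Hom(E, -)` -/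

section Alpha

variable {R : Type u} [CommRing R] (E : Type u) [AddCommGroup E] [Module R E]

/-- `Hom(E, M)` is a left module over `(End E)ᵒᵖ` by composition. -/
instance homModule (M : Type u) [AddCommGroup M] [Module R M] :
    Module (Module.End R E)ᵐᵒᵖ (E →ₗ[R] M) where
  smul a f := f ∘ₗ a.unop
  one_smul _ := rfl
  mul_smul _ _ _ := rfl
  smul_zero _ := LinearMap.zero_comp _
  smul_add _ _ _ := LinearMap.add_comp _ _ _
  add_smul _ _ f := LinearMap.comp_add _ _ f
  zero_smul f := LinearMap.comp_zero f

@[simp]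
theorem op_smul_hom {M : Type u} [AddCommGroup M] [Module R M] (a : (Module.End R E)ᵐᵒᵖ)
    (f : E →ₗ[R] M) : a • f = f ∘ₗ a.unop := rfl

/-- The map `Hom(E, f) : Hom(E, M) → Hom(E, N)` of `(End E)ᵒᵖ`-modules. -/
def homMap {M N : Type u} [AddCommGroup M] [Module R M] [AddCommGroup N] [Module R N]
    (f : M →ₗ[R] N) : (E →ₗ[R] M) →ₗ[(Module.End R E)ᵐᵒᵖ] (E →ₗ[R] N) where
  toFun g := f ∘ₗ g
  map_add' _ _ := LinearMap.comp_add _ _ _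
  map_smul' _ _ := rfl

theorem finLen_hom [Module.Finite R E] {M : Type u} [AddCommGroup M] [Module R M]
    (h : IsFiniteLength R M) : IsFiniteLength (Module.End R E)ᵐᵒᵖ (E →ₗ[R] M) := by
  have h' : IsFiniteLength R (E →ₗ[R] M) := by
    obtain ⟨n, s, hs⟩ := Module.Finite.exists_fin (R := R) (M := E)
    let ev : (E →ₗ[R] M) →ₗ[R] (Fin n → M) := LinearMap.pi fun i => LinearMap.applyₗ (s i)
    have hev : Function.Injective ev := fun f g hfg =>
      LinearMap.ext_on_range hs fun i => congrFun hfg i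
    have := finLen_pi (R := R) (fun _ : Fin n => M) (fun _ => h)
    rw [isFiniteLength_iff_isNoetherian_isArtinian] at this ⊢
    obtain ⟨_, _⟩ := this
    exact ⟨isNoetherian_of_injective ev hev, isArtinian_of_injective ev hev⟩
  have : IsScalarTower R (Module.End R E)ᵐᵒᵖ (E →ₗ[R] M) :=
    ⟨fun r a f => LinearMap.ext fun x => f.map_smul r (a.unop x)⟩
  exact finLen_tower R h'

/-- The functor `α`, which sends a map `f` in `mod R` to the cokernel of `Hom(E, f)`. -/
def alpha [Module.Finite R E] : Arrow (FinMod R) ⥤ FinMod (Module.End R E)ᵐᵒᵖ where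
  obj f := FinMod.of _
    ((E →ₗ[R] f.right.obj) ⧸ LinearMap.range (homMap E (FinMod.lin f.hom)))
    (finLen_quotient (finLen_hom E f.right.property) _)
  map {f g} φ := FinMod.ofHom (Submodule.mapQ _ _ (homMap E (FinMod.lin φ.right)) (by
    rintro _ ⟨x, rfl⟩
    refine ⟨FinMod.lin φ.left ∘ₗ x, ?_⟩
    have h : FinMod.lin g.hom ∘ₗ FinMod.lin φ.left = FinMod.lin φ.right ∘ₗ FinMod.lin f.hom :=
      congrArg FinMod.lin φ.w
    change FinMod.lin g.hom ∘ₗ FinMod.lin φ.left ∘ₗ x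
      = FinMod.lin φ.right ∘ₗ FinMod.lin f.hom ∘ₗ x
    rw [← LinearMap.comp_assoc, h, LinearMap.comp_assoc]))
  map_id f := by
    ext x
    rfl
  map_comp φ ψ := by
    ext x
    rfl

end Alpha

/-! ## The functor `δ` -/

section Delta

variable {A : Type u} [Ring A] (e : A)

/-- The two-sided ideal `⟨e⟩`. -/
abbrev idealOf : Ideal A := (TwoSidedIdeal.span {e}).asIdeal

/-- The submodule `A e M` of an `A`-module `M`. -/
def tors (M : Type u) [AddCommGroup M] [Module A M] : Submodule A M :=
  Submodule.span A (Set.range fun m : M => e • m)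

theorem tors_le {M N : Type u} [AddCommGroup M] [Module A M] [AddCommGroup N] [Module A N]
    (f : M →ₗ[A] N) : tors e M ≤ (tors e N).comap f := by
  refine Submodule.span_le.2 ?_
  rintro _ ⟨m, rfl⟩
  exact Submodule.subset_span ⟨f m, (f.map_smul e m).symm⟩

/-- The factor module `M / AeM`. -/
def TorsQuot (M : Type u) [AddCommGroup M] [Module A M] : Type u := M ⧸ tors e M

section

variable (M : Type u) [AddCommGroup M] [Module A M]

instance : AddCommGroup (TorsQuot e M) := inferInstanceAs (AddCommGroup (M ⧸ tors e M))

instance : Module A (TorsQuot e M) := inferInstanceAs (Module A (M ⧸ tors e M))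

/-- The canonical map `M → M / AeM`. -/
def TorsQuot.mk : M →ₗ[A] TorsQuot e M := (tors e M).mkQ

theorem TorsQuot.mk_surjective : Function.Surjective (TorsQuot.mk e M) :=
  (tors e M).mkQ_surjective

theorem tors_torsion : Module.IsTorsionBySet A (TorsQuot e M) (idealOf e) := by
  have h : TwoSidedIdeal.span {e} ≤ (Module.annihilator A (TorsQuot e M)).toTwoSided := by
    rw [TwoSidedIdeal.span_le]
    intro x hx
    rw [Set.mem_singleton_iff.1 hx]
    simp only [SetLike.mem_coe, Ideal.mem_toTwoSided, Module.mem_annihilator]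
    intro m
    obtain ⟨m, rfl⟩ := TorsQuot.mk_surjective e M m
    rw [← map_smul]
    exact (Submodule.Quotient.mk_eq_zero _).2 (Submodule.subset_span ⟨m, rfl⟩)
  rintro m ⟨a, ha⟩
  have := h (TwoSidedIdeal.mem_asIdeal.1 ha)
  rw [Ideal.mem_toTwoSided, Module.mem_annihilator] at this
  exact this m

/-- `M / AeM` is a module over `A / ⟨e⟩`: the residue class of `a` acts as `a`. -/
instance : Module (A ⧸ idealOf e) (TorsQuot e M) := (tors_torsion e M).module

theorem TorsQuot.mk_smul (a : A) (m : TorsQuot e M) :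
    (Ideal.Quotient.mk (idealOf e) a) • m = a • m := rfl

theorem finLen_torsQuot (h : IsFiniteLength A M) :
    IsFiniteLength (A ⧸ idealOf e) (TorsQuot e M) := by
  have : IsScalarTower A (A ⧸ idealOf e) (TorsQuot e M) :=
    ⟨fun a b m => by
      obtain ⟨b, rfl⟩ := Ideal.Quotient.mk_surjective b
      exact mul_smul a b m⟩
  have h' : IsFiniteLength A (TorsQuot e M) := finLen_quotient h (tors e M)
  exact finLen_tower A h'

end

/-- The map `M / AeM → N / AeN` induced by `f : M → N`. -/
def torsMap {M N : Type u} [AddCommGroup M] [Module A M] [AddCommGroup N] [Module A N]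
    (f : M →ₗ[A] N) : TorsQuot e M →ₗ[A ⧸ idealOf e] TorsQuot e N where
  toFun := (tors e M).mapQ (tors e N) f (tors_le e f)
  map_add' := map_add ((tors e M).mapQ (tors e N) f (tors_le e f))
  map_smul' a m := by
    obtain ⟨a, rfl⟩ := Ideal.Quotient.mk_surjective a
    exact ((tors e M).mapQ (tors e N) f (tors_le e f)).map_smul a m

/-- The functor `δ : mod A → mod A/⟨e⟩`, which sends `M` to `M / AeM`. -/
def delta : FinMod A ⥤ FinMod (A ⧸ idealOf e) where
  obj M := FinMod.of (A ⧸ idealOf e) (TorsQuot e M.obj) (finLen_torsQuot e M.obj M.property)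
  map f := FinMod.ofHom (torsMap e (FinMod.lin f))
  map_id M := by
    ext x
    obtain ⟨x, rfl⟩ := TorsQuot.mk_surjective e _ x
    rfl
  map_comp {M _ _} f g := by
    ext x
    obtain ⟨x, rfl⟩ := TorsQuot.mk_surjective e M.obj x
    rfl

end Delta

theorem finLen_restrict {S T : Type u} [Ring S] [Ring T] (φ : S ≃+* T) {M : Type u}
    [AddCommGroup M] [Module T M] (h : IsFiniteLength T M) :
    @IsFiniteLength S _ M _ (Module.compHom M φ.toRingHom) := by
  let _ : SMul T S := ⟨fun t s => φ.symm t * s⟩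
  let _ : Module S M := Module.compHom M φ.toRingHom
  have : IsScalarTower T S M := ⟨fun t s m => by
    change φ (φ.symm t * s) • m = t • φ s • m
    rw [map_mul, RingEquiv.apply_symm_apply, mul_smul]⟩
  exact finLen_tower T h

/-- A ring isomorphism `φ : S ≃ T` turns modules over `T` into modules over `S`. -/
def restrict {S T : Type u} [Ring S] [Ring T] (φ : S ≃+* T) : FinMod T ⥤ FinMod S :=
  (finLen S).lift ((finLen T).ι ⋙ ModuleCat.restrictScalars φ.toRingHom)
    (fun M => finLen_restrict φ (M := M.obj) M.property)

/-! ## The preprojective algebra -/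

section Preprojective

variable (k : Type u) [Field k] {V Q : Type} [Fintype V] [Fintype Q] (s t : Q → V)

/-- Vertices, arrows `a` and opposite arrows `a*` of the double of a quiver. -/
inductive DoubleGen (V Q : Type)
  | vertex (i : V)
  | arrow (a : Q)
  | star (a : Q)

open DoubleGen in
/-- The defining relations: those of the path algebra of the double quiver (with the convention
`a = e (t a) * a * e (s a)`) and the preprojective relation `∑ (a a* - a* a) = 0`. -/
inductive PreprojRel :
    FreeAlgebra k (DoubleGen V Q) → FreeAlgebra k (DoubleGen V Q) → Prop
  | idem (i : V) : PreprojRel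
      (FreeAlgebra.ι k (vertex i) * FreeAlgebra.ι k (vertex i)) (FreeAlgebra.ι k (vertex i))
  | orth (i j : V) (h : i ≠ j) : PreprojRel
      (FreeAlgebra.ι k (vertex i) * FreeAlgebra.ι k (vertex j)) 0
  | one : PreprojRel (∑ i : V, FreeAlgebra.ι k (vertex i)) 1
  | arrow_target (a : Q) : PreprojRel
      (FreeAlgebra.ι k (vertex (t a)) * FreeAlgebra.ι k (arrow a)) (FreeAlgebra.ι k (arrow a))
  | arrow_source (a : Q) : PreprojRel
      (FreeAlgebra.ι k (arrow a) * FreeAlgebra.ι k (vertex (s a))) (FreeAlgebra.ι k (arrow a))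
  | star_target (a : Q) : PreprojRel
      (FreeAlgebra.ι k (vertex (s a)) * FreeAlgebra.ι k (star a)) (FreeAlgebra.ι k (star a))
  | star_source (a : Q) : PreprojRel
      (FreeAlgebra.ι k (star a) * FreeAlgebra.ι k (vertex (t a))) (FreeAlgebra.ι k (star a))
  | preproj : PreprojRel
      (∑ a : Q, (FreeAlgebra.ι k (arrow a) * FreeAlgebra.ι k (star a)
        - FreeAlgebra.ι k (star a) * FreeAlgebra.ι k (arrow a))) 0

/-- The preprojective algebra over `k` of a finite quiver with vertices `V`, arrows `Q`,
source map `s` and target map `t`. -/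
abbrev PreprojectiveAlgebra := RingQuot (PreprojRel k s t)

/-- The arrows of the linearly oriented quiver of type `A_m`, one for each pair of vertices
`(i, i + 1)`. -/
abbrev ArrowA (m : ℕ) := {p : Fin m × Fin m // p.1.val + 1 = p.2.val}

/-- The preprojective algebra `Π_m` of type `A_m`, with vertices `Fin m`. -/
abbrev PreprojA (m : ℕ) :=
  PreprojectiveAlgebra k (V := Fin m) (Q := ArrowA m) (fun a => a.1.1) (fun a => a.1.2)

/-- The idempotent of `Π_m` at the vertex `i`. -/
def PreprojA.vertexIdem {m : ℕ} (i : Fin m) : PreprojA k m :=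
  RingQuot.mkAlgHom k _ (FreeAlgebra.ι k (DoubleGen.vertex i))

end Preprojective

/-! ## The algebra `Λ_n`, its Auslander algebra `A_n`, and the functors `F` and `G` -/

section Main

variable (k : Type u) [Field k] (n : ℕ)

/-- `Λ_n = k[x] / (x^n)`. -/
abbrev Lam := Polynomial k ⧸ Ideal.span {(Polynomial.X : Polynomial k) ^ n}

/-- The residue class of `x` in `Λ_n`. -/
def Lam.x : Lam k n := Ideal.Quotient.mk _ Polynomial.X

/-- `[i] = Λ_n / (x^i)`, the indecomposable `Λ_n`-module of length `i`, for `1 ≤ i ≤ n`;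
moreover `[0] = 0`. -/
def Cyc (i : ℕ) : Type u := Lam k n ⧸ Ideal.span {Lam.x k n ^ i}

instance (i : ℕ) : AddCommGroup (Cyc k n i) :=
  inferInstanceAs (AddCommGroup (Lam k n ⧸ Ideal.span {Lam.x k n ^ i}))

instance (i : ℕ) : Module (Lam k n) (Cyc k n i) :=
  inferInstanceAs (Module (Lam k n) (Lam k n ⧸ Ideal.span {Lam.x k n ^ i}))

instance (i : ℕ) : Module k (Cyc k n i) :=
  inferInstanceAs (Module k (Lam k n ⧸ Ideal.span {Lam.x k n ^ i}))

instance (i : ℕ) : IsScalarTower k (Lam k n) (Cyc k n i) :=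
  inferInstanceAs (IsScalarTower k (Lam k n) (Lam k n ⧸ Ideal.span {Lam.x k n ^ i}))

instance (i : ℕ) : Module.Finite (Lam k n) (Cyc k n i) :=
  inferInstanceAs (Module.Finite (Lam k n) (Lam k n ⧸ Ideal.span {Lam.x k n ^ i}))

/-- `E = [1] ⊕ ⋯ ⊕ [n]`. -/
abbrev AusGen := ∀ i : Fin n, Cyc k n (i.val + 1)

/-- The Auslander algebra `A_n = (End E)ᵒᵖ`. -/
abbrev AusAlg := (Module.End (Lam k n) (AusGen k n))ᵐᵒᵖ

/-- The idempotent `e(i)` of `A_n`: the projection of `E` onto its direct summand `[i]`,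
for `1 ≤ i ≤ n`. -/
def AusAlg.idem (i : ℕ) : AusAlg k n :=
  MulOpposite.op (LinearMap.pi fun j =>
    if j.val + 1 = i then LinearMap.proj j else 0)

/-- The factor algebra `A_n / ⟨e(n)⟩`; here `A_n e(n) = Hom(E, [n])` is the indecomposable
projective-injective `A_n`-module. -/
abbrev FactorAlg := AusAlg k n ⧸ idealOf (AusAlg.idem k n n)

/-- The category `𝒮(n)`. -/
abbrev S := Pair (Lam k n)

/-- `P` is of the form `([i], [j])`, where `0 ≤ i ≤ j ≤ n`. -/
def IsPicket {k : Type u} [Field k] {n : ℕ} (i j : ℕ) (P : S k n) : Prop :=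
  i ≤ j ∧ j ≤ n ∧
    Nonempty (P.sub ≃ₗ[Lam k n] Cyc k n i) ∧ Nonempty (P.amb.obj ≃ₗ[Lam k n] Cyc k n j)

/-- The objects of the form `([i], [j])` with `i = j` or `j = n`. -/
def setU : ObjectProperty (S k n) := fun P => ∃ i j, IsPicket i j P ∧ (i = j ∨ j = n)

/-- The objects of the form `([i], [j])` with `i = j` or `i = 0`. -/
def setV : ObjectProperty (S k n) := fun P => ∃ i j, IsPicket i j P ∧ (i = j ∨ i = 0)

variable {k n}

/-- The functor `F = δ α ι`, where `A_n / ⟨e(n)⟩` is identified with `Π_{n-1}` through `φ`. -/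
def functorF (φ : PreprojA k (n - 1) ≃ₐ[k] FactorAlg k n) :
    S k n ⥤ FinMod (PreprojA k (n - 1)) :=
  Pair.incl ⋙ alpha (AusGen k n) ⋙ delta (AusAlg.idem k n n) ⋙ restrict φ.toRingEquiv

/-- The functor `G = δ α ε`, where `A_n / ⟨e(n)⟩` is identified with `Π_{n-1}` through `φ`. -/
def functorG (φ : PreprojA k (n - 1) ≃ₐ[k] FactorAlg k n) :
    S k n ⥤ FinMod (PreprojA k (n - 1)) :=
  Pair.proj ⋙ alpha (AusGen k n) ⋙ delta (AusAlg.idem k n n) ⋙ restrict φ.toRingEquiv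

end Main

end

end SubmoduleCat

open SubmoduleCat

/-!
Write `E = [1] ⊕ ⋯ ⊕ [n]`. By definition of the functors, `F(X, Y)` is the group `Hom(E, Y)` modulo
the maps which factor through `X` or through a free module, and `G(X, Y)` is `Hom(E, Y / X)` modulo
the maps which lift to `Y`; the maps through free modules lift anyway. Everything is computed with
these residue classes (`clsIncl`, `clsProj`), and it rests on two facts about `Λ_n`: each finite
module is a direct sum of modules `[c]`, so it is a direct summand of a power of `E`
(`exists_sum_cyc_eq_id`, `exists_sum_ausGen_eq_id`), and `Λ_n` is self-injective (`Lam.baer`), so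
maps through free modules extend along injections and lift along surjections.

Since `E` generates `mod Λ_n` additively, `Hom(E, -)` is fully faithful; thus a homomorphism between
values of `F` or `G` is induced by a linear map, which can be corrected by a map through a free
module such that it comes from a morphism of pairs (`cokerIncl_full`, `cokerProj_full`). A morphism
killed by `F` is the sum of one with values in `X'` and one through a free module; these factor
through pairs `([c], [c])` and `([c], [n])`, respectively. A morphism killed by `G` is the sum of
one with values in `X'` and one which vanishes on `X`; these factor through pairs `([c], [c])` and
`([0], [c])` (`inIdeal_of_range_le`, `inIdeal_of_mem_projMaps`, `inIdeal_of_comp_mkQ`). Density is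
obtained by making a presentation `E^l → E^m` of a module injective, or surjective, with the help of
a free module (`cokerIncl_essSurj`, `cokerProj_essSurj`).

Hence `F` and `G` induce equivalences of the factor categories with the abelian category
`mod Π_{n-1}`. The pairs `([i], [j])` have local endomorphism rings (`localEnd_stdPicket`), so an
indecomposable object which is killed, or which is projective, is a retract of one of the pairs
through which the relevant morphisms factor (`indecomposable_and_isZero_obj_iff`,
`indecomposable_and_projective_iff`); this gives the index and the projective objects. For the
latter, `F([0], [c])` and `G([c], [n])` are projective, being the factor `Hom(E, M)` modulo maps
through free modules for a module `M`, and such objects cover all the others.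

For the isomorphism `Π_{n-1} ≅ A_n / ⟨e(n)⟩`, let `U` be the sum of the arrows and `D` the sum of
the opposite arrows. They commute by the preprojective relation, whence the elements `U^a D^b e(s)`
span `Π_{n-1}`, and they vanish unless the corresponding path can be drawn in each order of its
factors (`PreprojA.exists_sum_monom`). They are sent to maps `[t] → [s]` given by powers of `x`. These maps
span `A_n`, and those which do not come from `Π_{n-1}` factor through `[n]` or vanish; the others
are linearly independent modulo `⟨e(n)⟩`, since the elements of `⟨e(n)⟩` send elements killed by
`x^j` to multiples of `x^(n-j)` (`AusAlg.exists_eq_x_pow_smul_of_mem`).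
-/

open CategoryTheory CategoryTheory.Limits

namespace SubmoduleCat

universe u v

noncomputable section

/-! ### Objects with local endomorphism ring -/

section LocalEnd

variable {C : Type*} [Category C] [Preadditive C]

/-- The endomorphism ring of `B` is local or zero: for each endomorphism `f`, one of `f` and
`1 - f` is invertible. The zero object is allowed. -/
def LocalEnd (B : C) : Prop := ∀ f : B ⟶ B, IsIso f ∨ IsIso (𝟙 B - f)

omit [Preadditive C] in
theorem isIso_of_comp_eq_id {X Y : C} {f : X ⟶ Y} {g : Y ⟶ X} (h₁ : f ≫ g = 𝟙 X)
    (h₂ : g ≫ f = 𝟙 Y) : IsIso f := ⟨g, h₁, h₂⟩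

/-- The categorical form of the fact that `1 - ab` is invertible if and only if `1 - ba` is. -/
theorem isIso_one_sub_comp_comm {X Y : C} (f : X ⟶ Y) (g : Y ⟶ X) (h : IsIso (𝟙 X - f ≫ g)) :
    IsIso (𝟙 Y - g ≫ f) := by
  obtain ⟨w, h₁, h₂⟩ := h
  have e₁ : f ≫ g ≫ w = w - 𝟙 X := by
    rw [Preadditive.sub_comp, Category.id_comp, Category.assoc] at h₁
    rw [← h₁]; abel
  have e₂ : w ≫ f ≫ g = w - 𝟙 X := by
    rw [Preadditive.comp_sub, Category.comp_id] at h₂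
    rw [← h₂]; abel
  refine ⟨𝟙 Y + g ≫ w ≫ f, ?_, ?_⟩
  · have : g ≫ f ≫ g ≫ w ≫ f = g ≫ w ≫ f - g ≫ f := by
      rw [← Category.assoc g w, ← Category.assoc f, e₁]; simp
    simp only [Preadditive.sub_comp, Preadditive.comp_add, Category.id_comp, Category.comp_id,
      Category.assoc, this]
    abel
  · have : g ≫ w ≫ f ≫ g ≫ f = g ≫ w ≫ f - g ≫ f := by
      rw [← Category.assoc f g, ← Category.assoc w, e₂]; simp
    simp only [Preadditive.comp_sub, Preadditive.add_comp, Category.id_comp, Category.comp_id,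
      Category.assoc, this]
    abel

/-- If the identity of a nonzero object `Q` is a finite sum of morphisms which factor through
objects with local endomorphism rings, then one of these objects is a nonzero retract of `Q`. -/
theorem exists_retract_of_isIso_sum {Q : C} (hQ : ¬ IsZero Q) {J : Type*} (s : Finset J)
    {B : J → C} (hB : ∀ j, LocalEnd (B j)) (a : ∀ j, Q ⟶ B j) (b : ∀ j, B j ⟶ Q)
    (h : IsIso (∑ j ∈ s, a j ≫ b j)) :
    ∃ j, ¬ IsZero (B j) ∧ ∃ (f : B j ⟶ Q) (g : Q ⟶ B j), f ≫ g = 𝟙 _ := by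
  classical
  induction s using Finset.induction_on generalizing a with
  | empty =>
    refine absurd ((IsZero.iff_id_eq_zero Q).2 ?_) hQ
    rw [Finset.sum_empty] at h
    obtain ⟨w, hw, -⟩ := h
    rw [← hw, zero_comp]
  | insert i s hi ih =>
    obtain ⟨w, hw₁, hw₂⟩ := h
    rw [Finset.sum_insert hi] at hw₂
    have hsum : (w ≫ a i) ≫ b i + ∑ j ∈ s, (w ≫ a j) ≫ b j = 𝟙 Q := by
      rw [← hw₂, Preadditive.comp_add, Preadditive.comp_sum]
      simp only [Category.assoc]
    by_cases hz : IsZero (B i)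
    · refine ih (fun j => w ≫ a j) ?_
      rw [hz.eq_of_src (b i) 0, comp_zero, zero_add] at hsum
      rw [hsum]; infer_instance
    rcases hB i (b i ≫ w ≫ a i) with ⟨v, hv, -⟩ | h'
    · exact ⟨i, hz, b i, w ≫ a i ≫ v, by simpa using hv⟩
    · refine ih (fun j => w ≫ a j) ?_
      rw [eq_sub_of_add_eq' hsum]
      exact isIso_one_sub_comp_comm _ _ h'

theorem nonempty_iso_of_retract [HasBinaryBiproducts C] [IsIdempotentComplete C]
    {Q B : C} (hQ : Indecomposable Q) (hB : ¬ IsZero B) {f : B ⟶ Q} {g : Q ⟶ B}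
    (h : f ≫ g = 𝟙 B) : Nonempty (Q ≅ B) := by
  have hgf : g ≫ f ≫ g ≫ f = g ≫ f := by rw [reassoc_of% h]
  obtain ⟨Z, i, e, hie, hei⟩ := IsIdempotentComplete.idempotents_split Q (𝟙 Q - g ≫ f) (by
    simp [hgf])
  have hi : i ≫ (𝟙 Q - g ≫ f) = i := by rw [← hei, reassoc_of% hie]
  have he : (𝟙 Q - g ≫ f) ≫ e = e := by rw [← hei, Category.assoc, hie, Category.comp_id]
  have hig : i ≫ g = 0 := by rw [← hi]; simp [h]
  have hfe : f ≫ e = 0 := by rw [← he]; simp [reassoc_of% h]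
  have eq : Q ≅ B ⊞ Z :=
    { hom := biprod.lift g e
      inv := biprod.desc f i
      hom_inv_id := by rw [biprod.lift_desc, hei]; abel
      inv_hom_id := by ext <;> simp [h, hie, hig, hfe] }
  rcases hQ.2 B Z eq with h0 | h0
  · exact absurd h0 hB
  · refine ⟨⟨g, f, ?_, h⟩⟩
    rw [h0.eq_of_tgt e 0, zero_comp] at hei
    exact (sub_eq_zero.1 hei.symm).symm

theorem LocalEnd.indecomposable [HasBinaryBiproducts C] {B : C} (h : LocalEnd B)
    (h0 : ¬ IsZero B) : Indecomposable B := by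
  refine ⟨h0, fun Y Z e => ?_⟩
  rcases h (e.hom ≫ biprod.fst ≫ biprod.inl ≫ e.inv) with h | h
  · right
    have h1 : biprod.inr ≫ e.inv ≫ (e.hom ≫ biprod.fst ≫ biprod.inl ≫ e.inv) = 0 := by simp
    rw [← Category.assoc, ← cancel_mono (inv (e.hom ≫ biprod.fst ≫ biprod.inl ≫ e.inv)),
      Category.assoc, IsIso.hom_inv_id, zero_comp, Category.comp_id] at h1
    rw [IsZero.iff_id_eq_zero, ← biprod.inr_snd (X := Y), ← Category.comp_id (biprod.inr),
      ← e.inv_hom_id, reassoc_of% h1, zero_comp, zero_comp]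
  · left
    have h1 : biprod.inl ≫ e.inv ≫ (𝟙 _ - e.hom ≫ biprod.fst ≫ biprod.inl ≫ e.inv) = 0 := by
      simp
    rw [← Category.assoc, ← cancel_mono (inv (𝟙 _ - e.hom ≫ biprod.fst ≫ biprod.inl ≫ e.inv)),
      Category.assoc, IsIso.hom_inv_id, zero_comp, Category.comp_id] at h1
    rw [IsZero.iff_id_eq_zero, ← biprod.inl_fst (Y := Z), ← Category.comp_id (biprod.inl),
      ← e.inv_hom_id, reassoc_of% h1, zero_comp, zero_comp]

theorem LocalEnd.map {D : Type*} [Category D] [Preadditive D] (F : C ⥤ D) [F.Additive] [F.Full]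
    {B : C} (h : LocalEnd B) : LocalEnd (F.obj B) := by
  intro f
  obtain ⟨f, rfl⟩ := F.map_surjective f
  rcases h f with h | h
  · exact Or.inl inferInstance
  · right
    rw [← F.map_id, ← F.map_sub]
    infer_instance

theorem LocalEnd.of_iso {A B : C} (e : A ≅ B) (h : LocalEnd A) : LocalEnd B := by
  intro f
  have key : ∀ g : B ⟶ B, IsIso (e.hom ≫ g ≫ e.inv) → IsIso g := fun g hg => by
    have : g = e.inv ≫ (e.hom ≫ g ≫ e.inv) ≫ e.hom := by simp
    rw [this]; infer_instance
  refine (h (e.hom ≫ f ≫ e.inv)).imp (key _) fun h => key _ ?_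
  simpa using h

end LocalEnd

/-! ### Functors whose kernel is an ideal generated by objects -/

section Package

variable {C : Type*} [Category C] [Preadditive C] [HasFiniteBiproducts C]
  {D : Type*} [Category D] [Preadditive D]

theorem InIdeal.of_prop {K : ObjectProperty C} {X Y A : C} (hA : K A) (f : X ⟶ A) (g : A ⟶ Y) :
    InIdeal K (f ≫ g) := by
  have := inIdeal_sum K (J := Unit) (fun _ => A) (fun _ => hA) (fun _ => f) (fun _ => g)
  simpa using this

variable {F : C ⥤ D} {K : ObjectProperty C}

theorem isObjective_of_kernel_eq
    (hK : ∀ ⦃X Y : C⦄ (f : X ⟶ Y), F.map f = 0 ↔ InIdeal K f) : IsObjective F := by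
  intro X Y f hf
  obtain ⟨m, A, hA, g, h, rfl⟩ := (hK f).1 hf
  refine ⟨⨁ A, g, h, ?_, rfl⟩
  rw [IsZero.iff_id_eq_zero, ← F.map_id, hK]
  exact ⟨m, A, hA, 𝟙 _, 𝟙 _, Category.comp_id _⟩

theorem isZero_obj_of_prop (hK : ∀ ⦃X Y : C⦄ (f : X ⟶ Y), F.map f = 0 ↔ InIdeal K f) {A : C}
    (hA : K A) : IsZero (F.obj A) := by
  rw [IsZero.iff_id_eq_zero, ← F.map_id, hK, ← Category.comp_id (𝟙 A)]
  exact InIdeal.of_prop hA _ _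

/-- If the objects of `K` have local endomorphism rings, then the indecomposable objects killed by
`F` are the nonzero objects of `K`, up to isomorphism. -/
theorem indecomposable_and_isZero_obj_iff [HasBinaryBiproducts C] [IsIdempotentComplete C]
    (hK : ∀ ⦃X Y : C⦄ (f : X ⟶ Y), F.map f = 0 ↔ InIdeal K f)
    (hloc : ∀ B, K B → LocalEnd B) (A : C) :
    (Indecomposable A ∧ IsZero (F.obj A)) ↔ ∃ B, K B ∧ ¬ IsZero B ∧ Nonempty (A ≅ B) := by
  constructor
  · rintro ⟨hA, h0⟩
    rw [IsZero.iff_id_eq_zero, ← F.map_id, hK] at h0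
    obtain ⟨m, B, hB, g, h, hid⟩ := h0.exists_sum
    obtain ⟨j, hj, f, g, hfg⟩ := exists_retract_of_isIso_sum hA.1 Finset.univ
      (fun i => hloc _ (hB i)) g h (by rw [← hid]; infer_instance)
    exact ⟨B j, hB j, hj, nonempty_iso_of_retract hA hj hfg⟩
  · rintro ⟨B, hB, h0, ⟨e⟩⟩
    refine ⟨((hloc B hB).of_iso e.symm).indecomposable fun h => h0 (h.of_iso e.symm), ?_⟩
    exact (isZero_obj_of_prop hK hB).of_iso (F.mapIso e)

variable [F.Additive]

/-- The functor on the factor category `C / K` which is induced by a functor with kernel `⟨K⟩`. -/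
def inducedFunctor (hK : ∀ ⦃X Y : C⦄ (f : X ⟶ Y), F.map f = 0 ↔ InIdeal K f) :
    FactorCat K ⥤ D :=
  CategoryTheory.Quotient.lift _ F fun X Y f g h => by
    rw [← sub_eq_zero, ← F.map_sub]
    exact (hK _).2 h

variable (hK : ∀ ⦃X Y : C⦄ (f : X ⟶ Y), F.map f = 0 ↔ InIdeal K f)

include hK

theorem inducedFunctor_additive : (inducedFunctor hK).Additive where
  map_add {X Y f g} := by
    obtain ⟨f, rfl⟩ := (factorFunctor K).map_surjective (X := X.as) (Y := Y.as) f
    obtain ⟨g, rfl⟩ := (factorFunctor K).map_surjective (X := X.as) (Y := Y.as) g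
    rw [← (factorFunctor K).map_add]
    exact F.map_add

theorem inducedFunctor_faithful : (inducedFunctor hK).Faithful where
  map_injective {X Y f g} h := by
    obtain ⟨f, rfl⟩ := (factorFunctor K).map_surjective (X := X.as) (Y := Y.as) f
    obtain ⟨g, rfl⟩ := (factorFunctor K).map_surjective (X := X.as) (Y := Y.as) g
    refine CategoryTheory.Quotient.sound _ ?_
    change InIdeal K (f - g)
    rw [← hK, F.map_sub, sub_eq_zero]
    exact h

theorem inducedFunctor_full [F.Full] : (inducedFunctor hK).Full where
  map_surjective {X Y} f := by
    obtain ⟨g, hg⟩ := F.map_surjective (X := X.as) (Y := Y.as) f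
    exact ⟨(factorFunctor K).map g, hg⟩

theorem inducedFunctor_essSurj [F.EssSurj] : (inducedFunctor hK).EssSurj where
  mem_essImage Z := ⟨(factorFunctor K).obj (F.objPreimage Z), ⟨F.objObjPreimageIso Z⟩⟩

theorem inducedFunctor_isEquivalence [F.Full] [F.EssSurj] :
    (inducedFunctor hK).IsEquivalence :=
  have := inducedFunctor_faithful hK
  have := inducedFunctor_full hK
  have := inducedFunctor_essSurj hK
  {}

theorem exists_equivalence_factorCat [F.Full] [F.EssSurj] :
    ∃ e : FactorCat K ≌ D, e.functor.Additive ∧ Nonempty (factorFunctor K ⋙ e.functor ≅ F) :=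
  have := inducedFunctor_isEquivalence hK
  ⟨(inducedFunctor hK).asEquivalence, inducedFunctor_additive hK, ⟨Iso.refl _⟩⟩

theorem isZero_factorFunctor_iff {X : C} :
    IsZero ((factorFunctor K).obj X) ↔ IsZero (F.obj X) := by
  have := inducedFunctor_faithful hK
  have := inducedFunctor_additive hK
  rw [IsZero.iff_id_eq_zero, IsZero.iff_id_eq_zero,
    ← (inducedFunctor hK).map_eq_zero_iff, CategoryTheory.Functor.map_id]
  rfl

end Package

section PackageAbelian

variable {C : Type*} [Category C] [Preadditive C] [HasFiniteBiproducts C]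
  {D : Type*} [Category D] [Abelian D] {F : C ⥤ D} [F.Additive] [F.Full] [F.EssSurj]
  {K : ObjectProperty C} (hK : ∀ ⦃X Y : C⦄ (f : X ⟶ Y), F.map f = 0 ↔ InIdeal K f)

include hK

theorem exists_abelian_factorCat :
    ∃ h : Abelian (FactorCat K), h.toPreadditive = factorPreadditive K :=
  have := inducedFunctor_isEquivalence hK
  have : HasFiniteProducts (FactorCat K) := inferInstance
  ⟨abelianOfEquivalence (inducedFunctor hK), rfl⟩

theorem projective_factorFunctor_iff {B : C} :
    Projective ((factorFunctor K).obj B) ↔ Projective (F.obj B) := by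
  have := inducedFunctor_isEquivalence hK
  exact ((inducedFunctor hK).asEquivalence.map_projective_iff ((factorFunctor K).obj B)).symm

variable {T : ObjectProperty C} (hproj : ∀ B, T B → Projective (F.obj B))
  (hgen : ∀ Q : C, ∃ (m : ℕ) (B : Fin m → C) (_ : ∀ i, T (B i)) (r : ∀ i, B i ⟶ Q),
    ∀ ⦃W : D⦄ (t : F.obj Q ⟶ W), (∀ i, F.map (r i) ≫ t = 0) → t = 0)

include hproj hgen

/-- If every object of `D` is covered by finitely many projective objects `F B` with `B` in `T`,
then so is every object of `C / K`. -/
theorem exists_epi_biproduct (Q : FactorCat K) :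
    ∃ (m : ℕ) (B : Fin m → C) (_ : ∀ i, T (B i))
      (r : (⨁ fun i => (factorFunctor K).obj (B i)) ⟶ Q), Epi r ∧
        Projective (⨁ fun i => (factorFunctor K).obj (B i)) := by
  obtain ⟨m, B, hB, r, hr⟩ := hgen Q.as
  refine ⟨m, B, hB, biproduct.desc fun i => (factorFunctor K).map (r i), ?_, ?_⟩
  · refine Preadditive.epi_of_cancel_zero _ fun {W} t ht => ?_
    have := inducedFunctor_faithful hK
    have := inducedFunctor_additive hK
    apply (inducedFunctor hK).map_injective
    rw [Functor.map_zero]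
    refine hr _ fun i => ?_
    change (inducedFunctor hK).map ((factorFunctor K).map (r i)) ≫ _ = 0
    have h := biproduct.ι _ i ≫= ht
    rw [biproduct.ι_desc_assoc, comp_zero] at h
    rw [← Functor.map_comp, h, Functor.map_zero]
  · have := fun i => (projective_factorFunctor_iff hK).2 (hproj _ (hB i))
    exact ⟨fun f e _ => ⟨biproduct.desc fun i =>
      Projective.factorThru (biproduct.ι (fun i => (factorFunctor K).obj (B i)) i ≫ f) e,
      by cat_disch⟩⟩

theorem enoughProjectives_factorCat : EnoughProjectives (FactorCat K) where
  presentation Q := by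
    obtain ⟨m, B, hB, r, hr, hp⟩ := exists_epi_biproduct hK hproj hgen Q
    exact ⟨{ p := _, projective := hp, f := r, epi := hr }⟩

theorem indecomposable_and_projective_iff (hloc : ∀ B, T B → LocalEnd B) (P : FactorCat K) :
    (Indecomposable P ∧ Projective P) ↔
      ∃ B, T B ∧ ¬ IsZero (F.obj B) ∧ Nonempty (P ≅ (factorFunctor K).obj B) := by
  constructor
  · rintro ⟨hP, hp⟩
    obtain ⟨m, B, hB, r, hr, -⟩ := exists_epi_biproduct hK hproj hgen P
    have hid : ∑ i, (Projective.factorThru (𝟙 P) r ≫ biproduct.π _ i) ≫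
        biproduct.ι (fun i => (factorFunctor K).obj (B i)) i ≫ r = 𝟙 P := by
      have h := biproduct.total (f := fun i => (factorFunctor K).obj (B i)) =≫ r
      rw [Category.id_comp] at h
      refine Eq.trans ?_ ((Projective.factorThru (𝟙 P) r ≫= h).trans
        (Projective.factorThru_comp (𝟙 P) r))
      simp only [Preadditive.comp_sum, Preadditive.sum_comp, Category.assoc]
    obtain ⟨j, hj, f, g, hfg⟩ := exists_retract_of_isIso_sum hP.1 Finset.univ
      (fun i => (hloc _ (hB i)).map (factorFunctor K)) _ _ (by rw [hid]; infer_instance)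
    have : IsIdempotentComplete (FactorCat K) := by
      have := inducedFunctor_isEquivalence hK
      rw [Idempotents.isIdempotentComplete_iff_of_equivalence (inducedFunctor hK).asEquivalence]
      infer_instance
    exact ⟨B j, hB j, mt (isZero_factorFunctor_iff hK).2 hj, nonempty_iso_of_retract hP hj hfg⟩
  · rintro ⟨B, hB, h0, ⟨e⟩⟩
    refine ⟨(((hloc B hB).map (factorFunctor K)).of_iso e.symm).indecomposable fun h => h0 ?_, ?_⟩
    · exact (isZero_factorFunctor_iff hK).1 (h.of_iso e.symm)
    · exact Projective.of_iso e.symm ((projective_factorFunctor_iff hK).2 (hproj B hB))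

end PackageAbelian

/-! ### The ring `Λ_n` -/

section LamRing

variable {k : Type u} [Field k] {n : ℕ}

theorem Lam.mk_surjective : Function.Surjective
    (Ideal.Quotient.mk (Ideal.span {(Polynomial.X : Polynomial k) ^ n})) :=
  Ideal.Quotient.mk_surjective

theorem Lam.mk_eq_zero_iff (p : Polynomial k) :
    Ideal.Quotient.mk (Ideal.span {(Polynomial.X : Polynomial k) ^ n}) p = 0 ↔
      Polynomial.X ^ n ∣ p := by
  rw [Ideal.Quotient.eq_zero_iff_mem, Ideal.mem_span_singleton]

theorem Lam.x_pow (m : ℕ) : Lam.x k n ^ m = Ideal.Quotient.mk _ (Polynomial.X ^ m) :=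
  (map_pow _ _ _).symm

theorem Lam.x_pow_n : Lam.x k n ^ n = 0 := by
  rw [Lam.x, ← map_pow, Lam.mk_eq_zero_iff]

/-- Divisibility by a power of `x` can be tested on representing polynomials. -/
theorem Lam.x_pow_dvd_mk_iff {a : ℕ} (ha : a ≤ n) (p : Polynomial k) :
    Lam.x k n ^ a ∣ Ideal.Quotient.mk _ p ↔ Polynomial.X ^ a ∣ p := by
  constructor
  · rintro ⟨c, hc⟩
    obtain ⟨c, rfl⟩ := Lam.mk_surjective c
    rw [Lam.x, ← map_pow, ← map_mul, ← sub_eq_zero, ← map_sub, Lam.mk_eq_zero_iff] at hc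
    have h := dvd_add ((pow_dvd_pow Polynomial.X ha).trans hc) (dvd_mul_right (Polynomial.X ^ a) c)
    rwa [sub_add_cancel] at h
  · intro h
    rw [Lam.x, ← map_pow]
    exact map_dvd _ h

theorem Lam.x_pow_dvd_x_pow_iff {a b : ℕ} (ha : a ≤ n) :
    Lam.x k n ^ a ∣ Lam.x k n ^ b ↔ a ≤ b := by
  rw [Lam.x_pow b, Lam.x_pow_dvd_mk_iff ha]
  exact pow_dvd_pow_iff Polynomial.X_ne_zero Polynomial.not_isUnit_X

theorem Lam.x_pow_mul_eq_zero_iff {a : ℕ} (ha : a ≤ n) (c : Lam k n) :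
    Lam.x k n ^ a * c = 0 ↔ Lam.x k n ^ (n - a) ∣ c := by
  obtain ⟨p, rfl⟩ := Lam.mk_surjective c
  rw [Lam.x_pow_dvd_mk_iff (Nat.sub_le n a), Lam.x, ← map_pow, ← map_mul, Lam.mk_eq_zero_iff]
  conv_lhs => rw [← Nat.add_sub_cancel' ha, pow_add]
  exact mul_dvd_mul_iff_left (pow_ne_zero _ Polynomial.X_ne_zero)

theorem Lam.isUnit_or_x_dvd (c : Lam k n) : IsUnit c ∨ Lam.x k n ∣ c := by
  obtain ⟨p, rfl⟩ := Lam.mk_surjective c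
  by_cases h : Polynomial.X ∣ p
  · exact Or.inr (map_dvd _ h)
  · left
    have hc : IsCoprime p (Polynomial.X ^ n) :=
      (((Polynomial.prime_X (R := k)).coprime_iff_not_dvd.2 h).symm).pow_right
    obtain ⟨a, b, hab⟩ := hc
    refine IsUnit.of_mul_eq_one (Ideal.Quotient.mk _ a) ?_
    rw [mul_comm, ← map_mul, ← map_one (Ideal.Quotient.mk _), ← sub_eq_zero, ← map_sub,
      Lam.mk_eq_zero_iff]
    exact ⟨-b, by rw [← hab]; ring⟩

theorem Lam.isUnit_or_isUnit_one_sub (c : Lam k n) : IsUnit c ∨ IsUnit (1 - c) := by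
  refine (Lam.isUnit_or_x_dvd c).imp_right fun h => ?_
  have hc : IsNilpotent c :=
    ⟨n, zero_dvd_iff.1 (by rw [← Lam.x_pow_n (k := k)]; exact pow_dvd_pow_of_dvd h n)⟩
  exact hc.isUnit_one_sub

/-- Each element of `Λ_n` is a power of `x` up to a unit. -/
theorem Lam.exists_eq_x_pow_mul_unit (c : Lam k n) :
    ∃ m ≤ n, ∃ w : (Lam k n)ˣ, c = Lam.x k n ^ m * w := by
  have key : ∀ a ≤ n, Lam.x k n ^ a ∣ c ∨ ∃ m ≤ n, ∃ w : (Lam k n)ˣ, c = Lam.x k n ^ m * w := by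
    intro a ha
    induction a with
    | zero => left; simp
    | succ a ih =>
      rcases ih (by omega) with ⟨d, rfl⟩ | h
      · rcases Lam.isUnit_or_x_dvd d with ⟨w, rfl⟩ | ⟨d, rfl⟩
        · exact Or.inr ⟨a, by omega, w, rfl⟩
        · left; exact ⟨d, by ring⟩
      · exact Or.inr h
  rcases key n le_rfl with ⟨d, hd⟩ | h
  · rw [Lam.x_pow_n, zero_mul] at hd
    exact ⟨n, le_rfl, 1, by rw [hd, Lam.x_pow_n, zero_mul]⟩
  · exact h

theorem Lam.exists_ideal_eq_span (I : Ideal (Lam k n)) :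
    ∃ m ≤ n, I = Ideal.span {Lam.x k n ^ m} := by
  have : IsPrincipalIdealRing (Lam k n) :=
    IsPrincipalIdealRing.of_surjective (Ideal.Quotient.mk _) Lam.mk_surjective
  obtain ⟨c, hc⟩ := IsPrincipalIdealRing.principal I
  obtain ⟨m, hm, w, rfl⟩ := Lam.exists_eq_x_pow_mul_unit c
  refine ⟨m, hm, hc.trans ?_⟩
  exact Ideal.span_singleton_mul_right_unit w.isUnit _

/-- The ring `Λ_n` is self-injective. -/
theorem Lam.baer : Module.Baer (Lam k n) (Lam k n) := by
  intro I g
  obtain ⟨m, hm, rfl⟩ := Lam.exists_ideal_eq_span I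
  have hx : Lam.x k n ^ m ∈ Ideal.span {Lam.x k n ^ m} := Ideal.mem_span_singleton_self _
  obtain ⟨z, hz⟩ : Lam.x k n ^ (n - (n - m)) ∣ g ⟨_, hx⟩ := by
    rw [← Lam.x_pow_mul_eq_zero_iff (Nat.sub_le n m), ← smul_eq_mul, ← map_smul,
      ← map_zero g]
    congr 1
    ext
    simp only [smul_eq_mul, SetLike.mk_smul_mk, ← pow_add, Nat.sub_add_cancel hm]
    exact Lam.x_pow_n
  rw [Nat.sub_sub_self hm] at hz
  refine ⟨LinearMap.toSpanSingleton _ _ z, fun c hc => ?_⟩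
  obtain ⟨d, rfl⟩ := Ideal.mem_span_singleton'.1 hc
  have : (⟨d * Lam.x k n ^ m, hc⟩ : Ideal.span {Lam.x k n ^ m}) = d • ⟨_, hx⟩ := rfl
  rw [this, map_smul, hz, LinearMap.toSpanSingleton_apply, smul_eq_mul, smul_eq_mul]
  ring

theorem Lam.exists_extend {M N : Type u} [AddCommGroup M] [Module (Lam k n) M]
    [AddCommGroup N] [Module (Lam k n) N] (f : M →ₗ[Lam k n] N) (hf : Function.Injective f)
    (g : M →ₗ[Lam k n] Lam k n) : ∃ h : N →ₗ[Lam k n] Lam k n, h ∘ₗ f = g :=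
  Lam.baer.extension_property f hf g

end LamRing

/-! ### The modules `[i]` -/

section CycModule

variable {k : Type u} [Field k] {n : ℕ}

/-- The canonical generator of `[i] = Λ_n / (x^i)`. -/
def Cyc.gen (i : ℕ) : Cyc k n i := Ideal.Quotient.mk (Ideal.span {Lam.x k n ^ i}) 1

theorem Cyc.exists_smul_gen {i : ℕ} (y : Cyc k n i) : ∃ c : Lam k n, y = c • Cyc.gen i := by
  obtain ⟨c, rfl⟩ := Ideal.Quotient.mk_surjective y
  refine ⟨c, ?_⟩
  change Ideal.Quotient.mk (Ideal.span {Lam.x k n ^ i}) c = Ideal.Quotient.mk _ (c * 1)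
  rw [mul_one]

theorem Cyc.smul_gen_eq_zero_iff {i : ℕ} (c : Lam k n) :
    c • (Cyc.gen i : Cyc k n i) = 0 ↔ Lam.x k n ^ i ∣ c := by
  change Ideal.Quotient.mk (Ideal.span {Lam.x k n ^ i}) (c * 1) = 0 ↔ _
  rw [mul_one, Ideal.Quotient.eq_zero_iff_mem, Ideal.mem_span_singleton]

theorem Cyc.x_pow_smul {i : ℕ} (y : Cyc k n i) : Lam.x k n ^ i • y = 0 := by
  obtain ⟨c, rfl⟩ := Cyc.exists_smul_gen y
  rw [smul_smul, Cyc.smul_gen_eq_zero_iff]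
  exact dvd_mul_right _ _

variable {M : Type*} [AddCommGroup M] [Module (Lam k n) M]

/-- The linear map `[i] → M` which sends the canonical generator to an element killed by `x^i`. -/
def Cyc.lift (i : ℕ) (m : M) (hm : Lam.x k n ^ i • m = 0) : Cyc k n i →ₗ[Lam k n] M :=
  (Ideal.span {Lam.x k n ^ i}).liftQ (LinearMap.toSpanSingleton (Lam k n) M m) (by
    refine Submodule.span_le.2 (Set.singleton_subset_iff.2 ?_)
    simpa using hm)

@[simp]
theorem Cyc.lift_gen (i : ℕ) (m : M) (hm : Lam.x k n ^ i • m = 0) :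
    Cyc.lift i m hm (Cyc.gen i) = m := by
  change (LinearMap.toSpanSingleton (Lam k n) M m) 1 = m
  simp

theorem Cyc.hom_ext {i : ℕ} {f g : Cyc k n i →ₗ[Lam k n] M} (h : f (Cyc.gen i) = g (Cyc.gen i)) :
    f = g := by
  ext y
  obtain ⟨c, rfl⟩ := Cyc.exists_smul_gen y
  rw [map_smul, map_smul, h]

theorem Cyc.lift_injective {i : ℕ} {m : M} (hm : Lam.x k n ^ i • m = 0)
    (h : ∀ c : Lam k n, c • m = 0 → Lam.x k n ^ i ∣ c) : Function.Injective (Cyc.lift i m hm) := by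
  rw [injective_iff_map_eq_zero]
  intro y hy
  obtain ⟨c, rfl⟩ := Cyc.exists_smul_gen y
  rw [map_smul, Cyc.lift_gen] at hy
  exact (Cyc.smul_gen_eq_zero_iff c).2 (h c hy)

theorem Cyc.x_pow_smul_eq_zero_iff {i j : ℕ} (hj : j ≤ n) (hi : i ≤ j) (y : Cyc k n j) :
    Lam.x k n ^ i • y = 0 ↔ ∃ z : Cyc k n j, y = Lam.x k n ^ (j - i) • z := by
  constructor
  · intro h
    obtain ⟨c, rfl⟩ := Cyc.exists_smul_gen y
    obtain ⟨p, rfl⟩ := Lam.mk_surjective c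
    rw [smul_smul, Cyc.smul_gen_eq_zero_iff, Lam.x_pow i, ← map_mul,
      Lam.x_pow_dvd_mk_iff hj, ← Nat.add_sub_cancel' hi, pow_add,
      mul_dvd_mul_iff_left (pow_ne_zero _ Polynomial.X_ne_zero)] at h
    obtain ⟨q, rfl⟩ := h
    refine ⟨(Ideal.Quotient.mk _ q : Lam k n) • Cyc.gen j, ?_⟩
    rw [smul_smul, Lam.x_pow, ← map_mul]
  · rintro ⟨z, rfl⟩
    rw [smul_smul, ← pow_add, Nat.add_sub_cancel' hi]
    exact Cyc.x_pow_smul z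

/-- The modules `[j]` with `j ≤ n` are told apart by the powers of `x` which annihilate them. -/
theorem Cyc.x_pow_annihilates_iff {m j : ℕ} (hj : j ≤ n) :
    (∀ y : Cyc k n j, Lam.x k n ^ m • y = 0) ↔ j ≤ m := by
  constructor
  · intro h
    have := h (Cyc.gen j)
    rwa [Cyc.smul_gen_eq_zero_iff, Lam.x_pow_dvd_x_pow_iff hj] at this
  · intro h y
    obtain ⟨d, rfl⟩ := Nat.exists_eq_add_of_le' h
    rw [pow_add, mul_smul, Cyc.x_pow_smul, smul_zero]

theorem Cyc.eq_of_equiv {i j : ℕ} (hi : i ≤ n) (hj : j ≤ n)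
    (e : Cyc k n i ≃ₗ[Lam k n] Cyc k n j) : i = j := by
  apply le_antisymm
  · rw [← Cyc.x_pow_annihilates_iff (k := k) hi]
    intro y
    rw [← e.map_eq_zero_iff, map_smul, Cyc.x_pow_smul]
  · rw [← Cyc.x_pow_annihilates_iff (k := k) hj]
    intro y
    rw [← e.symm.map_eq_zero_iff, map_smul, Cyc.x_pow_smul]

/-- The module `[n]` is the regular module `Λ_n`. -/
def Cyc.equivLam : Cyc k n n ≃ₗ[Lam k n] Lam k n :=
  LinearEquiv.ofBijective (Cyc.lift n 1 (by rw [smul_eq_mul, Lam.x_pow_n, zero_mul]))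
    ⟨Cyc.lift_injective _ fun c hc => by
      rw [smul_eq_mul, mul_one] at hc
      rw [hc]; exact dvd_zero _,
    fun c => ⟨c • Cyc.gen n, by rw [map_smul, Cyc.lift_gen, smul_eq_mul, mul_one]⟩⟩

theorem finLen_lam : IsFiniteLength (Lam k n) (Lam k n) := by
  rw [isFiniteLength_iff_isNoetherian_isArtinian]
  have : Module.Finite k (Lam k n) := (Polynomial.monic_X_pow n).finite_quotient
  have : IsArtinianRing (Lam k n) := IsArtinianRing.of_finite k _
  exact ⟨inferInstance, inferInstance⟩

theorem finLen_of_finite (M : Type*) [AddCommGroup M] [Module (Lam k n) M]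
    [Module.Finite (Lam k n) M] : IsFiniteLength (Lam k n) M := by
  obtain ⟨m, f, hf⟩ := Module.Finite.exists_fin' (Lam k n) M
  have h := finLen_pi (fun _ : Fin m => Lam k n) fun _ => finLen_lam
  rw [isFiniteLength_iff_isNoetherian_isArtinian] at h ⊢
  obtain ⟨_, _⟩ := h
  exact ⟨isNoetherian_of_surjective f (LinearMap.range_eq_top.2 hf),
    isArtinian_of_surjective _ f hf⟩

/-- The modules `[c]` with `c ≤ n` generate `mod Λ_n` additively: the identity of a module of finite
length is a finite sum of maps which factor through such modules. -/
theorem exists_sum_cyc_eq_id (M : Type u) [AddCommGroup M] [Module (Lam k n) M]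
    [Module.Finite (Lam k n) M] :
    ∃ (m : ℕ) (c : Fin m → ℕ) (_ : ∀ a, c a ≤ n) (i : ∀ a, M →ₗ[Lam k n] Cyc k n (c a))
      (p : ∀ a, Cyc k n (c a) →ₗ[Lam k n] M), ∑ a, p a ∘ₗ i a = LinearMap.id := by
  classical
  let _ : Module (Polynomial k) M :=
    Module.compHom M (Ideal.Quotient.mk (Ideal.span {(Polynomial.X : Polynomial k) ^ n}))
  have hsmul : ∀ (p : Polynomial k) (y : M),
      p • y = (Ideal.Quotient.mk _ p : Lam k n) • y := fun _ _ => rfl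
  have : IsScalarTower (Polynomial k) (Lam k n) M := ⟨fun p c y => by
    rw [hsmul, smul_smul]; rfl⟩
  have : Module.Finite (Polynomial k) M := Module.Finite.trans (Lam k n) M
  have hX : ∀ y : M, (Polynomial.X ^ n : Polynomial k) • y = 0 := fun y => by
    rw [hsmul, (Lam.mk_eq_zero_iff _).2 dvd_rfl]
    exact zero_smul (Lam k n) y
  obtain ⟨m, c, ⟨e⟩⟩ := Module.torsion_by_prime_power_decomposition
    (Polynomial.irreducible_X (R := k)) (M := M)
    (fun y => ⟨⟨_, n, rfl⟩, hX y⟩)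
  let e' := e ≪≫ₗ DirectSum.linearEquivFunOnFintype (Polynomial k) (Fin m)
    fun a => Polynomial k ⧸ Polynomial k ∙ (Polynomial.X : Polynomial k) ^ c a
  -- the generators of the cyclic summands, as elements of `M`
  let g : ∀ a, M := fun a => e'.symm (Pi.single a (Submodule.Quotient.mk 1))
  have hg : ∀ a (q : Polynomial k), q • g a = e'.symm (Pi.single a (Submodule.Quotient.mk q)) := by
    intro a q
    rw [← map_smul, ← Pi.single_smul, ← Submodule.Quotient.mk_smul, smul_eq_mul, mul_one]
  have hg0 : ∀ a (q : Polynomial k), q • g a = 0 ↔ Polynomial.X ^ c a ∣ q := by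
    intro a q
    rw [hg, map_eq_zero_iff _ e'.symm.injective, Pi.single_eq_zero_iff,
      Submodule.Quotient.mk_eq_zero]
    exact Ideal.mem_span_singleton
  have hc : ∀ a, c a ≤ n := fun a =>
    (pow_dvd_pow_iff Polynomial.X_ne_zero Polynomial.not_isUnit_X).1 ((hg0 a _).1 (hX (g a)))
  have hgx : ∀ a, Lam.x k n ^ c a • g a = 0 := fun a => by rw [Lam.x_pow, ← hsmul, hg0]
  let β : ∀ a, (Polynomial k ⧸ Polynomial k ∙ (Polynomial.X : Polynomial k) ^ c a) →+
      Cyc k n (c a) := fun a =>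
    QuotientAddGroup.lift _ (AddMonoidHom.mk' (fun q : Polynomial k =>
      (Ideal.Quotient.mk _ q : Lam k n) • (Cyc.gen (c a) : Cyc k n (c a)))
      fun p q => by rw [map_add, add_smul]) (fun q hq => by
        refine (Cyc.smul_gen_eq_zero_iff _).2 ((Lam.x_pow_dvd_mk_iff (hc a) q).2 ?_)
        exact Ideal.mem_span_singleton.1 hq)
  have hβ : ∀ a (q : Polynomial k), β a (Submodule.Quotient.mk q) =
      (Ideal.Quotient.mk _ q : Lam k n) • (Cyc.gen (c a) : Cyc k n (c a)) := fun _ _ => rfl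
  refine ⟨m, c, hc, fun a =>
    { toFun := fun y => β a (e' y a)
      map_add' := fun y z => by rw [map_add, Pi.add_apply, map_add]
      map_smul' := fun r y => ?_ },
    fun a => Cyc.lift (c a) (g a) (hgx a), ?_⟩
  · obtain ⟨r, rfl⟩ := Lam.mk_surjective r
    rw [← hsmul, map_smul, Pi.smul_apply]
    obtain ⟨q, hq⟩ := Submodule.Quotient.mk_surjective _ (e' y a)
    rw [← hq, ← Submodule.Quotient.mk_smul, hβ, hβ, smul_eq_mul, map_mul, mul_smul]
    rfl
  · ext y
    rw [LinearMap.sum_apply, LinearMap.id_apply]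
    have hy : ∑ a, e'.symm (Pi.single a (e' y a)) = y := by
      rw [← map_sum, Finset.univ_sum_single, e'.symm_apply_apply]
    refine Eq.trans (Finset.sum_congr rfl fun a _ => ?_) hy
    change Cyc.lift (c a) (g a) (hgx a) (β a (e' y a)) = _
    obtain ⟨q, hq⟩ := Submodule.Quotient.mk_surjective _ (e' y a)
    rw [← hq, hβ, map_smul, Cyc.lift_gen, ← hsmul, hg]

end CycModule

/-! ### The abelian category `mod R` -/

section FinMod

variable {R : Type u} [Ring R]

instance : (finLen R).ContainsZero where
  exists_zero := ⟨ModuleCat.of R PUnit, ModuleCat.isZero_of_subsingleton _, .of_subsingleton⟩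

instance : (finLen R).IsClosedUnderSubobjects where
  prop_of_mono {X Y} f _ hY := by
    have hf := (ModuleCat.mono_iff_injective f).1 inferInstance
    rw [finLen, isFiniteLength_iff_isNoetherian_isArtinian] at hY ⊢
    obtain ⟨_, _⟩ := hY
    exact ⟨isNoetherian_of_injective f.hom hf, isArtinian_of_injective f.hom hf⟩

instance : (finLen R).IsClosedUnderQuotients where
  prop_of_epi {X Y} f _ hX := by
    have hf := (ModuleCat.epi_iff_surjective f).1 inferInstance
    rw [finLen, isFiniteLength_iff_isNoetherian_isArtinian] at hX ⊢
    obtain ⟨_, _⟩ := hX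
    exact ⟨isNoetherian_of_surjective f.hom (LinearMap.range_eq_top.2 hf),
      isArtinian_of_surjective _ f.hom hf⟩

instance : (finLen R).IsClosedUnderFiniteProducts where
  isClosedUnderLimitsOfShape J _ :=
    { limitsOfShape_le := by
        rintro X ⟨p⟩
        let t : X ⟶ ModuleCat.of R (∀ j : J, p.diag.obj ⟨j⟩) :=
          ModuleCat.ofHom (LinearMap.pi fun j => (p.π.app ⟨j⟩).hom)
        have : Mono t := ⟨fun g h hgh => p.isLimit.hom_ext fun ⟨j⟩ => by
          ext z
          exact congrFun (congrArg (fun q => q.hom z) hgh) j⟩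
        exact (finLen R).prop_of_mono t (finLen_pi _ fun j => p.prop_diag_obj ⟨j⟩) }

instance : Abelian (FinMod R) := inferInstance

theorem FinMod.surjective_of_epi {M N : FinMod R} (f : M ⟶ N) [Epi f] :
    Function.Surjective (FinMod.lin f) := by
  let q : N ⟶ FinMod.of R (N.obj ⧸ LinearMap.range (FinMod.lin f))
      (finLen_quotient N.property _) := FinMod.ofHom (Submodule.mkQ _)
  have hq : q = 0 := by
    rw [← cancel_epi f, comp_zero]
    ext x
    exact (Submodule.Quotient.mk_eq_zero _).2 ⟨x, rfl⟩
  rw [← LinearMap.range_eq_top, eq_top_iff]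
  intro y _
  exact (Submodule.Quotient.mk_eq_zero _).1 (congrArg (fun t => FinMod.lin t y) hq)

theorem FinMod.isZero_iff {M : FinMod R} : IsZero M ↔ ∀ x : M.obj, x = 0 := by
  rw [IsZero.iff_id_eq_zero]
  constructor
  · intro h x
    exact congrArg (fun t => FinMod.lin t x) h
  · intro h
    ext x
    exact h x

/-- A bijective linear map is an isomorphism of `mod R`. -/
def FinMod.isoOfEquiv {M N : FinMod R} (e : M.obj ≃ₗ[R] N.obj) : M ≅ N where
  hom := FinMod.ofHom e.toLinearMap
  inv := FinMod.ofHom e.symm.toLinearMap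
  hom_inv_id := by
    ext x
    exact e.symm_apply_apply x
  inv_hom_id := by
    ext x
    exact e.apply_symm_apply x

end FinMod

/-! ### The category of pairs -/

section PairCat

variable {R : Type u} [CommRing R]

theorem Pair.isZero_iff {P : Pair R} : IsZero P ↔ ∀ y : P.amb.obj, y = 0 := by
  rw [IsZero.iff_id_eq_zero]
  constructor
  · intro h y
    exact congrArg (fun t => Pair.Hom.lin t y) h
  · intro h
    ext y
    exact h y

@[simp]
theorem Pair.sum_lin {P Q : Pair R} {ι : Type*} (s : Finset ι) (f : ι → (P ⟶ Q)) :
    (∑ i ∈ s, f i : P ⟶ Q).lin = ∑ i ∈ s, (f i).lin :=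
  map_sum (Pair.linHom P Q) f s

@[simp] theorem Pair.sub_lin {P Q : Pair R} (f g : P ⟶ Q) : (f - g).lin = f.lin - g.lin :=
  map_sub (Pair.linHom P Q) f g

/-- Isomorphisms of pairs are the linear isomorphisms which match the submodules. -/
def Pair.isoMk {P Q : Pair R} (e : P.amb.obj ≃ₗ[R] Q.amb.obj)
    (h : ∀ y, y ∈ P.sub ↔ e y ∈ Q.sub) : P ≅ Q where
  hom := ⟨e.toLinearMap, fun y hy => (h y).1 hy⟩
  inv := ⟨e.symm.toLinearMap, fun y hy => (h _).2 (by simpa using hy)⟩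
  hom_inv_id := by
    ext y
    exact e.symm_apply_apply y
  inv_hom_id := by
    ext y
    exact e.apply_symm_apply y

/-- The linear isomorphism underlying an isomorphism of pairs. -/
def Pair.equivOfIso {P Q : Pair R} (e : P ≅ Q) : P.amb.obj ≃ₗ[R] Q.amb.obj :=
  LinearEquiv.ofLinearMap e.hom.lin e.inv.lin (congrArg Pair.Hom.lin e.inv_hom_id)
    (congrArg Pair.Hom.lin e.hom_inv_id)

/-- The isomorphism of submodules underlying an isomorphism of pairs. -/
def Pair.subEquivOfIso {P Q : Pair R} (e : P ≅ Q) : P.sub ≃ₗ[R] Q.sub :=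
  LinearEquiv.ofLinearMap (e.hom.lin.restrict e.hom.map_sub) (e.inv.lin.restrict e.inv.map_sub)
    (LinearMap.ext fun y => Subtype.ext ((Pair.equivOfIso e).apply_symm_apply y))
    (LinearMap.ext fun y => Subtype.ext ((Pair.equivOfIso e).symm_apply_apply y))

instance : IsIdempotentComplete (Pair R) where
  idempotents_split P p hp := by
    have hp' : ∀ y, p.lin (p.lin y) = p.lin y := fun y =>
      congrArg (fun t => Pair.Hom.lin t y) hp
    let Q : Pair R := ⟨FinMod.of R (LinearMap.range p.lin) (finLen_submodule P.amb.property _),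
      P.sub.comap (LinearMap.range p.lin).subtype⟩
    let i : Q ⟶ P := ⟨(LinearMap.range p.lin).subtype, le_rfl⟩
    let e : P ⟶ Q := ⟨p.lin.rangeRestrict, p.map_sub⟩
    refine ⟨Q, i, e, ?_, ?_⟩
    · ext y
      obtain ⟨_, y, rfl⟩ := y
      exact hp' y
    · rfl

end PairCat

/-! ### Pickets -/

section Pickets

variable (k : Type u) [Field k] (n : ℕ)

theorem finLen_cyc (j : ℕ) : IsFiniteLength (Lam k n) (Cyc k n j) := finLen_of_finite _

/-- The standard pair of the form `([i], [j])` for `i ≤ j ≤ n`. The unique submodule of `[j]` of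
length `i` is encoded as the set of elements killed by `x^i`. -/
abbrev stdPicket (i j : ℕ) : S k n :=
  ⟨FinMod.of _ (Cyc k n j) (finLen_cyc k n j), Submodule.torsionBy _ _ (Lam.x k n ^ i)⟩

variable {k n}

theorem mem_stdPicket_sub {i j : ℕ} (y : Cyc k n j) :
    y ∈ (stdPicket k n i j).sub ↔ Lam.x k n ^ i • y = 0 :=
  Submodule.mem_torsionBy_iff _ _

/-- The submodule of the standard pair `([i], [j])` is `[i]`. -/
def stdPicketSubEquiv {i j : ℕ} (hij : i ≤ j) (hj : j ≤ n) :
    Cyc k n i ≃ₗ[Lam k n] (stdPicket k n i j).sub :=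
  have h0 : Lam.x k n ^ i • (Lam.x k n ^ (j - i) • Cyc.gen j : Cyc k n j) = 0 := by
    rw [smul_smul, ← pow_add, Nat.add_sub_cancel' hij, Cyc.x_pow_smul]
  LinearEquiv.ofBijective ((Cyc.lift i (Lam.x k n ^ (j - i) • Cyc.gen j : Cyc k n j) h0).codRestrict
    (stdPicket k n i j).sub fun y => (mem_stdPicket_sub _).2 <| by
      rw [← map_smul, Cyc.x_pow_smul, map_zero]) (by
    constructor
    · rw [LinearMap.injective_codRestrict_iff]
      refine Cyc.lift_injective h0 fun c hc => ?_
      obtain ⟨p, rfl⟩ := Lam.mk_surjective c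
      rw [smul_smul, mul_comm, Cyc.smul_gen_eq_zero_iff, Lam.x_pow (j - i), ← map_mul,
        Lam.x_pow_dvd_mk_iff hj] at hc
      rw [Lam.x_pow_dvd_mk_iff (hij.trans hj)]
      refine (mul_dvd_mul_iff_left (pow_ne_zero (j - i) (Polynomial.X_ne_zero (R := k)))).1 ?_
      rwa [← pow_add, Nat.sub_add_cancel hij]
    · rintro ⟨y, hy⟩
      obtain ⟨z, rfl⟩ := (Cyc.x_pow_smul_eq_zero_iff hj hij y).1 ((mem_stdPicket_sub y).1 hy)
      obtain ⟨c, rfl⟩ := Cyc.exists_smul_gen z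
      refine ⟨c • Cyc.gen i, Subtype.ext ?_⟩
      change Cyc.lift i _ h0 _ = _
      rw [map_smul, Cyc.lift_gen, smul_comm])

theorem isPicket_stdPicket {i j : ℕ} (hij : i ≤ j) (hj : j ≤ n) :
    IsPicket i j (stdPicket k n i j) :=
  ⟨hij, hj, ⟨(stdPicketSubEquiv hij hj).symm⟩, ⟨LinearEquiv.refl _ _⟩⟩

theorem IsPicket.nonempty_iso {i j : ℕ} {P : S k n} (h : IsPicket i j P) :
    Nonempty (P ≅ stdPicket k n i j) := by
  obtain ⟨hij, hj, ⟨f⟩, ⟨e⟩⟩ := h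
  have hle : ∀ y, y ∈ P.sub → e y ∈ (stdPicket k n i j).sub := fun y hy => by
    have h0 : Lam.x k n ^ i • (⟨y, hy⟩ : P.sub) = 0 := by
      rw [← f.map_eq_zero_iff, map_smul, Cyc.x_pow_smul]
    have h1 : Lam.x k n ^ i • y = 0 := congrArg Subtype.val h0
    exact (mem_stdPicket_sub _).2 (by rw [← map_smul, h1, map_zero])
  -- `[i] ≅ X → (stdPicket i j).sub ≅ [i]` is an injective endomorphism of an artinian module
  let t : Cyc k n i →ₗ[Lam k n] Cyc k n i :=
    (stdPicketSubEquiv hij hj).symm.toLinearMap ∘ₗ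
      (e.toLinearMap.restrict hle) ∘ₗ f.symm.toLinearMap
  have ht : Function.Injective t := by
    intro y z hyz
    have h := (stdPicketSubEquiv hij hj).symm.injective hyz
    exact f.symm.injective (Subtype.ext (e.injective (congrArg Subtype.val h)))
  have := (isFiniteLength_iff_isNoetherian_isArtinian.1 (finLen_cyc k n i)).2
  have ht' := IsArtinian.surjective_of_injective_endomorphism t ht
  refine ⟨Pair.isoMk e fun y => ⟨hle y, fun hy => ?_⟩⟩
  obtain ⟨w, hw⟩ := ht' ((stdPicketSubEquiv hij hj).symm ⟨e y, hy⟩)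
  have hw' := congrArg Subtype.val ((stdPicketSubEquiv hij hj).symm.injective hw)
  have : ((f.symm w : P.sub) : P.amb.obj) = y := e.injective hw'
  rw [← this]
  exact (f.symm w).2

theorem eq_of_stdPicket_iso {i j i' j' : ℕ} (hij : i ≤ j) (hj : j ≤ n) (hij' : i' ≤ j')
    (hj' : j' ≤ n) (e : stdPicket k n i j ≅ stdPicket k n i' j') : i = i' ∧ j = j' :=
  ⟨Cyc.eq_of_equiv (hij.trans hj) (hij'.trans hj') (stdPicketSubEquiv hij hj ≪≫ₗ
    Pair.subEquivOfIso e ≪≫ₗ (stdPicketSubEquiv hij' hj').symm),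
    Cyc.eq_of_equiv hj hj' (Pair.equivOfIso e)⟩

theorem isZero_stdPicket_iff {i j : ℕ} (hj : j ≤ n) : IsZero (stdPicket k n i j) ↔ j = 0 := by
  rw [Pair.isZero_iff, ← Nat.le_zero, ← Cyc.x_pow_annihilates_iff (k := k) hj]
  simp only [pow_zero, one_smul]

/-- An endomorphism of `[j]` is the multiplication by an element of the local ring `Λ_n`; if that
element is a unit, its inverse preserves each submodule of `[j]`. -/
theorem localEnd_stdPicket (i j : ℕ) : LocalEnd (stdPicket k n i j) := by
  have key : ∀ (f : stdPicket k n i j ⟶ stdPicket k n i j) (c : (Lam k n)ˣ),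
      f.lin (Cyc.gen j) = (c : Lam k n) • Cyc.gen j → IsIso f := by
    intro f c hc
    have hf : f.lin = (c : Lam k n) • LinearMap.id := Cyc.hom_ext hc
    refine isIso_of_comp_eq_id (g := ⟨((c⁻¹ : (Lam k n)ˣ) : Lam k n) • LinearMap.id,
      fun y hy => Submodule.smul_mem _ _ hy⟩) ?_ ?_
    · apply Pair.hom_ext
      ext y
      simp [hf, smul_smul]
    · apply Pair.hom_ext
      ext y
      simp [hf, smul_smul]
  intro f
  obtain ⟨c, hc⟩ := Cyc.exists_smul_gen (f.lin (Cyc.gen j))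
  rcases Lam.isUnit_or_isUnit_one_sub c with ⟨w, rfl⟩ | ⟨w, hw⟩
  · exact Or.inl (key f w hc)
  · refine Or.inr (key _ w ?_)
    rw [hw]
    refine Eq.trans ?_ (sub_smul (1 : Lam k n) c (Cyc.gen j : Cyc k n j)).symm
    rw [one_smul, Pair.sub_lin, LinearMap.sub_apply, hc]
    rfl

end Pickets

/-! ### Maps which factor through a free module -/

section ProjMaps

variable {R : Type*} [CommRing R] {M N N' L : Type*} [AddCommGroup M] [Module R M]
  [AddCommGroup N] [Module R N] [AddCommGroup N'] [Module R N'] [AddCommGroup L] [Module R L]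

theorem linearMap_comp_sum {ι : Type*} (s : Finset ι) (g : N →ₗ[R] L) (f : ι → (M →ₗ[R] N)) :
    g ∘ₗ ∑ i ∈ s, f i = ∑ i ∈ s, g ∘ₗ f i := by
  ext z; simp [LinearMap.sum_apply]

theorem linearMap_sum_comp {ι : Type*} (s : Finset ι) (g : ι → (N →ₗ[R] L)) (f : M →ₗ[R] N) :
    (∑ i ∈ s, g i) ∘ₗ f = ∑ i ∈ s, g i ∘ₗ f := by
  ext z; simp [LinearMap.sum_apply]

section

variable {ι : Type*} [Fintype ι] {C : ι → Type*} [∀ a, AddCommGroup (C a)] [∀ a, Module R (C a)]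
  {p : ∀ a, C a →ₗ[R] N} {i : ∀ a, N →ₗ[R] C a} (h : ∑ a, p a ∘ₗ i a = LinearMap.id)

include h

theorem sum_apply_of_sum_comp_eq_id (z : N) : ∑ a, p a (i a z) = z := by
  have := LinearMap.congr_fun h z
  rwa [LinearMap.sum_apply] at this

theorem sum_comp_of_sum_comp_eq_id (f : M →ₗ[R] N) : ∑ a, p a ∘ₗ i a ∘ₗ f = f := by
  ext z
  rw [LinearMap.sum_apply]
  exact sum_apply_of_sum_comp_eq_id h (f z)

end

variable (R M N) in
/-- The group of linear maps which factor through a finitely generated free module, as the group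
generated by the maps which factor through `R`. -/
def projMaps : AddSubgroup (M →ₗ[R] N) :=
  AddSubgroup.closure {f | ∃ (β : M →ₗ[R] R) (y : N), f = β.smulRight y}

theorem smulRight_mem_projMaps (β : M →ₗ[R] R) (y : N) : β.smulRight y ∈ projMaps R M N :=
  AddSubgroup.subset_closure ⟨β, y, rfl⟩

theorem projMaps_induction {p : ∀ f : M →ₗ[R] N, f ∈ projMaps R M N → Prop}
    (h : ∀ (β : M →ₗ[R] R) (y : N), p (β.smulRight y) (smulRight_mem_projMaps β y))
    (zero : p 0 (zero_mem _))
    (add : ∀ f g hf hg, p f hf → p g hg → p (f + g) (add_mem hf hg))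
    (neg : ∀ f hf, p f hf → p (-f) (neg_mem hf))
    {f : M →ₗ[R] N} (hf : f ∈ projMaps R M N) : p f hf :=
  AddSubgroup.closure_induction (by rintro _ ⟨β, y, rfl⟩; exact h β y) zero add neg hf

theorem comp_mem_projMaps (g : N →ₗ[R] L) {f : M →ₗ[R] N} (hf : f ∈ projMaps R M N) :
    g ∘ₗ f ∈ projMaps R M L := by
  induction hf using projMaps_induction with
  | h β y =>
    have : g ∘ₗ β.smulRight y = β.smulRight (g y) := by ext z; simp
    rw [this]; exact smulRight_mem_projMaps _ _
  | zero => rw [LinearMap.comp_zero]; exact zero_mem _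
  | add f f' _ _ h h' => rw [LinearMap.comp_add]; exact add_mem h h'
  | neg f _ h => rw [LinearMap.comp_neg]; exact neg_mem h

theorem mem_projMaps_comp (g : L →ₗ[R] M) {f : M →ₗ[R] N} (hf : f ∈ projMaps R M N) :
    f ∘ₗ g ∈ projMaps R L N := by
  induction hf using projMaps_induction with
  | h β y =>
    have : β.smulRight y ∘ₗ g = (β ∘ₗ g).smulRight y := by ext z; simp
    rw [this]; exact smulRight_mem_projMaps _ _
  | zero => rw [LinearMap.zero_comp]; exact zero_mem _
  | add f f' _ _ h h' => rw [LinearMap.add_comp]; exact add_mem h h'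
  | neg f _ h => rw [LinearMap.neg_comp]; exact neg_mem h

theorem mem_projMaps_of_dom (f : R →ₗ[R] N) : f ∈ projMaps R R N := by
  have : f = LinearMap.id.smulRight (f 1) := by ext; simp
  rw [this]; exact smulRight_mem_projMaps _ _

theorem mem_projMaps_of_free {m : ℕ} (f : (Fin m → R) →ₗ[R] N) :
    f ∈ projMaps R (Fin m → R) N := by
  classical
  have : f = ∑ i, f ∘ₗ LinearMap.single R (fun _ => R) i ∘ₗ LinearMap.proj i := by
    refine LinearMap.ext fun z => ?_
    rw [LinearMap.sum_apply]
    conv_lhs => rw [← Finset.univ_sum_single z, map_sum]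
    rfl
  rw [this]
  refine sum_mem fun i _ => ?_
  rw [← LinearMap.comp_assoc]
  exact mem_projMaps_comp _ (mem_projMaps_of_dom _)

theorem mem_projMaps_comp_of_free {m : ℕ} (f : (Fin m → R) →ₗ[R] N) (g : M →ₗ[R] (Fin m → R)) :
    f ∘ₗ g ∈ projMaps R M N :=
  mem_projMaps_comp g (mem_projMaps_of_free f)

/-- Maps through free modules lift along surjections. -/
theorem exists_lift_of_mem_projMaps (π : L →ₗ[R] N) (hπ : Function.Surjective π)
    {f : M →ₗ[R] N} (hf : f ∈ projMaps R M N) : ∃ g ∈ projMaps R M L, π ∘ₗ g = f := by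
  induction hf using projMaps_induction with
  | h β y =>
    obtain ⟨z, rfl⟩ := hπ y
    exact ⟨β.smulRight z, smulRight_mem_projMaps _ _, by ext; simp⟩
  | zero => exact ⟨0, zero_mem _, LinearMap.comp_zero _⟩
  | add f f' _ _ h h' =>
    obtain ⟨g, hg, rfl⟩ := h
    obtain ⟨g', hg', rfl⟩ := h'
    exact ⟨g + g', add_mem hg hg', LinearMap.comp_add _ _ _⟩
  | neg f _ h =>
    obtain ⟨g, hg, rfl⟩ := h
    exact ⟨-g, neg_mem hg, LinearMap.comp_neg _ _⟩

/-- Over the self-injective ring `Λ_n`, maps through free modules extend along injections. -/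
theorem exists_extend_of_mem_projMaps {k : Type u} [Field k] {n : ℕ} {X Y N : Type u}
    [AddCommGroup X] [Module (Lam k n) X] [AddCommGroup Y] [Module (Lam k n) Y]
    [AddCommGroup N] [Module (Lam k n) N] (i : X →ₗ[Lam k n] Y) (hi : Function.Injective i)
    {f : X →ₗ[Lam k n] N} (hf : f ∈ projMaps (Lam k n) X N) :
    ∃ g ∈ projMaps (Lam k n) Y N, g ∘ₗ i = f := by
  induction hf using projMaps_induction with
  | h β y =>
    obtain ⟨β', rfl⟩ := Lam.exists_extend i hi β
    exact ⟨β'.smulRight y, smulRight_mem_projMaps _ _, by ext; simp⟩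
  | zero => exact ⟨0, zero_mem _, LinearMap.zero_comp _⟩
  | add f f' _ _ h h' =>
    obtain ⟨g, hg, rfl⟩ := h
    obtain ⟨g', hg', rfl⟩ := h'
    exact ⟨g + g', add_mem hg hg', LinearMap.add_comp _ _ _⟩
  | neg f _ h =>
    obtain ⟨g, hg, rfl⟩ := h
    exact ⟨-g, neg_mem hg, LinearMap.neg_comp _ _⟩

end ProjMaps

/-! ### The Auslander generator -/

section Generator

variable {k : Type u} [Field k] {n : ℕ}

theorem exists_cyc_retract_ausGen {c : ℕ} (hc : c ≤ n) :
    ∃ (i : Cyc k n c →ₗ[Lam k n] AusGen k n) (p : AusGen k n →ₗ[Lam k n] Cyc k n c),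
      p ∘ₗ i = LinearMap.id := by
  cases c with
  | zero =>
    refine ⟨0, 0, LinearMap.ext fun y => ?_⟩
    have := Cyc.x_pow_smul y
    rw [pow_zero, one_smul] at this
    rw [this, map_zero, map_zero]
  | succ l =>
    refine ⟨LinearMap.single (Lam k n) (fun i : Fin n => Cyc k n (i.val + 1)) ⟨l, hc⟩,
      LinearMap.proj (⟨l, hc⟩ : Fin n), LinearMap.ext fun y => ?_⟩
    exact Pi.single_eq_same (M := fun i : Fin n => Cyc k n (i.val + 1)) ⟨l, hc⟩ y

/-- Every finite module is a direct summand of a power of `E`. -/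
theorem exists_sum_ausGen_eq_id (M : Type u) [AddCommGroup M] [Module (Lam k n) M]
    [Module.Finite (Lam k n) M] :
    ∃ (m : ℕ) (i : Fin m → (M →ₗ[Lam k n] AusGen k n)) (p : Fin m → (AusGen k n →ₗ[Lam k n] M)),
      ∑ a, p a ∘ₗ i a = LinearMap.id := by
  obtain ⟨m, c, hc, i, p, h⟩ := exists_sum_cyc_eq_id (k := k) (n := n) M
  choose j q hjq using fun a => exists_cyc_retract_ausGen (k := k) (hc a)
  refine ⟨m, fun a => j a ∘ₗ i a, fun a => p a ∘ₗ q a, ?_⟩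
  rw [← h]
  refine Finset.sum_congr rfl fun a _ => ?_
  change p a ∘ₗ (q a ∘ₗ j a) ∘ₗ i a = _
  rw [hjq, LinearMap.id_comp]

theorem finite_of_finLen {R : Type*} [Ring R] {M : Type*} [AddCommGroup M] [Module R M]
    (h : IsFiniteLength R M) : Module.Finite R M := by
  have := (isFiniteLength_iff_isNoetherian_isArtinian.1 h).1
  infer_instance

instance (M : FinMod (Lam k n)) : Module.Finite (Lam k n) M.obj := finite_of_finLen M.property

theorem idem_smul_single {l : Fin n} (hl : l.val + 1 = n) {N : Type u} [AddCommGroup N]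
    [Module (Lam k n) N] (h : AusGen k n →ₗ[Lam k n] N) (z : AusGen k n) :
    (AusAlg.idem k n n • h) z = h (Pi.single l (z l)) := by
  change h (fun j => (if j.val + 1 = n then LinearMap.proj j else 0 :
    AusGen k n →ₗ[Lam k n] Cyc k n (j.val + 1)) z) = _
  congr 1
  ext j
  by_cases hj : j = l
  · subst hj
    rw [if_pos hl, Pi.single_eq_same]
    rfl
  · rw [if_neg (fun h => hj (Fin.ext (by omega))), Pi.single_eq_of_ne hj]
    rfl

variable {N : Type u} [AddCommGroup N] [Module (Lam k n) N]

/-- The maps `E → N` which factor through `[n]` are those which factor through the free module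
`Λ_n`. -/
theorem idem_smul_mem_projMaps (hn : 1 ≤ n) (h : AusGen k n →ₗ[Lam k n] N) :
    AusAlg.idem k n n • h ∈ projMaps (Lam k n) (AusGen k n) N := by
  let l : Fin n := ⟨n - 1, by omega⟩
  have hl : l.val + 1 = n := Nat.sub_add_cancel hn
  have h1 : Lam.x k n ^ (l.val + 1) • (1 : Lam k n) = 0 := by
    rw [hl, Lam.x_pow_n, smul_eq_mul, zero_mul]
  have : AusAlg.idem k n n • h = (Cyc.lift _ 1 h1 ∘ₗ LinearMap.proj l :
      AusGen k n →ₗ[Lam k n] Lam k n).smulRight (h (Pi.single l (Cyc.gen _))) := by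
    refine LinearMap.ext fun z => ?_
    rw [idem_smul_single hl, LinearMap.smulRight_apply, LinearMap.comp_apply, LinearMap.proj_apply]
    obtain ⟨c, hc⟩ := Cyc.exists_smul_gen (z l)
    rw [hc, map_smul, Cyc.lift_gen, Pi.single_smul, map_smul, smul_eq_mul, mul_one]
  rw [this]
  exact smulRight_mem_projMaps _ _

theorem exists_smul_idem_smul_eq (hn : 1 ≤ n) (β : AusGen k n →ₗ[Lam k n] Lam k n) (y : N) :
    ∃ (a : AusAlg k n) (h : AusGen k n →ₗ[Lam k n] N),
      β.smulRight y = a • AusAlg.idem k n n • h := by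
  let l : Fin n := ⟨n - 1, by omega⟩
  have hl : l.val + 1 = n := Nat.sub_add_cancel hn
  have h1 : Lam.x k n ^ (l.val + 1) • (1 : Lam k n) = 0 := by
    rw [hl, Lam.x_pow_n, smul_eq_mul, zero_mul]
  refine ⟨MulOpposite.op (LinearMap.single (Lam k n) (fun i : Fin n => Cyc k n (i.val + 1)) l ∘ₗ
      β.smulRight (Cyc.gen _)),
    LinearMap.toSpanSingleton _ _ y ∘ₗ (Cyc.lift _ 1 h1 ∘ₗ LinearMap.proj l :
      AusGen k n →ₗ[Lam k n] Lam k n), ?_⟩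
  refine LinearMap.ext fun z => ?_
  have : (Pi.single l (β z • Cyc.gen _) : AusGen k n) l = β z • Cyc.gen _ := Pi.single_eq_same _ _
  rw [op_smul_hom, LinearMap.comp_apply, idem_smul_single hl]
  change _ = Cyc.lift _ 1 h1 ((Pi.single l ((Pi.single l (β z • Cyc.gen _) : AusGen k n) l) :
    AusGen k n) l) • y
  rw [this, this, map_smul, Cyc.lift_gen, smul_eq_mul, mul_one, LinearMap.smulRight_apply]

end Generator

/-! ### The functor `δα` -/

section CokerFunctor

variable {k : Type u} [Field k] {n : ℕ} {T : Type u} [Ring T] (φ : T ≃+* FactorAlg k n)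

/-- The functor `δα`, with values in the modules over a ring `T` which is identified with
`A_n / ⟨e(n)⟩`. -/
abbrev deltaAlpha : Arrow (FinMod (Lam k n)) ⥤ FinMod T :=
  alpha (AusGen k n) ⋙ delta (AusAlg.idem k n n) ⋙ restrict φ

/-- The ring homomorphism `A_n → T`. -/
def ausToRing : AusAlg k n →+* T :=
  φ.symm.toRingHom.comp (Ideal.Quotient.mk _)

theorem ausToRing_surjective : Function.Surjective (ausToRing φ) :=
  φ.symm.surjective.comp Ideal.Quotient.mk_surjective

theorem ausToRing_idem : ausToRing φ (AusAlg.idem k n n) = 0 := by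
  have : Ideal.Quotient.mk (idealOf (AusAlg.idem k n n)) (AusAlg.idem k n n) = 0 := by
    rw [Ideal.Quotient.eq_zero_iff_mem, TwoSidedIdeal.mem_asIdeal]
    exact TwoSidedIdeal.subset_span rfl
  change φ.symm (Ideal.Quotient.mk _ _) = 0
  rw [this, map_zero]

/-- The residue class in `δα(f)` of a map from `E` to the target of `f`. -/
def cls (f : Arrow (FinMod (Lam k n))) :
    (AusGen k n →ₗ[Lam k n] f.right.obj) →+ ((deltaAlpha φ).obj f).obj :=
  (TorsQuot.mk (AusAlg.idem k n n) _).toAddMonoidHom.comp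
    (LinearMap.range (homMap (AusGen k n) (FinMod.lin f.hom))).mkQ.toAddMonoidHom

variable {φ}

theorem cls_surjective (f : Arrow (FinMod (Lam k n))) : Function.Surjective (cls φ f) :=
  (TorsQuot.mk_surjective _ _).comp (Submodule.mkQ_surjective _)

theorem ausToRing_smul_cls (f : Arrow (FinMod (Lam k n))) (a : AusAlg k n)
    (h : AusGen k n →ₗ[Lam k n] f.right.obj) : ausToRing φ a • cls φ f h = cls φ f (a • h) := by
  change φ (φ.symm (Ideal.Quotient.mk _ a)) • TorsQuot.mk (AusAlg.idem k n n) _ _ = _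
  rw [φ.apply_symm_apply]
  rfl

/-- `δα(f)` is the cokernel of `Hom(E, f)` modulo the maps which factor through free modules. -/
theorem cls_eq_zero_iff (hn : 1 ≤ n) (f : Arrow (FinMod (Lam k n)))
    (h : AusGen k n →ₗ[Lam k n] f.right.obj) :
    cls φ f h = 0 ↔ ∃ g : AusGen k n →ₗ[Lam k n] f.left.obj,
      ∃ b ∈ projMaps (Lam k n) (AusGen k n) f.right.obj, h = FinMod.lin f.hom ∘ₗ g + b := by
  have h0 : cls φ f h = 0 ↔
      (LinearMap.range (homMap (AusGen k n) (FinMod.lin f.hom))).mkQ h ∈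
        tors (AusAlg.idem k n n) _ :=
    Submodule.Quotient.mk_eq_zero _
  refine h0.trans ?_
  clear h0
  let P : Submodule (AusAlg k n) (AusGen k n →ₗ[Lam k n] f.right.obj) :=
    { projMaps (Lam k n) (AusGen k n) f.right.obj with
      smul_mem' := fun a b hb => mem_projMaps_comp a.unop hb }
  constructor
  · intro h
    have hle : tors (AusAlg.idem k n n) _ ≤
        P.map (LinearMap.range (homMap (AusGen k n) (FinMod.lin f.hom))).mkQ := by
      refine Submodule.span_le.2 ?_
      rintro _ ⟨z, rfl⟩
      obtain ⟨z, rfl⟩ := Submodule.mkQ_surjective _ z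
      exact ⟨AusAlg.idem k n n • z, idem_smul_mem_projMaps hn z, map_smul _ _ _⟩
    obtain ⟨b, hb, hbh⟩ := hle h
    obtain ⟨g, hg⟩ := (Submodule.Quotient.eq _).1 hbh.symm
    exact ⟨g, b, hb, eq_add_of_sub_eq hg.symm⟩
  · rintro ⟨g, b, hb, rfl⟩
    have hg : (LinearMap.range (homMap (AusGen k n) (FinMod.lin f.hom))).mkQ
        (FinMod.lin f.hom ∘ₗ g) = 0 := (Submodule.Quotient.mk_eq_zero _).2 ⟨g, rfl⟩
    rw [map_add, hg, zero_add]
    induction hb using projMaps_induction with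
    | h β y =>
      obtain ⟨a, h, hah⟩ := exists_smul_idem_smul_eq hn β y
      rw [hah, map_smul, map_smul]
      exact Submodule.smul_mem _ _ (Submodule.subset_span ⟨_, rfl⟩)
    | zero => rw [map_zero]; exact zero_mem _
    | add f f' _ _ h h' => rw [map_add]; exact add_mem h h'
    | neg f _ h => rw [map_neg]; exact neg_mem h

theorem cls_eq_zero_of_mem_projMaps (hn : 1 ≤ n) {f : Arrow (FinMod (Lam k n))}
    {b : AusGen k n →ₗ[Lam k n] f.right.obj}
    (hb : b ∈ projMaps (Lam k n) (AusGen k n) f.right.obj) : cls φ f b = 0 :=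
  (cls_eq_zero_iff hn f b).2 ⟨0, b, hb, by rw [LinearMap.comp_zero, zero_add]⟩

theorem cls_comp_eq_zero (hn : 1 ≤ n) {f : Arrow (FinMod (Lam k n))}
    (g : AusGen k n →ₗ[Lam k n] f.left.obj) : cls φ f (FinMod.lin f.hom ∘ₗ g) = 0 :=
  (cls_eq_zero_iff hn f _).2 ⟨g, 0, zero_mem _, (add_zero _).symm⟩

theorem hom_ext_cls {f : Arrow (FinMod (Lam k n))} {L : FinMod T}
    {s t : (deltaAlpha φ).obj f ⟶ L}
    (h : ∀ z, FinMod.lin s (cls φ f z) = FinMod.lin t (cls φ f z)) : s = t := by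
  ext x
  obtain ⟨z, rfl⟩ := cls_surjective f x
  exact h z

/-- A map which vanishes on `Hom(E, -)` modulo `f'` and free modules does so by itself, because
every module is a direct summand of a power of `E`. -/
theorem exists_eq_comp_add_of_cls_eq_zero (hn : 1 ≤ n) {f : Arrow (FinMod (Lam k n))}
    {M : Type u} [AddCommGroup M] [Module (Lam k n) M] [Module.Finite (Lam k n) M]
    (c : M →ₗ[Lam k n] f.right.obj) (hc : ∀ h : AusGen k n →ₗ[Lam k n] M, cls φ f (c ∘ₗ h) = 0) :
    ∃ a : M →ₗ[Lam k n] f.left.obj, ∃ b ∈ projMaps (Lam k n) M f.right.obj,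
      c = FinMod.lin f.hom ∘ₗ a + b := by
  obtain ⟨m, i, p, hip⟩ := exists_sum_ausGen_eq_id (k := k) (n := n) M
  choose g b hb hgb using fun a => (cls_eq_zero_iff hn f _).1 (hc (p a))
  refine ⟨∑ a, g a ∘ₗ i a, ∑ a, b a ∘ₗ i a,
    sum_mem fun a _ => mem_projMaps_comp _ (hb a), ?_⟩
  calc c = c ∘ₗ ∑ a, p a ∘ₗ i a := by rw [hip, LinearMap.comp_id]
    _ = ∑ a, (c ∘ₗ p a) ∘ₗ i a := by
      rw [linearMap_comp_sum]; rfl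
    _ = _ := by
      simp only [hgb, LinearMap.add_comp, Finset.sum_add_distrib]
      rw [linearMap_comp_sum]; rfl

/-- Every homomorphism between modules of the form `δα(f)` is induced by a linear map between the
targets. -/
theorem exists_linearMap_of_hom {f f' : Arrow (FinMod (Lam k n))}
    (t : (deltaAlpha φ).obj f ⟶ (deltaAlpha φ).obj f') :
    ∃ g : f.right.obj →ₗ[Lam k n] f'.right.obj,
      ∀ h, FinMod.lin t (cls φ f h) = cls φ f' (g ∘ₗ h) := by
  obtain ⟨m, i, p, hip⟩ := exists_sum_ausGen_eq_id (k := k) (n := n) f.right.obj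
  choose q hq using fun a => cls_surjective f' (FinMod.lin t (cls φ f (p a)))
  refine ⟨∑ a, q a ∘ₗ i a, fun h => ?_⟩
  have hh : h = ∑ a, MulOpposite.op (i a ∘ₗ h) • p a := (sum_comp_of_sum_comp_eq_id hip h).symm
  have hg : (∑ a, q a ∘ₗ i a) ∘ₗ h = ∑ a, MulOpposite.op (i a ∘ₗ h) • q a := by
    rw [linearMap_sum_comp]
    rfl
  rw [hg, map_sum]
  conv_lhs => rw [hh, map_sum, map_sum]
  refine Finset.sum_congr rfl fun a _ => ?_
  rw [← ausToRing_smul_cls, map_smul, ← hq, ausToRing_smul_cls]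

section Lift

variable {L : Type u} [AddCommGroup L] [Module T L]

theorem eq_zero_of_mem_projMaps_of_equivariant (hn : 1 ≤ n) {N : Type u} [AddCommGroup N]
    [Module (Lam k n) N] (t : (AusGen k n →ₗ[Lam k n] N) →+ L)
    (ht : ∀ (a : AusAlg k n) h, t (a • h) = ausToRing φ a • t h)
    {b : AusGen k n →ₗ[Lam k n] N} (hb : b ∈ projMaps (Lam k n) (AusGen k n) N) : t b = 0 := by
  induction hb using projMaps_induction with
  | h β y =>
    obtain ⟨a, h, hah⟩ := exists_smul_idem_smul_eq hn β y
    rw [hah, ht, ht, ausToRing_idem, zero_smul, smul_zero]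
  | zero => exact map_zero t
  | add f f' _ _ h h' => rw [map_add, h, h', add_zero]
  | neg f _ h => rw [map_neg, h, neg_zero]

/-- The universal property of `δα(f)`. -/
theorem exists_lift_cls (hn : 1 ≤ n) {f : Arrow (FinMod (Lam k n))}
    (t : (AusGen k n →ₗ[Lam k n] f.right.obj) →+ L)
    (ht : ∀ (a : AusAlg k n) h, t (a • h) = ausToRing φ a • t h)
    (hf : ∀ g, t (FinMod.lin f.hom ∘ₗ g) = 0) :
    ∃ s : ((deltaAlpha φ).obj f).obj →ₗ[T] L, ∀ h, s (cls φ f h) = t h := by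
  have key : ∀ h h', cls φ f h = cls φ f h' → t h = t h' := by
    intro h h' heq
    rw [← sub_eq_zero, ← map_sub, cls_eq_zero_iff hn] at heq
    obtain ⟨g, b, hb, hgb⟩ := heq
    rw [← sub_eq_zero, ← map_sub, hgb, map_add, hf,
      eq_zero_of_mem_projMaps_of_equivariant hn t ht hb, add_zero]
  choose q hq using cls_surjective (φ := φ) f
  refine ⟨⟨⟨fun z => t (q z), fun z w => ?_⟩, fun r z => ?_⟩, fun h => key _ _ (hq _)⟩
  · refine (key (q (z + w)) (q z + q w) ?_).trans (map_add t _ _)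
    exact (hq _).trans ((congrArg₂ (· + ·) (hq z) (hq w)).symm.trans (map_add _ _ _).symm)
  · obtain ⟨a, rfl⟩ := ausToRing_surjective φ r
    refine (key (q (ausToRing φ a • z)) (a • q z) ?_).trans (ht _ _)
    exact (hq _).trans ((congrArg (ausToRing φ a • ·) (hq z)).symm.trans (ausToRing_smul_cls f a _))

end Lift

/-- An equivariant surjection with the right kernel identifies `δα(f)`. -/
theorem nonempty_iso_of_equivariant (hn : 1 ≤ n) {f : Arrow (FinMod (Lam k n))} {L : FinMod T}
    (t : (AusGen k n →ₗ[Lam k n] f.right.obj) →+ L.obj)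
    (ht : ∀ (a : AusAlg k n) h, t (a • h) = ausToRing φ a • t h) (hs : Function.Surjective t)
    (hf : ∀ h, t h = 0 ↔ cls φ f h = 0) : Nonempty ((deltaAlpha φ).obj f ≅ L) := by
  obtain ⟨s, hst⟩ := exists_lift_cls hn t ht fun g => (hf _).2 (cls_comp_eq_zero hn g)
  refine ⟨FinMod.isoOfEquiv (LinearEquiv.ofBijective s ⟨?_, ?_⟩)⟩
  · rw [injective_iff_map_eq_zero]
    intro z hz
    obtain ⟨h, rfl⟩ := cls_surjective f z
    rwa [hst, hf] at hz
  · intro z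
    obtain ⟨h, rfl⟩ := hs z
    exact ⟨cls φ f h, hst h⟩

/-- If `Hom(E, f)` only takes values which factor through free modules, then `δα(f)` is a factor
of a projective `A_n`-module by its part generated by `e(n)`, hence projective. -/
theorem projective_deltaAlpha (hn : 1 ≤ n) {f : Arrow (FinMod (Lam k n))}
    (hf : ∀ g : AusGen k n →ₗ[Lam k n] f.left.obj,
      FinMod.lin f.hom ∘ₗ g ∈ projMaps (Lam k n) (AusGen k n) f.right.obj) :
    Projective ((deltaAlpha φ).obj f) where
  factors {L L'} s e _ := by
    obtain ⟨m, i, p, hip⟩ := exists_sum_ausGen_eq_id (k := k) (n := n) f.right.obj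
    choose w hw using fun a => FinMod.surjective_of_epi e (FinMod.lin s (cls φ f (p a)))
    let t : (AusGen k n →ₗ[Lam k n] f.right.obj) →+ L.obj :=
      AddMonoidHom.mk' (fun h => ∑ a, ausToRing φ (MulOpposite.op (i a ∘ₗ h)) • w a) fun h h' => by
        simp only [LinearMap.comp_add, MulOpposite.op_add, map_add, add_smul,
          Finset.sum_add_distrib]
    have ht : ∀ (a : AusAlg k n) h, t (a • h) = ausToRing φ a • t h := fun a h => by
      change ∑ i', ausToRing φ (MulOpposite.op (i i' ∘ₗ (a • h))) • w i' =
        ausToRing φ a • ∑ i', ausToRing φ (MulOpposite.op (i i' ∘ₗ h)) • w i'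
      rw [Finset.smul_sum]
      refine Finset.sum_congr rfl fun b _ => ?_
      rw [smul_smul, ← map_mul]
      rfl
    obtain ⟨r, hr⟩ := exists_lift_cls hn t ht fun g =>
      eq_zero_of_mem_projMaps_of_equivariant hn t ht (hf g)
    refine ⟨FinMod.ofHom r, hom_ext_cls fun h => ?_⟩
    change FinMod.lin e (r (cls φ f h)) = _
    have hh : h = ∑ a, MulOpposite.op (i a ∘ₗ h) • p a :=
      (sum_comp_of_sum_comp_eq_id hip h).symm
    conv_rhs => rw [hh, map_sum, map_sum]
    rw [hr]
    change FinMod.lin e (∑ a, ausToRing φ (MulOpposite.op (i a ∘ₗ h)) • w a) = _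
    rw [map_sum]
    refine Finset.sum_congr rfl fun a _ => ?_
    rw [map_smul, hw, ← ausToRing_smul_cls, map_smul]

/-- A projective presentation over `A_n`: each module `L` of finite length is the cokernel of
`Hom(E, f)` for a map `f` between powers of `E`. -/
theorem exists_presentation (L : FinMod T) :
    ∃ (l m : ℕ) (f : (Fin l → AusGen k n) →ₗ[Lam k n] (Fin m → AusGen k n))
      (t : (AusGen k n →ₗ[Lam k n] (Fin m → AusGen k n)) →+ L.obj),
      (∀ (a : AusAlg k n) h, t (a • h) = ausToRing φ a • t h) ∧ Function.Surjective t ∧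
      ∀ h, t h = 0 ↔ ∃ g : AusGen k n →ₗ[Lam k n] (Fin l → AusGen k n), h = f ∘ₗ g := by
  have := finite_of_finLen L.property
  obtain ⟨m, w, hw⟩ := Module.Finite.exists_fin (R := T) (M := L.obj)
  let t : (AusGen k n →ₗ[Lam k n] (Fin m → AusGen k n)) →+ L.obj :=
    AddMonoidHom.mk' (fun h => ∑ a, ausToRing φ (MulOpposite.op (LinearMap.proj a ∘ₗ h)) • w a)
      fun h h' => by
        simp only [LinearMap.comp_add, MulOpposite.op_add, map_add, add_smul,
          Finset.sum_add_distrib]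
  have ht : ∀ (a : AusAlg k n) h, t (a • h) = ausToRing φ a • t h := fun a h => by
    change ∑ i, ausToRing φ (MulOpposite.op (LinearMap.proj i ∘ₗ (a • h))) • w i =
      ausToRing φ a • ∑ i, ausToRing φ (MulOpposite.op (LinearMap.proj i ∘ₗ h)) • w i
    rw [Finset.smul_sum]
    refine Finset.sum_congr rfl fun b _ => ?_
    rw [smul_smul, ← map_mul]
    rfl
  let K : Submodule (AusAlg k n) (AusGen k n →ₗ[Lam k n] (Fin m → AusGen k n)) :=
    { carrier := {h | t h = 0}
      add_mem' := fun {h h'} hh hh' => by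
        rw [Set.mem_ofPred_eq] at *
        rw [map_add, hh, hh', add_zero]
      zero_mem' := map_zero t
      smul_mem' := fun a h hh => by
        rw [Set.mem_ofPred_eq] at *
        rw [ht, hh, smul_zero] }
  have hnoeth := (isFiniteLength_iff_isNoetherian_isArtinian.1
    (finLen_hom (AusGen k n) (finLen_of_finite (k := k) (n := n) (Fin m → AusGen k n)))).1
  obtain ⟨l, r, hr⟩ := Submodule.fg_iff_exists_fin_generating_family.1 (hnoeth.noetherian K)
  refine ⟨l, m, ∑ b, r b ∘ₗ LinearMap.proj b, t, ht, fun z => ?_, fun h => ?_⟩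
  · obtain ⟨c, rfl⟩ := (Submodule.mem_span_range_iff_exists_fun T).1
      (hw ▸ Submodule.mem_top (x := z))
    choose a ha using fun i => ausToRing_surjective φ (c i)
    refine ⟨LinearMap.pi fun i => (a i).unop, ?_⟩
    simp only [← ha]
    rfl
  · change h ∈ K ↔ _
    rw [← hr, Submodule.mem_span_range_iff_exists_fun]
    constructor
    · rintro ⟨a, rfl⟩
      refine ⟨LinearMap.pi fun b => (a b).unop, ?_⟩
      rw [linearMap_sum_comp]
      rfl
    · rintro ⟨g, rfl⟩
      refine ⟨fun b => MulOpposite.op (LinearMap.proj b ∘ₗ g), ?_⟩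
      rw [linearMap_sum_comp]
      rfl

end CokerFunctor

/-! ### Maps between pairs which factor through pickets -/

section PicketMaps

variable {k : Type u} [Field k] {n : ℕ}

theorem exists_sum_smulRight_of_mem_projMaps {R M N : Type*} [CommRing R] [AddCommGroup M]
    [Module R M] [AddCommGroup N] [Module R N] {f : M →ₗ[R] N} (hf : f ∈ projMaps R M N) :
    ∃ (J : Type) (_ : Fintype J) (β : J → (M →ₗ[R] R)) (y : J → N),
      f = ∑ j, (β j).smulRight (y j) := by
  induction hf using projMaps_induction with
  | h β y => exact ⟨Unit, inferInstance, fun _ => β, fun _ => y, by simp⟩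
  | zero => exact ⟨Empty, inferInstance, Empty.elim, Empty.elim, by simp⟩
  | add f f' _ _ h h' =>
    obtain ⟨J, _, β, y, rfl⟩ := h
    obtain ⟨J', _, β', y', rfl⟩ := h'
    exact ⟨J ⊕ J', inferInstance, Sum.elim β β', Sum.elim y y', by simp⟩
  | neg f _ h =>
    obtain ⟨J, _, β, y, rfl⟩ := h
    refine ⟨J, inferInstance, β, fun j => -y j, ?_⟩
    rw [← Finset.sum_neg_distrib]
    refine Finset.sum_congr rfl fun j _ => ?_
    ext z
    simp

/-- The map `[c] → [n]` onto the elements killed by `x^c`. -/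
def cycEmb {c : ℕ} (hc : c ≤ n) : Cyc k n c →ₗ[Lam k n] Cyc k n n :=
  (stdPicket k n c n).sub.subtype ∘ₗ (stdPicketSubEquiv hc le_rfl).toLinearMap

theorem cycEmb_injective {c : ℕ} (hc : c ≤ n) : Function.Injective (cycEmb (k := k) hc) :=
  Subtype.val_injective.comp (stdPicketSubEquiv hc le_rfl).injective

theorem exists_cycEmb_eq {c : ℕ} (hc : c ≤ n) {z : Cyc k n n}
    (hz : z ∈ (stdPicket k n c n).sub) : ∃ w, cycEmb hc w = z :=
  ⟨(stdPicketSubEquiv hc le_rfl).symm ⟨z, hz⟩,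
    congrArg Subtype.val ((stdPicketSubEquiv hc le_rfl).apply_symm_apply ⟨z, hz⟩)⟩

theorem x_pow_smul_cycEmb {c : ℕ} (hc : c ≤ n) (w : Cyc k n c) :
    Lam.x k n ^ c • cycEmb hc w = 0 := by
  rw [← map_smul, Cyc.x_pow_smul, map_zero]

variable {M N : Type u} [AddCommGroup M] [Module (Lam k n) M] [AddCommGroup N] [Module (Lam k n) N]

theorem mem_projMaps_cyc (f : M →ₗ[Lam k n] Cyc k n n) : f ∈ projMaps (Lam k n) M (Cyc k n n) := by
  have : f = (Cyc.equivLam.symm.toLinearMap : Lam k n →ₗ[Lam k n] Cyc k n n) ∘ₗ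
      Cyc.equivLam.toLinearMap ∘ₗ f := by
    ext z
    exact (Cyc.equivLam.symm_apply_apply (f z)).symm
  rw [this]
  exact mem_projMaps_comp _ (mem_projMaps_of_dom _)

theorem exists_extend_cyc (i : M →ₗ[Lam k n] N) (hi : Function.Injective i)
    (g : M →ₗ[Lam k n] Cyc k n n) : ∃ h : N →ₗ[Lam k n] Cyc k n n, h ∘ₗ i = g := by
  obtain ⟨h, -, hh⟩ := exists_extend_of_mem_projMaps i hi (mem_projMaps_cyc g)
  exact ⟨h, hh⟩

theorem exists_injective_free (M : Type u) [AddCommGroup M] [Module (Lam k n) M]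
    [Module.Finite (Lam k n) M] :
    ∃ (q : ℕ) (J : M →ₗ[Lam k n] (Fin q → Lam k n)), Function.Injective J := by
  obtain ⟨q, c, hc, i, p, hip⟩ := exists_sum_cyc_eq_id (k := k) (n := n) M
  refine ⟨q, LinearMap.pi fun a =>
    Cyc.equivLam.toLinearMap ∘ₗ cycEmb (hc a) ∘ₗ i a, ?_⟩
  rw [injective_iff_map_eq_zero]
  intro z hz
  have hi : ∀ a, i a z = 0 := fun a => by
    have h : Cyc.equivLam (cycEmb (hc a) (i a z)) = 0 := congrFun hz a
    rw [Cyc.equivLam.map_eq_zero_iff] at h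
    exact (map_eq_zero_iff _ (cycEmb_injective (hc a))).1 h
  rw [← LinearMap.id_apply (R := Lam k n) z, ← hip, LinearMap.sum_apply]
  exact Finset.sum_eq_zero fun a _ => by rw [LinearMap.comp_apply, hi, map_zero]

/-- A morphism to `(X', Y')` whose values lie in `X'` factors through pairs `([c], [c])`. -/
theorem inIdeal_of_range_le {K : ObjectProperty (S k n)}
    (hK : ∀ c ≤ n, K (stdPicket k n c c)) {P Q : S k n} (f : P ⟶ Q)
    (hf : ∀ y, f.lin y ∈ Q.sub) : InIdeal K f := by
  have := finite_of_finLen (finLen_submodule Q.amb.property Q.sub)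
  obtain ⟨m, c, hc, i, p, hip⟩ := exists_sum_cyc_eq_id (k := k) (n := n) Q.sub
  let g : ∀ a, P ⟶ stdPicket k n (c a) (c a) := fun a =>
    ⟨i a ∘ₗ f.lin.codRestrict Q.sub hf, fun y _ => (mem_stdPicket_sub _).2 (Cyc.x_pow_smul _)⟩
  let h : ∀ a, stdPicket k n (c a) (c a) ⟶ Q := fun a =>
    ⟨Q.sub.subtype ∘ₗ p a, fun y _ => (p a y).2⟩
  have hfg : f = ∑ a, g a ≫ h a := by
    apply Pair.hom_ext
    rw [Pair.sum_lin]
    refine LinearMap.ext fun y => ?_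
    have := congrArg Q.sub.subtype
      (sum_apply_of_sum_comp_eq_id hip (f.lin.codRestrict Q.sub hf y))
    rw [map_sum] at this
    rw [LinearMap.sum_apply]
    exact this.symm
  rw [hfg]
  exact inIdeal_sum K _ (fun a => hK _ (hc a)) g h

/-- A morphism from `(X, Y)` which is induced by a map on `Y / X` factors through pairs
`([0], [c])`. -/
theorem inIdeal_of_comp_mkQ {K : ObjectProperty (S k n)}
    (hK : ∀ c ≤ n, K (stdPicket k n 0 c)) {P Q : S k n} (f : P ⟶ Q)
    (a : (P.amb.obj ⧸ P.sub) →ₗ[Lam k n] Q.amb.obj) (hf : f.lin = a ∘ₗ P.sub.mkQ) :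
    InIdeal K f := by
  have := finite_of_finLen (finLen_quotient P.amb.property P.sub)
  obtain ⟨m, c, hc, i, p, hip⟩ := exists_sum_cyc_eq_id (k := k) (n := n) (P.amb.obj ⧸ P.sub)
  let g : ∀ a, P ⟶ stdPicket k n 0 (c a) := fun a =>
    ⟨i a ∘ₗ P.sub.mkQ, fun y hy => (mem_stdPicket_sub _).2 (by
      have h0 : P.sub.mkQ y = 0 := (Submodule.Quotient.mk_eq_zero _).2 hy
      rw [LinearMap.comp_apply, h0, map_zero, smul_zero])⟩
  let h : ∀ a, stdPicket k n 0 (c a) ⟶ Q := fun b =>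
    ⟨a ∘ₗ p b, fun y hy => by
      have h0 := (mem_stdPicket_sub _).1 hy
      rw [pow_zero, one_smul] at h0
      rw [h0]
      exact zero_mem _⟩
  have hfg : f = ∑ a, g a ≫ h a := by
    apply Pair.hom_ext
    rw [Pair.sum_lin, hf]
    refine LinearMap.ext fun y => ?_
    have := congrArg a (sum_apply_of_sum_comp_eq_id hip (P.sub.mkQ y))
    rw [map_sum] at this
    rw [LinearMap.sum_apply]
    exact this.symm
  rw [hfg]
  exact inIdeal_sum K _ (fun a => hK _ (hc a)) g h

/-- A morphism of pairs whose underlying map factors through a free module factors through pairs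
`([c], [n])`: the restriction of the map to `X` is extended to a sum of maps which factor through
the injective hulls `[c] → [n]` of the direct summands `[c]` of `X`, and the difference vanishes
on `X`. -/
theorem inIdeal_of_mem_projMaps {K : ObjectProperty (S k n)}
    (hK : ∀ c ≤ n, K (stdPicket k n c n)) {P Q : S k n} (f : P ⟶ Q)
    (hf : f.lin ∈ projMaps (Lam k n) P.amb.obj Q.amb.obj) : InIdeal K f := by
  obtain ⟨J, _, β, y, hβ⟩ := exists_sum_smulRight_of_mem_projMaps hf
  have := finite_of_finLen (finLen_submodule P.amb.property P.sub)
  obtain ⟨m, c, hc, i, p, hip⟩ := exists_sum_cyc_eq_id (k := k) (n := n) P.sub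
  -- extensions `κ a` of `X → [c a] → [n]` to `Y`, and `χ a j` of `[c a] → X → Λ_n` to `[n]`
  choose κ hκ using fun a => exists_extend_cyc P.sub.subtype Subtype.val_injective
    (cycEmb (hc a) ∘ₗ i a)
  choose χ hχ using fun a j => Lam.exists_extend (cycEmb (hc a)) (cycEmb_injective (hc a))
    (β j ∘ₗ P.sub.subtype ∘ₗ p a)
  let ψ : ∀ a, Cyc k n n →ₗ[Lam k n] Q.amb.obj := fun a => ∑ j, (χ a j).smulRight (y j)
  have hψ : ∀ a w, ψ a (cycEmb (hc a) w) = f.lin (p a w) := fun a w => by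
    change (∑ j, (χ a j).smulRight (y j)) (cycEmb (hc a) w) = _
    rw [hβ, LinearMap.sum_apply, LinearMap.sum_apply]
    refine Finset.sum_congr rfl fun j _ => ?_
    rw [LinearMap.smulRight_apply, LinearMap.smulRight_apply]
    exact congrArg (· • y j) (LinearMap.congr_fun (hχ a j) w)
  have hκx : ∀ a (x : P.amb.obj) (hx : x ∈ P.sub), κ a x = cycEmb (hc a) (i a ⟨x, hx⟩) :=
    fun a x hx => LinearMap.congr_fun (hκ a) ⟨x, hx⟩
  let β' : J → (P.amb.obj →ₗ[Lam k n] Lam k n) := fun j => β j - ∑ a, χ a j ∘ₗ κ a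
  have hβ'0 : ∀ j, ∀ x ∈ P.sub, β' j x = 0 := fun j x hx => by
    change (β j - ∑ a, χ a j ∘ₗ κ a) x = 0
    rw [LinearMap.sub_apply, LinearMap.sum_apply, sub_eq_zero]
    have h := congrArg (β j ∘ₗ P.sub.subtype) (sum_apply_of_sum_comp_eq_id hip ⟨x, hx⟩)
    rw [map_sum] at h
    refine h.symm.trans (Finset.sum_congr rfl fun a _ => ?_)
    exact (LinearMap.congr_fun (hχ a j) _).symm.trans (congrArg (χ a j) (hκx a x hx).symm)
  let g : ∀ a, P ⟶ stdPicket k n (c a) n := fun a => ⟨κ a, fun x hx =>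
    (mem_stdPicket_sub _).2 (by rw [hκx a x hx, x_pow_smul_cycEmb])⟩
  let h : ∀ a, stdPicket k n (c a) n ⟶ Q := fun a => ⟨ψ a, fun z hz => by
    obtain ⟨w, rfl⟩ := exists_cycEmb_eq (hc a) hz
    rw [Submodule.mem_comap, hψ]
    exact f.map_sub (p a w).2⟩
  let g' : ∀ _ : J, P ⟶ stdPicket k n 0 n := fun j =>
    ⟨Cyc.equivLam.symm.toLinearMap ∘ₗ β' j, fun x hx => (mem_stdPicket_sub _).2 (by
      rw [LinearMap.comp_apply, hβ'0 j x hx, map_zero, smul_zero])⟩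
  let h' : ∀ _ : J, stdPicket k n 0 n ⟶ Q := fun j =>
    ⟨LinearMap.toSpanSingleton _ _ (y j) ∘ₗ Cyc.equivLam.toLinearMap, fun z hz => by
      have h0 := (mem_stdPicket_sub _).1 hz
      rw [pow_zero, one_smul] at h0
      rw [h0]
      exact zero_mem _⟩
  have hsum : f = ∑ a, g a ≫ h a + ∑ j, g' j ≫ h' j := by
    apply Pair.hom_ext
    rw [Pair.add_lin, Pair.sum_lin, Pair.sum_lin]
    refine LinearMap.ext fun z => ?_
    rw [LinearMap.add_apply, LinearMap.sum_apply, LinearMap.sum_apply]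
    have h1 : ∀ a, (g a ≫ h a).lin z = ∑ j, χ a j (κ a z) • y j := fun a =>
      LinearMap.sum_apply _ _ _
    have h2 : ∀ j, (g' j ≫ h' j).lin z = β j z • y j - ∑ a, χ a j (κ a z) • y j := fun j => by
      change Cyc.equivLam (Cyc.equivLam.symm (β' j z)) • y j = _
      rw [Cyc.equivLam.apply_symm_apply]
      change (β j - ∑ a, χ a j ∘ₗ κ a) z • y j = _
      rw [LinearMap.sub_apply, LinearMap.sum_apply, sub_smul, Finset.sum_smul]
      rfl
    rw [hβ, LinearMap.sum_apply]
    simp only [h1, h2, Finset.sum_sub_distrib, LinearMap.smulRight_apply]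
    rw [Finset.sum_comm]
    abel
  rw [hsum]
  exact (inIdeal_sum K _ (fun a => hK _ (hc a)) g h).add
    (inIdeal_sum K _ (fun _ => hK 0 (Nat.zero_le n)) g' h')

theorem map_eq_zero_of_inIdeal {C D : Type*} [Category C] [Preadditive C] [HasFiniteBiproducts C]
    [Category D] [Preadditive D] {F : C ⥤ D} [F.Additive] {K : ObjectProperty C}
    (hK : ∀ A, K A → IsZero (F.obj A)) {X Y : C} {f : X ⟶ Y} (hf : InIdeal K f) :
    F.map f = 0 := by
  obtain ⟨m, A, hA, g, h, rfl⟩ := hf.exists_sum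
  rw [F.map_sum]
  refine Finset.sum_eq_zero fun i _ => ?_
  rw [F.map_comp, (hK _ (hA i)).eq_of_tgt (F.map (g i)) 0, zero_comp]

end PicketMaps

/-! ### The functor `F` -/

section FunctorF

variable {k : Type u} [Field k] {n : ℕ} {T : Type u} [Ring T] (φ : T ≃+* FactorAlg k n)

/-- The functor `F`, with values in the modules over a ring `T` which is identified with
`A_n / ⟨e(n)⟩`. -/
abbrev cokerIncl : S k n ⥤ FinMod T := Pair.incl ⋙ deltaAlpha φ

/-- The residue class in `F(X, Y)` of a map `E → Y`. -/
def clsIncl (P : S k n) :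
    (AusGen k n →ₗ[Lam k n] P.amb.obj) →+ ((cokerIncl φ).obj P).obj := cls φ (Pair.incl.obj P)

variable {φ}

theorem clsIncl_surjective (P : S k n) : Function.Surjective (clsIncl φ P) := cls_surjective _

theorem map_clsIncl {P Q : S k n} (f : P ⟶ Q) (h : AusGen k n →ₗ[Lam k n] P.amb.obj) :
    FinMod.lin ((cokerIncl φ).map f) (clsIncl φ P h) = clsIncl φ Q (f.lin ∘ₗ h) := rfl

theorem clsIncl_eq_zero_iff (hn : 1 ≤ n) (P : S k n) (h : AusGen k n →ₗ[Lam k n] P.amb.obj) :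
    clsIncl φ P h = 0 ↔ ∃ g : AusGen k n →ₗ[Lam k n] P.sub,
      ∃ b ∈ projMaps (Lam k n) (AusGen k n) P.amb.obj, h = P.sub.subtype ∘ₗ g + b :=
  cls_eq_zero_iff hn (Pair.incl.obj P) h

theorem hom_ext_clsIncl {P : S k n} {L : FinMod T} {s t : (cokerIncl φ).obj P ⟶ L}
    (h : ∀ z, FinMod.lin s (clsIncl φ P z) = FinMod.lin t (clsIncl φ P z)) : s = t :=
  hom_ext_cls h

theorem exists_linearMap_of_hom_cokerIncl {P Q : S k n}
    (t : (cokerIncl φ).obj P ⟶ (cokerIncl φ).obj Q) :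
    ∃ g : P.amb.obj →ₗ[Lam k n] Q.amb.obj,
      ∀ h, FinMod.lin t (clsIncl φ P h) = clsIncl φ Q (g ∘ₗ h) :=
  exists_linearMap_of_hom t

theorem exists_eq_add_of_clsIncl_eq_zero (hn : 1 ≤ n) {Q : S k n} {M : Type u} [AddCommGroup M]
    [Module (Lam k n) M] [Module.Finite (Lam k n) M] (c : M →ₗ[Lam k n] Q.amb.obj)
    (hc : ∀ h : AusGen k n →ₗ[Lam k n] M, clsIncl φ Q (c ∘ₗ h) = 0) :
    ∃ a : M →ₗ[Lam k n] Q.sub, ∃ b ∈ projMaps (Lam k n) M Q.amb.obj, c = Q.sub.subtype ∘ₗ a + b :=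
  exists_eq_comp_add_of_cls_eq_zero hn (f := Pair.incl.obj Q) c hc

theorem clsIncl_eq_zero_of_mem_projMaps (hn : 1 ≤ n) {P : S k n}
    {b : AusGen k n →ₗ[Lam k n] P.amb.obj}
    (hb : b ∈ projMaps (Lam k n) (AusGen k n) P.amb.obj) : clsIncl φ P b = 0 :=
  cls_eq_zero_of_mem_projMaps hn hb

theorem clsIncl_subtype_comp (hn : 1 ≤ n) {P : S k n} (g : AusGen k n →ₗ[Lam k n] P.sub) :
    clsIncl φ P (P.sub.subtype ∘ₗ g) = 0 :=
  cls_comp_eq_zero hn (f := Pair.incl.obj P) g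

theorem nonempty_cokerIncl_iso (hn : 1 ≤ n) {P : S k n} {L : FinMod T}
    (t : (AusGen k n →ₗ[Lam k n] P.amb.obj) →+ L.obj)
    (ht : ∀ (a : AusAlg k n) h, t (a • h) = ausToRing φ a • t h) (hs : Function.Surjective t)
    (hf : ∀ h, t h = 0 ↔ clsIncl φ P h = 0) : Nonempty ((cokerIncl φ).obj P ≅ L) :=
  nonempty_iso_of_equivariant hn (f := Pair.incl.obj P) t ht hs hf

variable (φ)

instance cokerIncl_additive : (cokerIncl φ).Additive where
  map_add {_ Q f g} := hom_ext_clsIncl fun h =>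
    (congrArg (clsIncl φ Q) (LinearMap.add_comp h g.lin f.lin)).trans (map_add _ _ _)

/-- A homomorphism `F(X, Y) → F(X', Y')` is induced by a map `Y → Y'` which sends `X` into `X'` up
to a map through a free module. That map extends to `Y`, as `Λ_n` is self-injective. -/
theorem cokerIncl_full (hn : 1 ≤ n) : (cokerIncl φ).Full where
  map_surjective {P Q} t := by
    obtain ⟨g, hg⟩ := exists_linearMap_of_hom_cokerIncl t
    have := finite_of_finLen (finLen_submodule P.amb.property P.sub)
    obtain ⟨a, b, hb, hab⟩ := exists_eq_add_of_clsIncl_eq_zero (φ := φ) hn (g ∘ₗ P.sub.subtype)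
      fun h => by
        refine (hg (P.sub.subtype ∘ₗ h)).symm.trans ?_
        rw [clsIncl_subtype_comp hn, map_zero]
    obtain ⟨b', hb', hbb'⟩ := exists_extend_of_mem_projMaps P.sub.subtype
      Subtype.val_injective hb
    refine ⟨⟨g - b', fun x hx => ?_⟩, hom_ext_clsIncl fun h => ?_⟩
    · have h1 : g x = a ⟨x, hx⟩ + b ⟨x, hx⟩ := LinearMap.congr_fun hab ⟨x, hx⟩
      have h2 : b' x = b ⟨x, hx⟩ := LinearMap.congr_fun hbb' ⟨x, hx⟩
      rw [Submodule.mem_comap, LinearMap.sub_apply, h1, h2, add_sub_cancel_right]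
      exact (a ⟨x, hx⟩).2
    · rw [hg, map_clsIncl]
      change clsIncl φ Q (g ∘ₗ h - b' ∘ₗ h) = _
      rw [map_sub, clsIncl_eq_zero_of_mem_projMaps hn (mem_projMaps_comp h hb'), sub_zero]

theorem inIdeal_of_cokerIncl_map_eq_zero (hn : 1 ≤ n) {K : ObjectProperty (S k n)}
    (hK : ∀ c ≤ n, K (stdPicket k n c c)) (hK' : ∀ c ≤ n, K (stdPicket k n c n)) {P Q : S k n}
    (f : P ⟶ Q) (hf : (cokerIncl φ).map f = 0) : InIdeal K f := by
  obtain ⟨a, b, hb, hab⟩ := exists_eq_add_of_clsIncl_eq_zero (φ := φ) hn f.lin fun h =>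
    congrArg (fun t => FinMod.lin t (clsIncl φ P h)) hf
  let f₁ : P ⟶ Q := ⟨Q.sub.subtype ∘ₗ a, fun x _ => (a x).2⟩
  have hb' : (f - f₁).lin = b := by
    rw [Pair.sub_lin, hab]
    exact add_sub_cancel_left _ _
  rw [← sub_add_cancel f f₁]
  exact (inIdeal_of_mem_projMaps hK' _ (hb' ▸ hb)).add
    (inIdeal_of_range_le hK f₁ fun y => (a y).2)

theorem isZero_cokerIncl_of_eq (hn : 1 ≤ n) (c : ℕ) :
    IsZero ((cokerIncl φ).obj (stdPicket k n c c)) := by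
  refine FinMod.isZero_iff.2 fun x => ?_
  obtain ⟨h, rfl⟩ := clsIncl_surjective (φ := φ) (stdPicket k n c c) x
  exact clsIncl_subtype_comp hn (P := stdPicket k n c c)
    (h.codRestrict (stdPicket k n c c).sub fun z => (mem_stdPicket_sub _).2 (Cyc.x_pow_smul _))

theorem isZero_cokerIncl_of_top (hn : 1 ≤ n) (c : ℕ) :
    IsZero ((cokerIncl φ).obj (stdPicket k n c n)) := by
  refine FinMod.isZero_iff.2 fun x => ?_
  obtain ⟨h, rfl⟩ := clsIncl_surjective (φ := φ) (stdPicket k n c n) x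
  exact clsIncl_eq_zero_of_mem_projMaps hn (mem_projMaps_cyc h)

/-- A presentation `E^l → E^m` of a module is made injective by adding an embedding of `E^l` into
a free module, which does not change the value of `δα`. -/
theorem cokerIncl_essSurj (hn : 1 ≤ n) : (cokerIncl φ).EssSurj where
  mem_essImage L := by
    obtain ⟨l, m, f, t, ht, hs, hf⟩ := exists_presentation (φ := φ) L
    obtain ⟨q, J, hJ⟩ := exists_injective_free (k := k) (n := n) (Fin l → AusGen k n)
    have hfJ : Function.Injective (f.prod J) := fun z w h => hJ (congrArg Prod.snd h)
    let P : S k n := ⟨FinMod.of _ ((Fin m → AusGen k n) × (Fin q → Lam k n)) (finLen_of_finite _),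
      LinearMap.range (f.prod J)⟩
    let t' : (AusGen k n →ₗ[Lam k n] P.amb.obj) →+ L.obj :=
      t.comp (AddMonoidHom.mk' (fun h => LinearMap.fst _ _ _ ∘ₗ h)
        fun _ _ => LinearMap.comp_add _ _ _)
    have ht' : ∀ (a : AusAlg k n) h, t' (a • h) = ausToRing φ a • t' h := fun a h =>
      ht a (LinearMap.fst _ _ _ ∘ₗ h)
    refine ⟨P, nonempty_cokerIncl_iso hn t' ht' (fun z => ?_) fun h => ?_⟩
    · obtain ⟨h, rfl⟩ := hs z
      exact ⟨LinearMap.inl _ _ _ ∘ₗ h, congrArg t (LinearMap.ext fun z => rfl)⟩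
    · rw [clsIncl_eq_zero_iff hn]
      constructor
      · intro h0
        obtain ⟨g, hg⟩ := (hf _).1 h0
        refine ⟨(f.prod J).rangeRestrict ∘ₗ g,
          LinearMap.inr _ _ _ ∘ₗ (LinearMap.snd _ _ _ ∘ₗ h - J ∘ₗ g), ?_, ?_⟩
        · exact mem_projMaps_comp _ (mem_projMaps_of_free _)
        · refine LinearMap.ext fun z => Prod.ext ?_ ?_
          · have h1 : (h z).1 = f (g z) := LinearMap.congr_fun hg z
            change (h z).1 = f (g z) + 0
            rw [add_zero, h1]
          · change (h z).2 = J (g z) + ((h z).2 - J (g z))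
            abel
      · rintro ⟨g, b, hb, rfl⟩
        rw [map_add, eq_zero_of_mem_projMaps_of_equivariant hn t' ht' hb, add_zero]
        refine (hf _).2 ⟨(LinearEquiv.ofInjective _ hfJ).symm.toLinearMap ∘ₗ g, ?_⟩
        refine LinearMap.ext fun z => ?_
        have h1 : f.prod J ((LinearEquiv.ofInjective _ hfJ).symm (g z)) = (g z).1 :=
          congrArg Subtype.val ((LinearEquiv.ofInjective _ hfJ).apply_symm_apply (g z))
        exact (congrArg Prod.fst h1).symm

theorem projective_cokerIncl (hn : 1 ≤ n) (c : ℕ) :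
    Projective ((cokerIncl φ).obj (stdPicket k n 0 c)) := by
  refine projective_deltaAlpha hn fun g => ?_
  have : FinMod.lin (Pair.incl.obj (stdPicket k n 0 c)).hom ∘ₗ g = 0 := by
    refine LinearMap.ext fun z => ?_
    have h0 := (mem_stdPicket_sub _).1 (g z).2
    rwa [pow_zero, one_smul] at h0
  rw [this]
  exact zero_mem _

theorem exists_generators_cokerIncl (P : S k n) :
    ∃ (m : ℕ) (B : Fin m → S k n) (_ : ∀ i, ∃ c ≤ n, B i = stdPicket k n 0 c)
      (r : ∀ i, B i ⟶ P), ∀ ⦃W : FinMod T⦄ (t : (cokerIncl φ).obj P ⟶ W),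
        (∀ i, (cokerIncl φ).map (r i) ≫ t = 0) → t = 0 := by
  obtain ⟨m, c, hc, i, p, hip⟩ := exists_sum_cyc_eq_id (k := k) (n := n) P.amb.obj
  let r : ∀ a, stdPicket k n 0 (c a) ⟶ P := fun a => ⟨p a, fun y hy => by
    have h0 := (mem_stdPicket_sub _).1 hy
    rw [pow_zero, one_smul] at h0
    rw [h0]
    exact zero_mem _⟩
  refine ⟨m, fun a => stdPicket k n 0 (c a), fun a => ⟨c a, hc a, rfl⟩, r,
    fun W t ht => hom_ext_clsIncl fun h => ?_⟩
  rw [← sum_comp_of_sum_comp_eq_id hip h, map_sum, map_sum, map_sum]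
  refine Finset.sum_congr rfl fun a _ => ?_
  exact congrArg (fun s => FinMod.lin s (clsIncl φ (stdPicket k n 0 (c a)) (i a ∘ₗ h))) (ht a)

end FunctorF

/-! ### The functor `G` -/

section FunctorG

variable {k : Type u} [Field k] {n : ℕ} {T : Type u} [Ring T] (φ : T ≃+* FactorAlg k n)

/-- The functor `G`, with values in the modules over a ring `T` which is identified with
`A_n / ⟨e(n)⟩`. -/
abbrev cokerProj : S k n ⥤ FinMod T := Pair.proj ⋙ deltaAlpha φ

/-- The residue class in `G(X, Y)` of a map `E → Y / X`. -/
def clsProj (P : S k n) :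
    (AusGen k n →ₗ[Lam k n] (P.amb.obj ⧸ P.sub)) →+ ((cokerProj φ).obj P).obj :=
  cls φ (Pair.proj.obj P)

variable {φ}

theorem clsProj_surjective (P : S k n) : Function.Surjective (clsProj φ P) := cls_surjective _

theorem map_clsProj {P Q : S k n} (f : P ⟶ Q)
    (h : AusGen k n →ₗ[Lam k n] (P.amb.obj ⧸ P.sub)) :
    FinMod.lin ((cokerProj φ).map f) (clsProj φ P h) =
      clsProj φ Q (P.sub.mapQ Q.sub f.lin f.map_sub ∘ₗ h) := rfl

/-- As the projection `Y → Y / X` is surjective, maps through free modules need not be mentioned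
in the description of `G(X, Y)`. -/
theorem clsProj_eq_zero_iff (hn : 1 ≤ n) (P : S k n)
    (h : AusGen k n →ₗ[Lam k n] (P.amb.obj ⧸ P.sub)) :
    clsProj φ P h = 0 ↔ ∃ g : AusGen k n →ₗ[Lam k n] P.amb.obj, h = P.sub.mkQ ∘ₗ g := by
  refine (cls_eq_zero_iff hn (Pair.proj.obj P) h).trans ⟨?_, ?_⟩
  · rintro ⟨g, b, hb, rfl⟩
    obtain ⟨b', -, hb'⟩ := exists_lift_of_mem_projMaps P.sub.mkQ P.sub.mkQ_surjective hb
    let g' : AusGen k n →ₗ[Lam k n] P.amb.obj := g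
    exact ⟨g' + b', by rw [LinearMap.comp_add, hb']; rfl⟩
  · rintro ⟨g, rfl⟩
    exact ⟨g, 0, zero_mem _, (add_zero _).symm⟩

theorem hom_ext_clsProj {P : S k n} {L : FinMod T} {s t : (cokerProj φ).obj P ⟶ L}
    (h : ∀ z, FinMod.lin s (clsProj φ P z) = FinMod.lin t (clsProj φ P z)) : s = t :=
  hom_ext_cls h

theorem exists_linearMap_of_hom_cokerProj {P Q : S k n}
    (t : (cokerProj φ).obj P ⟶ (cokerProj φ).obj Q) :
    ∃ g : (P.amb.obj ⧸ P.sub) →ₗ[Lam k n] (Q.amb.obj ⧸ Q.sub),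
      ∀ h, FinMod.lin t (clsProj φ P h) = clsProj φ Q (g ∘ₗ h) :=
  exists_linearMap_of_hom t

theorem exists_eq_comp_of_clsProj_eq_zero (hn : 1 ≤ n) {Q : S k n} {M : Type u} [AddCommGroup M]
    [Module (Lam k n) M] [Module.Finite (Lam k n) M] (c : M →ₗ[Lam k n] (Q.amb.obj ⧸ Q.sub))
    (hc : ∀ h : AusGen k n →ₗ[Lam k n] M, clsProj φ Q (c ∘ₗ h) = 0) :
    ∃ a : M →ₗ[Lam k n] Q.amb.obj, c = Q.sub.mkQ ∘ₗ a := by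
  obtain ⟨a, b, hb, hab⟩ := exists_eq_comp_add_of_cls_eq_zero hn (f := Pair.proj.obj Q) c hc
  obtain ⟨b', -, hb'⟩ := exists_lift_of_mem_projMaps Q.sub.mkQ Q.sub.mkQ_surjective hb
  let a' : M →ₗ[Lam k n] Q.amb.obj := a
  exact ⟨a' + b', by rw [LinearMap.comp_add, hb']; exact hab⟩

theorem clsProj_mkQ_comp (hn : 1 ≤ n) {P : S k n} (g : AusGen k n →ₗ[Lam k n] P.amb.obj) :
    clsProj φ P (P.sub.mkQ ∘ₗ g) = 0 :=
  (clsProj_eq_zero_iff hn P _).2 ⟨g, rfl⟩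

theorem nonempty_cokerProj_iso (hn : 1 ≤ n) {P : S k n} {L : FinMod T}
    (t : (AusGen k n →ₗ[Lam k n] (P.amb.obj ⧸ P.sub)) →+ L.obj)
    (ht : ∀ (a : AusAlg k n) h, t (a • h) = ausToRing φ a • t h) (hs : Function.Surjective t)
    (hf : ∀ h, t h = 0 ↔ clsProj φ P h = 0) : Nonempty ((cokerProj φ).obj P ≅ L) :=
  nonempty_iso_of_equivariant hn (f := Pair.proj.obj P) t ht hs hf

variable (φ)

instance cokerProj_additive : (cokerProj φ).Additive where
  map_add {P Q f g} := hom_ext_clsProj fun h => by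
    have h0 : P.sub.mapQ Q.sub (f + g).lin (f + g).map_sub ∘ₗ h =
        P.sub.mapQ Q.sub f.lin f.map_sub ∘ₗ h + P.sub.mapQ Q.sub g.lin g.map_sub ∘ₗ h := by
      refine LinearMap.ext fun z => ?_
      rw [LinearMap.add_apply, LinearMap.comp_apply, LinearMap.comp_apply, LinearMap.comp_apply]
      obtain ⟨y, hy⟩ := P.sub.mkQ_surjective (h z)
      rw [← hy]
      rfl
    exact (congrArg (clsProj φ Q) h0).trans (map_add _ _ _)

/-- A homomorphism `G(X, Y) → G(X', Y')` is induced by a map `Y / X → Y' / X'` which lifts to a map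
`Y → Y'` up to a map through a free module, and the latter lifts as well. -/
theorem cokerProj_full (hn : 1 ≤ n) : (cokerProj φ).Full where
  map_surjective {P Q} t := by
    obtain ⟨g, hg⟩ := exists_linearMap_of_hom_cokerProj t
    obtain ⟨a, ha⟩ := exists_eq_comp_of_clsProj_eq_zero (φ := φ) hn (g ∘ₗ P.sub.mkQ) fun h => by
      refine (hg (P.sub.mkQ ∘ₗ h)).symm.trans ?_
      rw [clsProj_mkQ_comp hn, map_zero]
    have hga : ∀ y, g (P.sub.mkQ y) = Q.sub.mkQ (a y) := LinearMap.congr_fun ha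
    let f : P ⟶ Q := ⟨a, fun x hx => by
      have h0 : P.sub.mkQ x = 0 := (Submodule.Quotient.mk_eq_zero _).2 hx
      refine (Submodule.Quotient.mk_eq_zero Q.sub).1 ?_
      exact (hga x).symm.trans (by rw [h0, map_zero])⟩
    have hf : P.sub.mapQ Q.sub f.lin f.map_sub = g := by
      refine LinearMap.ext fun z => ?_
      obtain ⟨y, rfl⟩ := P.sub.mkQ_surjective z
      exact (hga y).symm
    refine ⟨f, hom_ext_clsProj fun h => ?_⟩
    rw [hg, map_clsProj, hf]

/-- If `G` kills a morphism, then the induced map `Y / X → Y' / X'` lifts to a map `a` into `Y'`.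
The morphism is the sum of the composition of `a` with the projection of `Y`, and a map into
`X'`. -/
theorem inIdeal_of_cokerProj_map_eq_zero (hn : 1 ≤ n) {K : ObjectProperty (S k n)}
    (hK : ∀ c ≤ n, K (stdPicket k n c c)) (hK' : ∀ c ≤ n, K (stdPicket k n 0 c)) {P Q : S k n}
    (f : P ⟶ Q) (hf : (cokerProj φ).map f = 0) : InIdeal K f := by
  have := finite_of_finLen (finLen_quotient P.amb.property P.sub)
  obtain ⟨a, ha⟩ := exists_eq_comp_of_clsProj_eq_zero (φ := φ) hn
    (P.sub.mapQ Q.sub f.lin f.map_sub) fun h =>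
      congrArg (fun t => FinMod.lin t (clsProj φ P h)) hf
  let f₁ : P ⟶ Q := ⟨a ∘ₗ P.sub.mkQ, fun x hx => by
    have h0 : P.sub.mkQ x = 0 := (Submodule.Quotient.mk_eq_zero _).2 hx
    rw [Submodule.mem_comap, LinearMap.comp_apply, h0, map_zero]
    exact zero_mem _⟩
  rw [← sub_add_cancel f f₁]
  refine (inIdeal_of_range_le hK _ fun y => ?_).add (inIdeal_of_comp_mkQ hK' f₁ a rfl)
  refine (Submodule.Quotient.mk_eq_zero Q.sub).1 ?_
  have h1 : Q.sub.mkQ (f.lin y) = Q.sub.mkQ (a (P.sub.mkQ y)) :=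
    LinearMap.congr_fun ha (P.sub.mkQ y)
  rw [Pair.sub_lin]
  refine (map_sub Q.sub.mkQ (f.lin y) (a (P.sub.mkQ y))).trans ?_
  rw [h1, sub_self]

theorem isZero_cokerProj_of_eq (hn : 1 ≤ n) (c : ℕ) :
    IsZero ((cokerProj φ).obj (stdPicket k n c c)) := by
  refine FinMod.isZero_iff.2 fun x => ?_
  obtain ⟨h, rfl⟩ := clsProj_surjective (φ := φ) (stdPicket k n c c) x
  have h0 : h = (stdPicket k n c c).sub.mkQ ∘ₗ 0 := by
    refine LinearMap.ext fun z => ?_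
    obtain ⟨y, hy⟩ := (stdPicket k n c c).sub.mkQ_surjective (h z)
    rw [← hy, LinearMap.comp_apply, LinearMap.zero_apply, map_zero]
    exact (Submodule.Quotient.mk_eq_zero _).2 ((mem_stdPicket_sub _).2 (Cyc.x_pow_smul y))
  rw [h0]
  exact clsProj_mkQ_comp hn (P := stdPicket k n c c) 0

theorem isZero_cokerProj_of_bot (hn : 1 ≤ n) (c : ℕ) :
    IsZero ((cokerProj φ).obj (stdPicket k n 0 c)) := by
  refine FinMod.isZero_iff.2 fun x => ?_
  obtain ⟨h, rfl⟩ := clsProj_surjective (φ := φ) (stdPicket k n 0 c) x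
  have hinj : Function.Injective (stdPicket k n 0 c).sub.mkQ := by
    rw [injective_iff_map_eq_zero]
    intro y hy
    have h0 := (mem_stdPicket_sub _).1 ((Submodule.Quotient.mk_eq_zero _).1 hy)
    rwa [pow_zero, one_smul] at h0
  let e := LinearEquiv.ofBijective _ ⟨hinj, (stdPicket k n 0 c).sub.mkQ_surjective⟩
  refine (clsProj_eq_zero_iff hn _ h).2 ⟨e.symm.toLinearMap ∘ₗ h, LinearMap.ext fun z => ?_⟩
  exact (e.apply_symm_apply (h z)).symm

/-- A presentation `E^l → E^m` of a module is made surjective by adding a projective cover of `E^m`,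
which does not change the value of `δα`. -/
theorem cokerProj_essSurj (hn : 1 ≤ n) : (cokerProj φ).EssSurj where
  mem_essImage L := by
    obtain ⟨l, m, f, t, ht, hs, hf⟩ := exists_presentation (φ := φ) L
    obtain ⟨q, π, hπ⟩ := Module.Finite.exists_fin' (Lam k n) (Fin m → AusGen k n)
    have hfπ : Function.Surjective (f.coprod π) := fun z => by
      obtain ⟨w, rfl⟩ := hπ z
      exact ⟨(0, w), by simp⟩
    let P : S k n := ⟨FinMod.of _ ((Fin l → AusGen k n) × (Fin q → Lam k n)) (finLen_of_finite _),
      LinearMap.ker (f.coprod π)⟩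
    let e : (P.amb.obj ⧸ P.sub) ≃ₗ[Lam k n] (Fin m → AusGen k n) :=
      (f.coprod π).quotKerEquivOfSurjective hfπ
    have he : ∀ y, e (P.sub.mkQ y) = f.coprod π y := fun _ => rfl
    let t' : (AusGen k n →ₗ[Lam k n] (P.amb.obj ⧸ P.sub)) →+ L.obj :=
      t.comp (AddMonoidHom.mk' (fun h => e.toLinearMap ∘ₗ h)
        fun _ _ => LinearMap.comp_add _ _ _)
    have ht' : ∀ (a : AusAlg k n) h, t' (a • h) = ausToRing φ a • t' h := fun a h =>
      ht a (e.toLinearMap ∘ₗ h)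
    refine ⟨P, nonempty_cokerProj_iso hn t' ht' (fun z => ?_) fun h => ?_⟩
    · obtain ⟨h, rfl⟩ := hs z
      exact ⟨e.symm.toLinearMap ∘ₗ h,
        congrArg t (LinearMap.ext fun z => e.apply_symm_apply (h z))⟩
    · rw [clsProj_eq_zero_iff hn]
      constructor
      · intro h0
        obtain ⟨g, hg⟩ := (hf _).1 h0
        refine ⟨LinearMap.inl _ _ _ ∘ₗ g, LinearMap.ext fun z => e.injective ?_⟩
        have h1 : e (h z) = f (g z) := LinearMap.congr_fun hg z
        refine h1.trans ((he (LinearMap.inl _ _ _ (g z))).trans ?_).symm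
        simp
      · rintro ⟨g, rfl⟩
        have h1 : e.toLinearMap ∘ₗ P.sub.mkQ ∘ₗ g =
            f ∘ₗ LinearMap.fst _ _ _ ∘ₗ g + π ∘ₗ LinearMap.snd _ _ _ ∘ₗ g := by
          refine LinearMap.ext fun z => (he (g z)).trans ?_
          rfl
        change t (e.toLinearMap ∘ₗ P.sub.mkQ ∘ₗ g) = 0
        rw [h1, map_add, (hf _).2 ⟨_, rfl⟩, zero_add]
        refine eq_zero_of_mem_projMaps_of_equivariant hn t ht ?_
        exact mem_projMaps_comp_of_free π _

theorem projective_cokerProj (hn : 1 ≤ n) (c : ℕ) :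
    Projective ((cokerProj φ).obj (stdPicket k n c n)) :=
  projective_deltaAlpha hn fun g => comp_mem_projMaps _ (mem_projMaps_cyc g)

theorem exists_generators_cokerProj (P : S k n) :
    ∃ (m : ℕ) (B : Fin m → S k n) (_ : ∀ i, ∃ c ≤ n, B i = stdPicket k n c n)
      (r : ∀ i, B i ⟶ P), ∀ ⦃W : FinMod T⦄ (t : (cokerProj φ).obj P ⟶ W),
        (∀ i, (cokerProj φ).map (r i) ≫ t = 0) → t = 0 := by
  have := finite_of_finLen (finLen_quotient P.amb.property P.sub)
  obtain ⟨m, c, hc, i, p, hip⟩ := exists_sum_cyc_eq_id (k := k) (n := n) (P.amb.obj ⧸ P.sub)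
  -- `[n] → [c a] → Y / X` lifts to `Y`, and `[c a]` is the factor module of `[n]` by `[n - c a]`
  choose y hy using fun a => P.sub.mkQ_surjective (p a (Cyc.gen (c a)))
  have hy0 : ∀ a, Lam.x k n ^ n • y a = 0 := fun a => by
    rw [Lam.x_pow_n]
    exact zero_smul (Lam k n) (y a)
  let r : ∀ a, stdPicket k n (n - c a) n ⟶ P := fun a => ⟨Cyc.lift n (y a) (hy0 a), fun z hz => by
    obtain ⟨w, rfl⟩ := (Cyc.x_pow_smul_eq_zero_iff le_rfl (Nat.sub_le n (c a)) z).1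
      ((mem_stdPicket_sub _).1 hz)
    obtain ⟨d, rfl⟩ := Cyc.exists_smul_gen w
    refine (Submodule.Quotient.mk_eq_zero P.sub).1 ?_
    change P.sub.mkQ (Cyc.lift n (y a) (hy0 a) (Lam.x k n ^ (n - (n - c a)) • d • Cyc.gen n)) = 0
    rw [Nat.sub_sub_self (hc a), map_smul, map_smul, map_smul, Cyc.lift_gen, map_smul, hy,
      smul_comm, ← map_smul, Cyc.x_pow_smul, map_zero, smul_zero]⟩
  have hv : ∀ a, Lam.x k n ^ c a • (stdPicket k n (n - c a) n).sub.mkQ (Cyc.gen n) = 0 :=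
      fun a => by
    rw [← map_smul]
    refine (Submodule.Quotient.mk_eq_zero _).2 ((mem_stdPicket_sub _).2 ?_)
    rw [smul_smul, ← pow_add, Nat.sub_add_cancel (hc a), Cyc.x_pow_smul]
  let v := fun a => Cyc.lift (c a) _ (hv a)
  have hrv : ∀ a, (stdPicket k n (n - c a) n).sub.mapQ P.sub (r a).lin (r a).map_sub ∘ₗ v a
      = p a := fun a => Cyc.hom_ext (by
    rw [LinearMap.comp_apply, Cyc.lift_gen, ← hy]
    exact congrArg P.sub.mkQ (Cyc.lift_gen n (y a) (hy0 a)))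
  refine ⟨m, fun a => stdPicket k n (n - c a) n, fun a => ⟨_, Nat.sub_le _ _, rfl⟩, r,
    fun W t ht => hom_ext_clsProj fun h => ?_⟩
  rw [← sum_comp_of_sum_comp_eq_id hip h, map_sum, map_sum, map_sum]
  refine Finset.sum_congr rfl fun a _ => ?_
  rw [← hrv a]
  exact congrArg (fun s => FinMod.lin s
    (clsProj φ (stdPicket k n (n - c a) n) (v a ∘ₗ i a ∘ₗ h))) (ht a)

end FunctorG

/-! ### The classes `𝒰` and `𝒱` -/

section Classes

variable {k : Type u} [Field k] {n : ℕ}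

theorem setU_stdPicket {i j : ℕ} (hij : i ≤ j) (hj : j ≤ n) (h : i = j ∨ j = n) :
    setU k n (stdPicket k n i j) := ⟨i, j, isPicket_stdPicket hij hj, h⟩

theorem setV_stdPicket {i j : ℕ} (hij : i ≤ j) (hj : j ≤ n) (h : i = j ∨ i = 0) :
    setV k n (stdPicket k n i j) := ⟨i, j, isPicket_stdPicket hij hj, h⟩

theorem localEnd_of_isPicket {i j : ℕ} {P : S k n} (h : IsPicket i j P) : LocalEnd P :=
  let ⟨e⟩ := h.nonempty_iso
  (localEnd_stdPicket i j).of_iso e.symm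

theorem isPicket_of_iso {i j : ℕ} {P : S k n} (hij : i ≤ j) (hj : j ≤ n)
    (e : P ≅ stdPicket k n i j) : IsPicket i j P :=
  ⟨hij, hj, ⟨Pair.subEquivOfIso e ≪≫ₗ (stdPicketSubEquiv hij hj).symm⟩, ⟨Pair.equivOfIso e⟩⟩

theorem eq_of_isPicket {i j i' j' : ℕ} {P : S k n} (h : IsPicket i j P) (h' : IsPicket i' j' P) :
    i = i' ∧ j = j' := by
  obtain ⟨e⟩ := h.nonempty_iso
  obtain ⟨e'⟩ := h'.nonempty_iso
  exact eq_of_stdPicket_iso h.1 h.2.1 h'.1 h'.2.1 (e.symm ≪≫ e')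

theorem isZero_iff_of_isPicket {i j : ℕ} {P : S k n} (h : IsPicket i j P) : IsZero P ↔ j = 0 := by
  obtain ⟨e⟩ := h.nonempty_iso
  rw [e.isZero_iff, isZero_stdPicket_iff h.2.1]

theorem isPicket_congr {i j : ℕ} {P Q : S k n} (e : P ≅ Q) (h : IsPicket i j Q) :
    IsPicket i j P := by
  obtain ⟨e'⟩ := h.nonempty_iso
  exact isPicket_of_iso h.1 h.2.1 (e ≪≫ e')

/-- The index of a functor which kills, up to isomorphism, the indecomposable pairs with `2n` given
dimension types. -/
theorem index_eq {D : Type*} [Category D] [Preadditive D] (F : S k n ⥤ D)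
    (p : Fin n ⊕ Fin n → ℕ × ℕ) (hp : Function.Injective p)
    (hle : ∀ s, (p s).1 ≤ (p s).2 ∧ (p s).2 ≤ n)
    (hF : ∀ A, (Indecomposable A ∧ IsZero (F.obj A)) ↔ ∃ s, IsPicket (p s).1 (p s).2 A) :
    index F = ((2 * n : ℕ) : ℕ∞) := by
  let q : Fin n ⊕ Fin n → Quotient (isIsomorphicSetoid (S k n)) :=
    fun s => Quotient.mk _ (stdPicket k n (p s).1 (p s).2)
  have hset : {c : Quotient (isIsomorphicSetoid (S k n)) |
      ∃ A : S k n, Indecomposable A ∧ IsZero (F.obj A) ∧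
        Quotient.mk (isIsomorphicSetoid (S k n)) A = c} = Set.range q := by
    ext c
    constructor
    · rintro ⟨A, hA, h0, rfl⟩
      obtain ⟨s, hs⟩ := (hF A).1 ⟨hA, h0⟩
      obtain ⟨e⟩ := hs.nonempty_iso
      exact ⟨s, Quotient.sound ⟨e.symm⟩⟩
    · rintro ⟨s, rfl⟩
      obtain ⟨h1, h2⟩ := (hF (stdPicket k n (p s).1 (p s).2)).2
        ⟨s, isPicket_stdPicket (hle s).1 (hle s).2⟩
      exact ⟨_, h1, h2, rfl⟩
  have hq : Function.Injective q := fun s s' h => by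
    obtain ⟨e⟩ := Quotient.exact h
    obtain ⟨h1, h2⟩ := eq_of_stdPicket_iso (hle s).1 (hle s).2 (hle s').1 (hle s').2 e
    exact hp (Prod.ext h1 h2)
  rw [index, hset, ← Set.image_univ, hq.encard_image, Set.encard_univ,
    ENat.card_eq_coe_fintype_card, Fintype.card_sum, Fintype.card_fin, two_mul]

end Classes

/-! ### The properties of `F` -/

section PropertiesF

variable {k : Type u} [Field k] {n : ℕ} {T : Type u} [Ring T] (φ : T ≃+* FactorAlg k n)

theorem cokerIncl_map_eq_zero_iff (hn : 1 ≤ n) ⦃P Q : S k n⦄ (f : P ⟶ Q) :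
    (cokerIncl φ).map f = 0 ↔ InIdeal (setU k n) f := by
  refine ⟨inIdeal_of_cokerIncl_map_eq_zero φ hn
    (fun c hc => setU_stdPicket le_rfl hc (Or.inl rfl))
    (fun c hc => setU_stdPicket hc le_rfl (Or.inr rfl)) f,
    map_eq_zero_of_inIdeal fun A hA => ?_⟩
  obtain ⟨i, j, hA, rfl | rfl⟩ := hA
  · obtain ⟨e⟩ := hA.nonempty_iso
    exact (isZero_cokerIncl_of_eq φ hn i).of_iso ((cokerIncl φ).mapIso e)
  · obtain ⟨e⟩ := hA.nonempty_iso
    exact (isZero_cokerIncl_of_top φ hn i).of_iso ((cokerIncl φ).mapIso e)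

theorem indecomposable_and_isZero_cokerIncl_iff (hn : 1 ≤ n) (A : S k n) :
    (Indecomposable A ∧ IsZero ((cokerIncl φ).obj A)) ↔
      ∃ i j, IsPicket i j A ∧ j ≠ 0 ∧ (i = j ∨ j = n) := by
  rw [indecomposable_and_isZero_obj_iff (cokerIncl_map_eq_zero_iff φ hn)
    fun B ⟨_, _, hB, _⟩ => localEnd_of_isPicket hB]
  constructor
  · rintro ⟨B, ⟨i, j, hB, hij⟩, h0, ⟨e⟩⟩
    exact ⟨i, j, isPicket_congr e hB, mt (isZero_iff_of_isPicket hB).2 h0, hij⟩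
  · rintro ⟨i, j, hA, h0, hij⟩
    exact ⟨A, ⟨i, j, hA, hij⟩, mt (isZero_iff_of_isPicket hA).1 h0, ⟨Iso.refl A⟩⟩

theorem index_cokerIncl (hn : 1 ≤ n) : index (cokerIncl φ) = ((2 * n : ℕ) : ℕ∞) := by
  refine index_eq _ (Sum.elim (fun a => (a.val + 1, a.val + 1)) fun a => (a.val, n)) ?_ ?_
    fun A => (indecomposable_and_isZero_cokerIncl_iff φ hn A).trans ⟨?_, ?_⟩
  · rintro (⟨a, ha⟩ | ⟨a, ha⟩) (⟨b, hb⟩ | ⟨b, hb⟩) h <;>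
      simp only [Sum.elim_inl, Sum.elim_inr, Prod.mk.injEq] at h
    · congr 2; omega
    · omega
    · omega
    · congr 2; omega
  · rintro (⟨a, ha⟩ | ⟨a, ha⟩) <;> simp only [Sum.elim_inl, Sum.elim_inr] <;> omega
  · rintro ⟨i, j, hA, h0, hij⟩
    obtain ⟨h1, h2, -⟩ := id hA
    by_cases h : i = j
    · refine ⟨Sum.inl ⟨j - 1, by omega⟩, ?_⟩
      subst h
      simpa only [Sum.elim_inl, Nat.sub_add_cancel (Nat.pos_of_ne_zero h0)] using hA
    · obtain rfl := hij.resolve_left h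
      exact ⟨Sum.inr ⟨i, by omega⟩, hA⟩
  · rintro ⟨a | a, hA⟩
    · exact ⟨_, _, hA, Nat.succ_ne_zero _, Or.inl rfl⟩
    · exact ⟨_, _, hA, by simp only [Sum.elim_inr]; omega, Or.inr rfl⟩

/-- The functor `F` has all the asserted properties, for any identification of a ring `T` with
`A_n / ⟨e(n)⟩`. -/
theorem cokerIncl_properties (hn : 1 ≤ n) :
    (cokerIncl φ).Additive ∧ (cokerIncl φ).Full ∧ (cokerIncl φ).EssSurj ∧
      IsObjective (cokerIncl φ) ∧ index (cokerIncl φ) = ((2 * n : ℕ) : ℕ∞) ∧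
      (∀ ⦃P Q : S k n⦄ (f : P ⟶ Q), (cokerIncl φ).map f = 0 ↔ InIdeal (setU k n) f) ∧
      ∃ e : FactorCat (setU k n) ≌ FinMod T,
        e.functor.Additive ∧ Nonempty (factorFunctor (setU k n) ⋙ e.functor ≅ cokerIncl φ) :=
  have := cokerIncl_full φ hn
  have := cokerIncl_essSurj φ hn
  ⟨inferInstance, inferInstance, inferInstance,
    isObjective_of_kernel_eq (cokerIncl_map_eq_zero_iff φ hn), index_cokerIncl φ hn,
    cokerIncl_map_eq_zero_iff φ hn,
    exists_equivalence_factorCat (cokerIncl_map_eq_zero_iff φ hn)⟩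

end PropertiesF

section FactorU

variable (k : Type u) [Field k] (n : ℕ)

theorem factorCat_setU_abelian (hn : 1 ≤ n) :
    (∃ h : Abelian (FactorCat (setU k n)), h.toPreadditive = factorPreadditive (setU k n)) ∧
      EnoughProjectives (FactorCat (setU k n)) := by
  let φ := RingEquiv.refl (FactorAlg k n)
  have := cokerIncl_full φ hn
  have := cokerIncl_essSurj φ hn
  refine ⟨exists_abelian_factorCat (cokerIncl_map_eq_zero_iff φ hn),
    enoughProjectives_factorCat (cokerIncl_map_eq_zero_iff φ hn)
      (T := fun B => ∃ c ≤ n, B = stdPicket k n 0 c) ?_ (exists_generators_cokerIncl φ)⟩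
  rintro _ ⟨c, -, rfl⟩
  exact projective_cokerIncl φ hn c

theorem indecomposable_projective_setU_iff (hn : 1 ≤ n) (P : FactorCat (setU k n)) :
    (Indecomposable P ∧ Projective P) ↔
      ∃ (Z : S k n) (j : ℕ), 1 ≤ j ∧ j ≤ n - 1 ∧ IsPicket 0 j Z ∧
        Nonempty (P ≅ (factorFunctor (setU k n)).obj Z) := by
  let φ := RingEquiv.refl (FactorAlg k n)
  have := cokerIncl_full φ hn
  have := cokerIncl_essSurj φ hn
  rw [indecomposable_and_projective_iff (cokerIncl_map_eq_zero_iff φ hn)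
    (T := fun B => ∃ c ≤ n, B = stdPicket k n 0 c) (by
      rintro _ ⟨c, -, rfl⟩
      exact projective_cokerIncl φ hn c) (exists_generators_cokerIncl φ) (by
      rintro _ ⟨c, -, rfl⟩
      exact localEnd_stdPicket 0 c)]
  constructor
  · rintro ⟨_, ⟨c, hc, rfl⟩, h0, he⟩
    refine ⟨_, c, ?_, ?_, isPicket_stdPicket (Nat.zero_le c) hc, he⟩
    · by_contra h
      obtain rfl : c = 0 := by omega
      exact h0 (isZero_cokerIncl_of_eq φ hn 0)
    · by_contra h
      obtain rfl : c = n := by omega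
      exact h0 (isZero_cokerIncl_of_top φ hn 0)
  · rintro ⟨Z, j, h1, h2, hZ, ⟨e⟩⟩
    obtain ⟨e'⟩ := hZ.nonempty_iso
    refine ⟨_, ⟨j, hZ.2.1, rfl⟩, fun h0 => ?_, ⟨e ≪≫ (factorFunctor (setU k n)).mapIso e'⟩⟩
    have hP := isPicket_stdPicket (k := k) hZ.1 hZ.2.1
    obtain ⟨i', j', hP', -, h⟩ := (indecomposable_and_isZero_cokerIncl_iff φ hn _).1
      ⟨(localEnd_stdPicket 0 j).indecomposable
        (mt (isZero_iff_of_isPicket hP).1 (by omega)), h0⟩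
    obtain ⟨rfl, rfl⟩ := eq_of_isPicket hP hP'
    omega

end FactorU

/-! ### The properties of `G` -/

section PropertiesG

variable {k : Type u} [Field k] {n : ℕ} {T : Type u} [Ring T] (φ : T ≃+* FactorAlg k n)

theorem cokerProj_map_eq_zero_iff (hn : 1 ≤ n) ⦃P Q : S k n⦄ (f : P ⟶ Q) :
    (cokerProj φ).map f = 0 ↔ InIdeal (setV k n) f := by
  refine ⟨inIdeal_of_cokerProj_map_eq_zero φ hn
    (fun c hc => setV_stdPicket le_rfl hc (Or.inl rfl))
    (fun c hc => setV_stdPicket (Nat.zero_le c) hc (Or.inr rfl)) f,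
    map_eq_zero_of_inIdeal fun A hA => ?_⟩
  obtain ⟨i, j, hA, rfl | rfl⟩ := hA
  · obtain ⟨e⟩ := hA.nonempty_iso
    exact (isZero_cokerProj_of_eq φ hn i).of_iso ((cokerProj φ).mapIso e)
  · obtain ⟨e⟩ := hA.nonempty_iso
    exact (isZero_cokerProj_of_bot φ hn j).of_iso ((cokerProj φ).mapIso e)

theorem indecomposable_and_isZero_cokerProj_iff (hn : 1 ≤ n) (A : S k n) :
    (Indecomposable A ∧ IsZero ((cokerProj φ).obj A)) ↔
      ∃ i j, IsPicket i j A ∧ j ≠ 0 ∧ (i = j ∨ i = 0) := by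
  rw [indecomposable_and_isZero_obj_iff (cokerProj_map_eq_zero_iff φ hn)
    fun B ⟨_, _, hB, _⟩ => localEnd_of_isPicket hB]
  constructor
  · rintro ⟨B, ⟨i, j, hB, hij⟩, h0, ⟨e⟩⟩
    exact ⟨i, j, isPicket_congr e hB, mt (isZero_iff_of_isPicket hB).2 h0, hij⟩
  · rintro ⟨i, j, hA, h0, hij⟩
    exact ⟨A, ⟨i, j, hA, hij⟩, mt (isZero_iff_of_isPicket hA).1 h0, ⟨Iso.refl A⟩⟩

theorem index_cokerProj (hn : 1 ≤ n) : index (cokerProj φ) = ((2 * n : ℕ) : ℕ∞) := by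
  refine index_eq _ (Sum.elim (fun a => (a.val + 1, a.val + 1)) fun a => (0, a.val + 1)) ?_ ?_
    fun A => (indecomposable_and_isZero_cokerProj_iff φ hn A).trans ⟨?_, ?_⟩
  · rintro (⟨a, ha⟩ | ⟨a, ha⟩) (⟨b, hb⟩ | ⟨b, hb⟩) h <;>
      simp only [Sum.elim_inl, Sum.elim_inr, Prod.mk.injEq] at h
    · congr 2; omega
    · omega
    · omega
    · congr 2; omega
  · rintro (⟨a, ha⟩ | ⟨a, ha⟩) <;> simp only [Sum.elim_inl, Sum.elim_inr] <;> omega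
  · rintro ⟨i, j, hA, h0, hij⟩
    obtain ⟨h1, h2, -⟩ := id hA
    rcases hij with rfl | rfl
    · refine ⟨Sum.inl ⟨i - 1, by omega⟩, ?_⟩
      simpa only [Sum.elim_inl, Nat.sub_add_cancel (Nat.pos_of_ne_zero h0)] using hA
    · refine ⟨Sum.inr ⟨j - 1, by omega⟩, ?_⟩
      simpa only [Sum.elim_inr, Nat.sub_add_cancel (Nat.pos_of_ne_zero h0)] using hA
  · rintro ⟨a | a, hA⟩
    · exact ⟨_, _, hA, Nat.succ_ne_zero _, Or.inl rfl⟩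
    · exact ⟨_, _, hA, Nat.succ_ne_zero _, Or.inr rfl⟩

/-- The functor `G` has all the asserted properties, for any identification of a ring `T` with
`A_n / ⟨e(n)⟩`. -/
theorem cokerProj_properties (hn : 1 ≤ n) :
    (cokerProj φ).Additive ∧ (cokerProj φ).Full ∧ (cokerProj φ).EssSurj ∧
      IsObjective (cokerProj φ) ∧ index (cokerProj φ) = ((2 * n : ℕ) : ℕ∞) ∧
      (∀ ⦃P Q : S k n⦄ (f : P ⟶ Q), (cokerProj φ).map f = 0 ↔ InIdeal (setV k n) f) ∧
      ∃ e : FactorCat (setV k n) ≌ FinMod T,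
        e.functor.Additive ∧ Nonempty (factorFunctor (setV k n) ⋙ e.functor ≅ cokerProj φ) :=
  have := cokerProj_full φ hn
  have := cokerProj_essSurj φ hn
  ⟨inferInstance, inferInstance, inferInstance,
    isObjective_of_kernel_eq (cokerProj_map_eq_zero_iff φ hn), index_cokerProj φ hn,
    cokerProj_map_eq_zero_iff φ hn,
    exists_equivalence_factorCat (cokerProj_map_eq_zero_iff φ hn)⟩

end PropertiesG

section FactorV

variable (k : Type u) [Field k] (n : ℕ)

theorem factorCat_setV_abelian (hn : 1 ≤ n) :
    (∃ h : Abelian (FactorCat (setV k n)), h.toPreadditive = factorPreadditive (setV k n)) ∧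
      EnoughProjectives (FactorCat (setV k n)) := by
  let φ := RingEquiv.refl (FactorAlg k n)
  have := cokerProj_full φ hn
  have := cokerProj_essSurj φ hn
  refine ⟨exists_abelian_factorCat (cokerProj_map_eq_zero_iff φ hn),
    enoughProjectives_factorCat (cokerProj_map_eq_zero_iff φ hn)
      (T := fun B => ∃ c ≤ n, B = stdPicket k n c n) ?_ (exists_generators_cokerProj φ)⟩
  rintro _ ⟨c, -, rfl⟩
  exact projective_cokerProj φ hn c

theorem indecomposable_projective_setV_iff (hn : 1 ≤ n) (P : FactorCat (setV k n)) :
    (Indecomposable P ∧ Projective P) ↔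
      ∃ (Z : S k n) (i : ℕ), 1 ≤ i ∧ i ≤ n - 1 ∧ IsPicket i n Z ∧
        Nonempty (P ≅ (factorFunctor (setV k n)).obj Z) := by
  let φ := RingEquiv.refl (FactorAlg k n)
  have := cokerProj_full φ hn
  have := cokerProj_essSurj φ hn
  rw [indecomposable_and_projective_iff (cokerProj_map_eq_zero_iff φ hn)
    (T := fun B => ∃ c ≤ n, B = stdPicket k n c n) (by
      rintro _ ⟨c, -, rfl⟩
      exact projective_cokerProj φ hn c) (exists_generators_cokerProj φ) (by
      rintro _ ⟨c, -, rfl⟩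
      exact localEnd_stdPicket c n)]
  constructor
  · rintro ⟨_, ⟨c, hc, rfl⟩, h0, he⟩
    refine ⟨_, c, ?_, ?_, isPicket_stdPicket hc le_rfl, he⟩
    · by_contra h
      obtain rfl : c = 0 := by omega
      exact h0 (isZero_cokerProj_of_bot φ hn n)
    · by_contra h
      obtain rfl : c = n := by omega
      exact h0 (isZero_cokerProj_of_eq φ hn c)
  · rintro ⟨Z, i, h1, h2, hZ, ⟨e⟩⟩
    obtain ⟨e'⟩ := hZ.nonempty_iso
    refine ⟨_, ⟨i, hZ.1, rfl⟩, fun h0 => ?_, ⟨e ≪≫ (factorFunctor (setV k n)).mapIso e'⟩⟩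
    have hP := isPicket_stdPicket (k := k) hZ.1 hZ.2.1
    obtain ⟨i', j', hP', -, h⟩ := (indecomposable_and_isZero_cokerProj_iff φ hn _).1
      ⟨(localEnd_stdPicket i n).indecomposable
        (mt (isZero_iff_of_isPicket hP).1 (by omega)), h0⟩
    obtain ⟨rfl, rfl⟩ := eq_of_isPicket hP hP'
    omega

end FactorV

/-! ### Normal forms in the preprojective algebra of type `A_m` -/

section Preproj

variable (k : Type u) [Field k] (m : ℕ)

/-- The idempotent of `Π_m` at the vertex `i`, extended by `0` to all natural numbers `i`. -/
def PreprojA.e (i : ℕ) : PreprojA k m :=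
  if h : i < m then PreprojA.vertexIdem k ⟨i, h⟩ else 0

variable {m} in
/-- The element of `Π_m` given by an arrow. -/
def PreprojA.arrow (a : ArrowA m) : PreprojA k m :=
  RingQuot.mkAlgHom k _ (FreeAlgebra.ι k (DoubleGen.arrow a))

variable {m} in
/-- The element of `Π_m` given by the opposite of an arrow. -/
def PreprojA.star (a : ArrowA m) : PreprojA k m :=
  RingQuot.mkAlgHom k _ (FreeAlgebra.ι k (DoubleGen.star a))

/-- The sum of all arrows of `Π_m`. -/
def PreprojA.up : PreprojA k m := ∑ a, PreprojA.arrow k a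

/-- The sum of all opposite arrows of `Π_m`. -/
def PreprojA.down : PreprojA k m := ∑ a, PreprojA.star k a

namespace PreprojA

variable {k m}

theorem e_of_lt {i : ℕ} (h : i < m) : e k m i = vertexIdem k ⟨i, h⟩ := dif_pos h

theorem e_of_le {i : ℕ} (h : m ≤ i) : e k m i = 0 := dif_neg (by omega)

theorem e_mul_e (i j : ℕ) : e k m i * e k m j = if i = j then e k m i else 0 := by
  by_cases hi : i < m
  · by_cases hj : j < m
    · rw [e_of_lt hi, e_of_lt hj, vertexIdem, vertexIdem, ← map_mul]
      split_ifs with h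
      · subst h
        exact RingQuot.mkAlgHom_rel k (PreprojRel.idem _)
      · exact (RingQuot.mkAlgHom_rel k (PreprojRel.orth _ _
          fun h' => h (congrArg Fin.val h'))).trans (map_zero _)
    · rw [e_of_le (not_lt.1 hj), mul_zero, if_neg (by omega)]
  · rw [e_of_le (not_lt.1 hi), zero_mul, ite_self]

theorem sum_e : ∑ i : Fin m, e k m i.val = 1 := by
  have h := RingQuot.mkAlgHom_rel k (PreprojRel.one (k := k) (V := Fin m) (Q := ArrowA m)
    (s := fun a => a.1.1) (t := fun a => a.1.2))
  rw [map_sum, map_one] at h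
  refine Eq.trans (Finset.sum_congr rfl fun i _ => ?_) h
  rw [e_of_lt i.isLt]
  rfl

theorem e_mul_arrow (i : ℕ) (a : ArrowA m) :
    e k m i * arrow k a = if i = a.1.2.val then arrow k a else 0 := by
  have h : e k m a.1.2.val * arrow k a = arrow k a := by
    rw [e_of_lt a.1.2.isLt, vertexIdem, arrow, ← map_mul]
    exact RingQuot.mkAlgHom_rel k (PreprojRel.arrow_target a)
  rw [← h, ← mul_assoc, e_mul_e, ite_mul, zero_mul]
  split_ifs with h'
  · rw [h']
  · rfl

theorem arrow_mul_e (i : ℕ) (a : ArrowA m) :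
    arrow k a * e k m i = if i = a.1.1.val then arrow k a else 0 := by
  have h : arrow k a * e k m a.1.1.val = arrow k a := by
    rw [e_of_lt a.1.1.isLt, vertexIdem, arrow, ← map_mul]
    exact RingQuot.mkAlgHom_rel k (PreprojRel.arrow_source a)
  rw [← h, mul_assoc, e_mul_e, mul_ite, mul_zero]
  simp only [eq_comm]

theorem e_mul_star (i : ℕ) (a : ArrowA m) :
    e k m i * star k a = if i = a.1.1.val then star k a else 0 := by
  have h : e k m a.1.1.val * star k a = star k a := by
    rw [e_of_lt a.1.1.isLt, vertexIdem, star, ← map_mul]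
    exact RingQuot.mkAlgHom_rel k (PreprojRel.star_target a)
  rw [← h, ← mul_assoc, e_mul_e, ite_mul, zero_mul]
  split_ifs with h'
  · rw [h']
  · rfl

theorem star_mul_e (i : ℕ) (a : ArrowA m) :
    star k a * e k m i = if i = a.1.2.val then star k a else 0 := by
  have h : star k a * e k m a.1.2.val = star k a := by
    rw [e_of_lt a.1.2.isLt, vertexIdem, star, ← map_mul]
    exact RingQuot.mkAlgHom_rel k (PreprojRel.star_source a)
  rw [← h, mul_assoc, e_mul_e, mul_ite, mul_zero]
  simp only [eq_comm]

theorem up_mul_e (i : ℕ) : up k m * e k m i = e k m (i + 1) * up k m := by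
  rw [up, Finset.sum_mul, Finset.mul_sum]
  refine Finset.sum_congr rfl fun a _ => ?_
  rw [arrow_mul_e, e_mul_arrow]
  refine if_congr ?_ rfl rfl
  rw [← a.2]
  omega

theorem down_mul_e_succ (i : ℕ) : down k m * e k m (i + 1) = e k m i * down k m := by
  rw [down, Finset.sum_mul, Finset.mul_sum]
  refine Finset.sum_congr rfl fun a _ => ?_
  rw [star_mul_e, e_mul_star]
  refine if_congr ?_ rfl rfl
  rw [← a.2]
  omega

theorem down_mul_e_zero : down k m * e k m 0 = 0 := by
  rw [down, Finset.sum_mul]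
  refine Finset.sum_eq_zero fun a _ => ?_
  rw [star_mul_e, if_neg]
  have := a.2
  omega

theorem up_mul_e_source (a : ArrowA m) : up k m * e k m a.1.1.val = arrow k a := by
  rw [up, Finset.sum_mul, Finset.sum_eq_single a]
  · rw [arrow_mul_e, if_pos rfl]
  · intro b _ hb
    rw [arrow_mul_e, if_neg]
    intro h
    have h1 := a.2
    have h2 := b.2
    exact hb (Subtype.ext (Prod.ext (Fin.ext h.symm) (Fin.ext (by omega))))
  · exact fun h => absurd (Finset.mem_univ a) h

theorem down_mul_e_target (a : ArrowA m) : down k m * e k m a.1.2.val = star k a := by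
  rw [down, Finset.sum_mul, Finset.sum_eq_single a]
  · rw [star_mul_e, if_pos rfl]
  · intro b _ hb
    rw [star_mul_e, if_neg]
    intro h
    have h1 := a.2
    have h2 := b.2
    exact hb (Subtype.ext (Prod.ext (Fin.ext (by omega)) (Fin.ext h.symm)))
  · exact fun h => absurd (Finset.mem_univ a) h

/-- The preprojective relation. -/
theorem commute_up_down : Commute (up k m) (down k m) := by
  have h := RingQuot.mkAlgHom_rel k (PreprojRel.preproj (k := k) (V := Fin m) (Q := ArrowA m)
    (s := fun a => a.1.1) (t := fun a => a.1.2))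
  rw [map_sum, map_zero] at h
  simp only [map_sub, map_mul] at h
  rw [Finset.sum_sub_distrib, sub_eq_zero] at h
  have h1 : up k m * down k m = ∑ a, arrow k a * star k a := by
    rw [down, Finset.mul_sum]
    refine Finset.sum_congr rfl fun a _ => ?_
    rw [← up_mul_e_source, mul_assoc, e_mul_star, if_pos rfl]
  have h2 : down k m * up k m = ∑ a, star k a * arrow k a := by
    rw [up, Finset.mul_sum]
    refine Finset.sum_congr rfl fun a _ => ?_
    rw [← down_mul_e_target, mul_assoc, e_mul_arrow, if_pos rfl]
  exact h1.trans (h.trans h2.symm)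

theorem up_pow_mul_e (a i : ℕ) : up k m ^ a * e k m i = e k m (i + a) * up k m ^ a := by
  induction a with
  | zero => simp
  | succ a ih =>
    rw [pow_succ', mul_assoc, ih, ← mul_assoc, up_mul_e, mul_assoc]
    rfl

theorem down_pow_mul_e (b i : ℕ) : down k m ^ b * e k m (i + b) = e k m i * down k m ^ b := by
  induction b generalizing i with
  | zero => simp
  | succ b ih =>
    rw [pow_succ', mul_assoc, show i + (b + 1) = i + 1 + b by omega, ih, ← mul_assoc,
      down_mul_e_succ, mul_assoc]

variable (k m) in
/-- The monomials `U^a D^b e(s)` in the sum `U` of the arrows and the sum `D` of the opposite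
arrows. -/
def monom (a b s : ℕ) : PreprojA k m := up k m ^ a * down k m ^ b * e k m s

theorem monom_eq (a b i : ℕ) :
    monom k m a b (i + b) = e k m (i + a) * (up k m ^ a * down k m ^ b) := by
  rw [monom, mul_assoc, down_pow_mul_e, ← mul_assoc, up_pow_mul_e, mul_assoc]

theorem monom_eq_zero_of_lt {a b s : ℕ} (h : s < b) : monom k m a b s = 0 := by
  obtain ⟨c, rfl⟩ := Nat.exists_eq_add_of_lt h
  have := down_pow_mul_e (k := k) (m := m) s 0
  rw [zero_add] at this
  rw [monom, show s + c + 1 = c + 1 + s by omega, pow_add, pow_succ, mul_assoc, mul_assoc,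
    mul_assoc, this, ← mul_assoc (down k m) (e k m 0), down_mul_e_zero]
  simp

theorem monom_eq_zero_of_le {a b s : ℕ} (h : m ≤ s + a) : monom k m a b s = 0 := by
  rw [monom, (commute_up_down.pow_pow a b).eq, mul_assoc, up_pow_mul_e, e_of_le h]
  simp

theorem e_mul_monom (i a b s : ℕ) :
    e k m i * monom k m a b s = if i + b = s + a then monom k m a b s else 0 := by
  by_cases h : b ≤ s
  · obtain ⟨j, rfl⟩ := Nat.exists_eq_add_of_le' h
    rw [monom_eq, ← mul_assoc, e_mul_e, ite_mul, zero_mul]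
    split_ifs with h1 h2 h2
    · rw [h1]
    · omega
    · omega
    · rfl
  · rw [monom_eq_zero_of_lt (by omega), mul_zero, ite_self]

theorem up_mul_monom (a b s : ℕ) : up k m * monom k m a b s = monom k m (a + 1) b s := by
  rw [monom, monom, pow_succ', mul_assoc, mul_assoc, mul_assoc]

theorem down_mul_monom (a b s : ℕ) : down k m * monom k m a b s = monom k m a (b + 1) s := by
  rw [monom, monom, pow_succ', ← mul_assoc, ← mul_assoc, ← mul_assoc,
    (commute_up_down.pow_left a).symm.eq]

variable (k m) in
/-- The monomials span `Π_m`: their span contains `1`, and it is stable under left multiplication by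
the generators. -/
theorem span_monom_eq_top :
    Submodule.span k (Set.range fun p : ℕ × ℕ × ℕ => monom k m p.1 p.2.1 p.2.2) = ⊤ := by
  set N := Submodule.span k (Set.range fun p : ℕ × ℕ × ℕ => monom k m p.1 p.2.1 p.2.2) with hN
  have hmem : ∀ a b s, monom k m a b s ∈ N := fun a b s => Submodule.subset_span ⟨(a, b, s), rfl⟩
  have key : ∀ g : PreprojA k m, (∀ a b s, g * monom k m a b s ∈ N) → ∀ y ∈ N, g * y ∈ N := by
    intro g hg y hy
    refine Submodule.span_induction (p := fun y _ => g * y ∈ N) ?_ ?_ ?_ ?_ hy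
    · rintro _ ⟨p, rfl⟩
      exact hg _ _ _
    · rw [mul_zero]; exact zero_mem _
    · intro y z _ _ hy hz
      rw [mul_add]; exact add_mem hy hz
    · intro c y _ hy
      rw [mul_smul_comm]; exact N.smul_mem c hy
  have he : ∀ i, ∀ y ∈ N, e k m i * y ∈ N := fun i => key _ fun a b s => by
    rw [e_mul_monom]
    split_ifs
    · exact hmem _ _ _
    · exact zero_mem _
  have hu : ∀ y ∈ N, up k m * y ∈ N := key _ fun a b s => by
    rw [up_mul_monom]; exact hmem _ _ _
  have hd : ∀ y ∈ N, down k m * y ∈ N := key _ fun a b s => by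
    rw [down_mul_monom]; exact hmem _ _ _
  have hall : ∀ p : FreeAlgebra k (DoubleGen (Fin m) (ArrowA m)), ∀ y ∈ N,
      RingQuot.mkAlgHom k (PreprojRel k (fun a : ArrowA m => a.1.1) fun a => a.1.2) p * y ∈ N := by
    intro p
    induction p using FreeAlgebra.induction with
    | grade0 r =>
      intro y hy
      rw [AlgHom.commutes, ← Algebra.smul_def]
      exact N.smul_mem r hy
    | grade1 g =>
      intro y hy
      cases g with
      | vertex i =>
        have := he i.val y hy
        rwa [e_of_lt i.isLt] at this
      | arrow a =>
        have := hu _ (he a.1.1.val y hy)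
        rwa [← mul_assoc, up_mul_e_source] at this
      | star a =>
        have := hd _ (he a.1.2.val y hy)
        rwa [← mul_assoc, down_mul_e_target] at this
    | mul p q hp hq =>
      intro y hy
      rw [map_mul, mul_assoc]
      exact hp _ (hq y hy)
    | add p q hp hq =>
      intro y hy
      rw [map_add, add_mul]
      exact add_mem (hp y hy) (hq y hy)
  have h1 : (1 : PreprojA k m) ∈ N := by
    rw [← sum_e]
    refine sum_mem fun i _ => ?_
    have := hmem 0 0 i.val
    rwa [monom, pow_zero, pow_zero, one_mul, one_mul] at this
  rw [eq_top_iff]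
  intro y _
  obtain ⟨p, rfl⟩ := RingQuot.mkAlgHom_surjective k _ y
  have := hall p 1 h1
  rwa [mul_one] at this

variable (k m) in
/-- The indices `(t, s, b)` of the monomials `U^a D^b e(s)`, where `a = t + b - s`, which are paths
from the vertex `s` to the vertex `t` passing only through vertices of `A_m`, whatever the order of
the factors is. -/
abbrev NormalIdx := {p : Fin m × Fin m × Fin m //
  p.2.1.val ≤ p.1.val + p.2.2.val ∧ p.2.2.val ≤ p.2.1.val ∧ p.1.val + p.2.2.val < m}

/-- Each element of `Π_m` is a combination of the monomials with index in `NormalIdx`, since the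
others vanish. -/
theorem exists_sum_monom (y : PreprojA k m) : ∃ c : NormalIdx m → k,
    ∑ p : NormalIdx m, c p • monom k m (p.1.1.val + p.1.2.2.val - p.1.2.1.val) p.1.2.2.val
      p.1.2.1.val = y := by
  rw [← Submodule.mem_span_range_iff_exists_fun]
  have hy : y ∈ (⊤ : Submodule k (PreprojA k m)) := trivial
  rw [← span_monom_eq_top] at hy
  refine Submodule.span_le.2 ?_ hy
  rintro _ ⟨⟨a, b, s⟩, rfl⟩
  change monom k m a b s ∈ _
  by_cases h1 : s < b
  · rw [monom_eq_zero_of_lt h1]; exact zero_mem _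
  · by_cases h2 : m ≤ s + a
    · rw [monom_eq_zero_of_le h2]; exact zero_mem _
    · refine Submodule.subset_span
        ⟨⟨(⟨s + a - b, by omega⟩, ⟨s, by omega⟩, ⟨b, by omega⟩), ?_⟩, ?_⟩
      · dsimp only; omega
      · dsimp only
        rw [show s + a - b + b - s = a by omega]

end PreprojA

end Preproj

/-! ### A basis of the algebra `A_n / ⟨e(n)⟩` -/

section AusBasis

variable {k : Type u} [Field k] {n : ℕ}

/-- The canonical generator of the summand `[t + 1]` of `E`. -/
def ausGen (t : Fin n) : AusGen k n :=
  Pi.single (M := fun i : Fin n => Cyc k n (i.val + 1)) t (Cyc.gen (t.val + 1))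

theorem ausGen_hom_ext {N : Type*} [AddCommGroup N] [Module (Lam k n) N]
    {f g : AusGen k n →ₗ[Lam k n] N} (h : ∀ t, f (ausGen t) = g (ausGen t)) : f = g :=
  LinearMap.pi_ext' fun t => Cyc.hom_ext (h t)

theorem ausGen_apply_self (t : Fin n) : (ausGen t : AusGen k n) t = Cyc.gen (t.val + 1) :=
  Pi.single_eq_same (M := fun i : Fin n => Cyc k n (i.val + 1)) t _

theorem ausGen_apply_ne {s t : Fin n} (h : s ≠ t) : (ausGen t : AusGen k n) s = 0 :=
  Pi.single_eq_of_ne (M := fun i : Fin n => Cyc k n (i.val + 1)) h _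

theorem x_pow_smul_ausGen {b : ℕ} {s : Fin n} (h : s.val + 1 ≤ b) :
    Lam.x k n ^ b • (ausGen s : AusGen k n) = 0 := by
  obtain ⟨d, rfl⟩ := Nat.exists_eq_add_of_le' h
  refine funext fun j => ?_
  change Lam.x k n ^ (d + (s.val + 1)) • (ausGen s : AusGen k n) j = 0
  by_cases hj : j = s
  · subst hj
    rw [pow_add, mul_smul, Cyc.x_pow_smul, smul_zero]
  · rw [ausGen_apply_ne hj, smul_zero]

theorem x_pow_smul_x_pow_smul {M : Type*} [AddCommGroup M] [Module (Lam k n) M] (a b : ℕ) (y : M) :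
    Lam.x k n ^ a • Lam.x k n ^ b • y = Lam.x k n ^ (a + b) • y := by
  rw [smul_smul, ← pow_add]

theorem x_pow_smul_x_pow_smul_ausGen {t b : ℕ} {s : Fin n} (h : s.val ≤ t + b) :
    Lam.x k n ^ (t + 1) • Lam.x k n ^ b • (ausGen s : AusGen k n) = 0 :=
  (x_pow_smul_x_pow_smul _ _ _).trans (x_pow_smul_ausGen (by omega))

variable (k n) in
/-- The linear map `[t + 1] → [s + 1]` which sends the canonical generator to `x ^ b` times the
canonical generator, as an element of `A_n`; it is set to `0` if there is no such map. -/
def AusAlg.el (t s b : ℕ) : AusAlg k n :=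
  if h : t < n ∧ s < n ∧ s ≤ t + b then
    MulOpposite.op (Cyc.lift (t + 1) (Lam.x k n ^ b • (ausGen ⟨s, h.2.1⟩ : AusGen k n))
      (x_pow_smul_x_pow_smul_ausGen h.2.2) ∘ₗ
        LinearMap.proj (⟨t, h.1⟩ : Fin n))
  else 0

namespace AusAlg

theorem unop_el_ausGen {s t : Fin n} {b : ℕ} (h : s.val ≤ t.val + b) (r : Fin n) :
    (el k n t.val s.val b).unop (ausGen r) = if t = r then Lam.x k n ^ b • ausGen s else 0 := by
  rw [el, dif_pos ⟨t.isLt, s.isLt, h⟩]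
  change Cyc.lift (t.val + 1) (Lam.x k n ^ b • ausGen s : AusGen k n)
    (x_pow_smul_x_pow_smul_ausGen h) ((ausGen r : AusGen k n) t) = _
  split_ifs with hr
  · subst hr
    rw [ausGen_apply_self, Cyc.lift_gen]
  · rw [ausGen_apply_ne hr, map_zero]

theorem el_eq_zero {t s b : ℕ} (h : ¬ (t < n ∧ s < n ∧ s ≤ t + b)) : el k n t s b = 0 := dif_neg h

theorem el_mul_el {t s r b c : ℕ} (hs : s < n) (h : s ≤ t + b) (h' : r ≤ s + c) :
    el k n t s b * el k n s r c = el k n t r (b + c) := by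
  by_cases ht : t < n
  · by_cases hr : r < n
    · lift t to Fin n using ht
      lift s to Fin n using hs
      lift r to Fin n using hr
      apply MulOpposite.unop_injective
      refine ausGen_hom_ext fun j => ?_
      change (el k n s r c).unop ((el k n t s b).unop (ausGen j)) = _
      rw [unop_el_ausGen h, unop_el_ausGen (by omega)]
      split_ifs with hj
      · rw [map_smul, unop_el_ausGen h', if_pos rfl]
        exact x_pow_smul_x_pow_smul _ _ _
      · rw [map_zero]
    · rw [el_eq_zero (t := s), el_eq_zero (s := r), mul_zero] <;> omega
  · rw [el_eq_zero (t := t), el_eq_zero (t := t), zero_mul] <;> omega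

theorem el_mul_el_of_ne {t s s' r b c : ℕ} (h : s ≠ s') : el k n t s b * el k n s' r c = 0 := by
  by_cases h1 : t < n ∧ s < n ∧ s ≤ t + b
  · by_cases h2 : s' < n ∧ r < n ∧ r ≤ s' + c
    · obtain ⟨ht, hs, h1⟩ := h1
      obtain ⟨hs', hr, h2⟩ := h2
      lift t to Fin n using ht
      lift s to Fin n using hs
      lift s' to Fin n using hs'
      lift r to Fin n using hr
      apply MulOpposite.unop_injective
      refine ausGen_hom_ext fun j => ?_
      change (el k n s' r c).unop ((el k n t s b).unop (ausGen j)) = 0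
      rw [unop_el_ausGen h1]
      split_ifs with hj
      · rw [map_smul, unop_el_ausGen h2, if_neg (fun h' => h (congrArg Fin.val h'.symm)), smul_zero]
      · rw [map_zero]
    · rw [el_eq_zero h2, mul_zero]
  · rw [el_eq_zero h1, zero_mul]

theorem el_eq_zero_of_lt {t s b : ℕ} (h : s < b) : el k n t s b = 0 := by
  by_cases h1 : t < n ∧ s < n ∧ s ≤ t + b
  · obtain ⟨ht, hs, h1⟩ := h1
    lift t to Fin n using ht
    lift s to Fin n using hs
    apply MulOpposite.unop_injective
    refine ausGen_hom_ext fun j => ?_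
    rw [unop_el_ausGen h1, x_pow_smul_ausGen (by omega), ite_self]
    rfl
  · exact el_eq_zero h1

theorem idem_eq_el (i : Fin n) : idem k n (i.val + 1) = el k n i.val i.val 0 := by
  apply MulOpposite.unop_injective
  refine ausGen_hom_ext fun r => ?_
  rw [unop_el_ausGen (by omega), pow_zero, one_smul]
  refine funext fun j => ?_
  change (if j.val + 1 = i.val + 1 then LinearMap.proj j else 0 :
    AusGen k n →ₗ[Lam k n] Cyc k n (j.val + 1)) (ausGen r) = _
  by_cases hj : j = i
  · subst hj
    rw [if_pos rfl]
    split_ifs with h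
    · subst h; rfl
    · exact ausGen_apply_ne h
  · rw [if_neg (fun h => hj (Fin.ext (by omega)))]
    split_ifs with h
    · exact (ausGen_apply_ne hj).symm
    · rfl

theorem sum_el : ∑ i : Fin n, el k n i.val i.val 0 = 1 := by
  apply MulOpposite.unop_injective
  refine ausGen_hom_ext fun r => ?_
  rw [Finset.unop_sum, LinearMap.sum_apply, Finset.sum_eq_single r]
  · rw [unop_el_ausGen (by omega), if_pos rfl, pow_zero, one_smul]
    rfl
  · intro i _ hi
    rw [unop_el_ausGen (by omega), if_neg hi]
  · exact fun h => absurd (Finset.mem_univ r) h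

theorem algebra_smul_eq {M : Type*} [AddCommGroup M] [Module (Lam k n) M] [Module k M]
    [IsScalarTower k (Lam k n) M] (c : k) (b : ℕ) (y : M) :
    c • Lam.x k n ^ b • y =
      (Ideal.Quotient.mk _ (Polynomial.C c * Polynomial.X ^ b) : Lam k n) • y := by
  rw [map_mul, mul_smul, ← Lam.x_pow, ← algebraMap_smul (Lam k n) c (Lam.x k n ^ b • y)]
  rfl

theorem sum_coeff_smul (p : Polynomial k) {M : Type*} [AddCommGroup M] [Module (Lam k n) M]
    [Module k M] [IsScalarTower k (Lam k n) M] (y : M) :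
    ∑ b ∈ p.support, p.coeff b • Lam.x k n ^ b • y = (Ideal.Quotient.mk _ p : Lam k n) • y := by
  conv_rhs => rw [p.as_sum_support_C_mul_X_pow, map_sum, Finset.sum_smul]
  exact Finset.sum_congr rfl fun b _ => algebra_smul_eq _ _ _

/-- The elements `el t s b` span `A_n`. -/
theorem mem_span_el (f : AusAlg k n) : f ∈ Submodule.span k
    (Set.range fun p : ℕ × ℕ × ℕ => el k n p.1 p.2.1 p.2.2) := by
  have key : ∀ t s : Fin n, el k n t.val t.val 0 * f * el k n s.val s.val 0 ∈ Submodule.span k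
      (Set.range fun p : ℕ × ℕ × ℕ => el k n p.1 p.2.1 p.2.2) := by
    intro t s
    obtain ⟨c, hc⟩ := Cyc.exists_smul_gen (f.unop (ausGen t) s)
    obtain ⟨p, rfl⟩ := Lam.mk_surjective c
    -- since `x ^ (t + 1)` kills the generator of `[t + 1]`, low coefficients of `p` vanish
    have hp : ∀ b, ¬ s.val ≤ t.val + b → p.coeff b = 0 := by
      intro b hb
      have h0 : Lam.x k n ^ (t.val + 1) • f.unop (ausGen t) s = 0 := by
        have : f.unop (Lam.x k n ^ (t.val + 1) • ausGen t) s = 0 := by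
          rw [x_pow_smul_ausGen le_rfl, map_zero]
          rfl
        rwa [map_smul] at this
      rw [hc, smul_smul, Cyc.smul_gen_eq_zero_iff, Lam.x_pow (t.val + 1), ← map_mul,
        Lam.x_pow_dvd_mk_iff s.isLt, Polynomial.X_pow_dvd_iff] at h0
      have := h0 (b + (t.val + 1)) (by omega)
      rwa [Polynomial.coeff_X_pow_mul] at this
    have hsum : el k n t.val t.val 0 * f * el k n s.val s.val 0 =
        ∑ b ∈ p.support, p.coeff b • el k n t.val s.val b := by
      apply MulOpposite.unop_injective
      refine ausGen_hom_ext fun r => ?_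
      rw [Finset.unop_sum, LinearMap.sum_apply]
      have hb : ∀ b ∈ p.support, (MulOpposite.unop (p.coeff b • el k n t.val s.val b)) (ausGen r)
          = p.coeff b • (if t = r then Lam.x k n ^ b • ausGen s else 0 : AusGen k n) := by
        intro b hb
        rw [MulOpposite.unop_smul, LinearMap.smul_apply, unop_el_ausGen]
        by_contra h
        exact Polynomial.mem_support_iff.1 hb (hp b h)
      rw [Finset.sum_congr rfl hb]
      change (el k n s.val s.val 0).unop (f.unop ((el k n t.val t.val 0).unop (ausGen r))) = _
      rw [unop_el_ausGen (by omega)]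
      split_ifs with hr
      · rw [sum_coeff_smul, pow_zero, one_smul, el, dif_pos ⟨s.isLt, s.isLt, by omega⟩]
        change Cyc.lift (s.val + 1) (Lam.x k n ^ 0 • ausGen s : AusGen k n)
          (x_pow_smul_x_pow_smul_ausGen (by omega)) (f.unop (ausGen t) s) = _
        rw [hc, map_smul, Cyc.lift_gen, pow_zero, one_smul]
      · rw [map_zero, map_zero]
        simp
    rw [hsum]
    exact sum_mem fun b _ => Submodule.smul_mem _ _ (Submodule.subset_span ⟨(_, _, b), rfl⟩)
  have hf : f = ∑ t : Fin n, ∑ s : Fin n, el k n t.val t.val 0 * f * el k n s.val s.val 0 := by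
    simp_rw [← Finset.mul_sum, sum_el, mul_one, ← Finset.sum_mul, sum_el, one_mul]
  rw [hf]
  exact sum_mem fun t _ => sum_mem fun s _ => key t s

/-- The elements of `⟨e(n)⟩` map elements killed by `x ^ j` to multiples of `x ^ (n - j)`, as they
factor through the free module `[n]`. -/
theorem exists_eq_x_pow_smul_of_mem (hn : 1 ≤ n) {f : AusAlg k n} (hf : f ∈ idealOf (idem k n n))
    {j : ℕ} (hj : j ≤ n) {y : AusGen k n} (hy : Lam.x k n ^ j • y = 0) :
    ∃ z, f.unop y = Lam.x k n ^ (n - j) • z := by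
  let I : TwoSidedIdeal (AusAlg k n) := TwoSidedIdeal.mk'
    {f | ∀ y : AusGen k n, Lam.x k n ^ j • y = 0 → ∃ z, f.unop y = Lam.x k n ^ (n - j) • z}
    (fun y _ => ⟨0, by rw [smul_zero]; rfl⟩)
    (fun {f g} hf hg y hy => by
      obtain ⟨z, hz⟩ := hf y hy
      obtain ⟨w, hw⟩ := hg y hy
      exact ⟨z + w, by rw [smul_add, ← hz, ← hw]; rfl⟩)
    (fun {f} hf y hy => by
      obtain ⟨z, hz⟩ := hf y hy
      exact ⟨-z, by rw [smul_neg, ← hz]; rfl⟩)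
    (fun {f g} hg y hy => by
      refine hg (f.unop y) ?_
      rw [← map_smul, hy, map_zero])
    (fun {f g} hf y hy => by
      obtain ⟨z, hz⟩ := hf y hy
      refine ⟨g.unop z, ?_⟩
      rw [← map_smul, ← hz]
      rfl)
  have hI : TwoSidedIdeal.span {idem k n n} ≤ I := by
    rw [TwoSidedIdeal.span_le, Set.singleton_subset_iff]
    rw [SetLike.mem_coe, TwoSidedIdeal.mem_mk']
    intro y hy
    let l : Fin n := ⟨n - 1, by omega⟩
    have hl : l.val + 1 = n := Nat.sub_add_cancel hn
    obtain ⟨z, hz⟩ := (Cyc.x_pow_smul_eq_zero_iff (i := j) l.isLt (by omega) (y l)).1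
      (congrFun hy l)
    refine ⟨Pi.single (M := fun i : Fin n => Cyc k n (i.val + 1)) l z, ?_⟩
    refine (idem_smul_single hl LinearMap.id y).trans ?_
    rw [LinearMap.id_apply, hz, show l.val.succ - j = n - j from congrArg (· - j) hl]
    exact Pi.single_smul (f := fun i : Fin n => Cyc k n (i.val + 1)) l _ z
  have := hI (TwoSidedIdeal.mem_asIdeal.1 hf)
  rw [TwoSidedIdeal.mem_mk'] at this
  exact this y hy

end AusAlg

end AusBasis

/-! ### The preprojective algebra as a factor algebra of the Auslander algebra -/

section PreprojIso

variable (k : Type u) [Field k] (m : ℕ)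

/-- The residue class of `AusAlg.el` modulo `⟨e(n)⟩`, where `n = m + 1`. -/
def FactorAlg.el (t s b : ℕ) : FactorAlg k (m + 1) :=
  Ideal.Quotient.mkₐ k (idealOf (AusAlg.idem k (m + 1) (m + 1))) (AusAlg.el k (m + 1) t s b)

namespace FactorAlg

variable {k m}

theorem el_mul_el {t s r b c : ℕ} (hs : s < m + 1) (h : s ≤ t + b) (h' : r ≤ s + c) :
    el k m t s b * el k m s r c = el k m t r (b + c) := by
  rw [el, el, ← map_mul, AusAlg.el_mul_el hs h h', el]

theorem el_mul_el_of_ne {t s s' r b c : ℕ} (h : s ≠ s') : el k m t s b * el k m s' r c = 0 := by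
  rw [el, el, ← map_mul, AusAlg.el_mul_el_of_ne h, map_zero]

theorem el_eq_zero_of_lt {t s b : ℕ} (h : s < b) : el k m t s b = 0 := by
  rw [el, AusAlg.el_eq_zero_of_lt h, map_zero]

theorem el_eq_zero {t s b : ℕ} (h : ¬ s ≤ t + b) : el k m t s b = 0 := by
  rw [el, AusAlg.el_eq_zero (fun h' => h h'.2.2), map_zero]

/-- A map `[t + 1] → [s + 1]` which factors through `[n]` vanishes modulo `⟨e(n)⟩`. -/
theorem el_eq_zero_of_le {t s b : ℕ} (h : m ≤ t + b) : el k m t s b = 0 := by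
  by_cases h1 : t < m + 1 ∧ s < m + 1
  · have h0 : el k m m m 0 = 0 := by
      have := AusAlg.idem_eq_el (k := k) (Fin.last m)
      rw [Fin.val_last] at this
      rw [el, ← this]
      exact Ideal.Quotient.eq_zero_iff_mem.2
        (TwoSidedIdeal.mem_asIdeal.2 (TwoSidedIdeal.subset_span rfl))
    have h2 : el k m t s b = el k m t m (m - t) * (el k m m m 0 * el k m m s (t + b - m)) := by
      rw [el_mul_el (by omega) (by omega) (by omega), el_mul_el (by omega) (by omega) (by omega)]
      congr 1
      omega
    rw [h2, h0, zero_mul, mul_zero]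
  · rw [el, AusAlg.el_eq_zero (fun h' => h1 ⟨h'.1, h'.2.1⟩), map_zero]

end FactorAlg

/-- The values of the isomorphism from `Π_m` to `A_{m + 1} / ⟨e(m + 1)⟩` on generators: an arrow
`i → i + 1` goes to the canonical projection `[i + 1] → [i]` (with vertices numbered from `1`), and
its opposite to the inclusion `[i] → [i + 1]`. Since `A_{m + 1}` is the opposite of `End E`, the
directions of the maps are reversed. -/
def genToFactor : DoubleGen (Fin m) (ArrowA m) → FactorAlg k (m + 1)
  | .vertex i => FactorAlg.el k m i.val i.val 0
  | .arrow a => FactorAlg.el k m a.1.2.val a.1.1.val 0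
  | .star a => FactorAlg.el k m a.1.1.val a.1.2.val 1

/-- Along the arrows of the linear quiver, differences of a function on vertices add up to zero if
the function vanishes at both ends. -/
theorem sum_arrowA_sub_eq_zero {G : Type*} [AddCommGroup G] {m : ℕ} (g : ℕ → G)
    (h0 : g 0 = 0) (hm : ∀ i, i + 1 = m → g i = 0) :
    ∑ a : ArrowA m, (g a.1.2.val - g a.1.1.val) = 0 := by
  have ht : ∑ a : ArrowA m, g a.1.2.val = ∑ i : Fin m, g i.val := by
    refine Fintype.sum_of_injective (fun a : ArrowA m => a.1.2) (fun a b hab => ?_) _ _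
      (fun i hi => ?_) fun _ => rfl
    · have h1 := a.2
      have h2 := b.2
      have h3 : a.1.2 = b.1.2 := hab
      rw [h3] at h1
      exact Subtype.ext (Prod.ext (Fin.ext (by omega)) h3)
    · by_cases h : i.val = 0
      · rw [h, h0]
      · exact absurd ⟨⟨(⟨i.val - 1, by omega⟩, i), by dsimp only; omega⟩, rfl⟩ hi
  have hs : ∑ a : ArrowA m, g a.1.1.val = ∑ i : Fin m, g i.val := by
    refine Fintype.sum_of_injective (fun a : ArrowA m => a.1.1) (fun a b hab => ?_) _ _
      (fun i hi => ?_) fun _ => rfl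
    · have h1 := a.2
      have h2 := b.2
      have h3 : a.1.1 = b.1.1 := hab
      rw [h3] at h1
      exact Subtype.ext (Prod.ext h3 (Fin.ext (by omega)))
    · by_cases h : i.val + 1 = m
      · rw [hm _ h]
      · exact absurd ⟨⟨(i, ⟨i.val + 1, by omega⟩), rfl⟩, rfl⟩ hi
  rw [Finset.sum_sub_distrib, ht, hs, sub_self]

theorem lift_genToFactor_rel {x y : FreeAlgebra k (DoubleGen (Fin m) (ArrowA m))}
    (h : PreprojRel k (fun a : ArrowA m => a.1.1) (fun a => a.1.2) x y) :
    FreeAlgebra.lift k (genToFactor k m) x = FreeAlgebra.lift k (genToFactor k m) y := by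
  induction h with
  | idem i =>
    simp only [map_mul, FreeAlgebra.lift_ι_apply, genToFactor]
    rw [FactorAlg.el_mul_el (by omega) (by omega) (by omega)]
  | orth i j h =>
    simp only [map_mul, map_zero, FreeAlgebra.lift_ι_apply, genToFactor]
    exact FactorAlg.el_mul_el_of_ne fun h' => h (Fin.ext h')
  | one =>
    simp only [map_sum, map_one, FreeAlgebra.lift_ι_apply, genToFactor]
    have := congrArg (Ideal.Quotient.mkₐ k (idealOf (AusAlg.idem k (m + 1) (m + 1))))
      (AusAlg.sum_el (k := k) (n := m + 1))
    rw [map_sum, map_one, Fin.sum_univ_castSucc] at this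
    refine Eq.trans ?_ this
    refine ((add_zero _).symm.trans (congrArg _ ?_))
    exact (FactorAlg.el_eq_zero_of_le (k := k) (m := m) (t := m) (s := m) (b := 0) le_rfl).symm
  | arrow_target a =>
    simp only [map_mul, FreeAlgebra.lift_ι_apply, genToFactor]
    have := a.2
    rw [FactorAlg.el_mul_el (by omega) (by omega) (by omega)]
  | arrow_source a =>
    simp only [map_mul, FreeAlgebra.lift_ι_apply, genToFactor]
    have := a.2
    rw [FactorAlg.el_mul_el (by omega) (by omega) (by omega)]
  | star_target a =>
    simp only [map_mul, FreeAlgebra.lift_ι_apply, genToFactor]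
    have := a.2
    rw [FactorAlg.el_mul_el (by omega) (by omega) (by omega)]
  | star_source a =>
    simp only [map_mul, FreeAlgebra.lift_ι_apply, genToFactor]
    have := a.2
    rw [FactorAlg.el_mul_el (by omega) (by omega) (by omega)]
  | preproj =>
    simp only [map_sum, map_sub, map_mul, map_zero, FreeAlgebra.lift_ι_apply, genToFactor]
    -- both composites at the vertex `i` are multiplication by `x`
    refine Eq.trans (Finset.sum_congr rfl fun a _ => ?_)
      (sum_arrowA_sub_eq_zero (m := m) (fun i => FactorAlg.el k m i i 1)
        (FactorAlg.el_eq_zero_of_lt zero_lt_one) fun i hi => FactorAlg.el_eq_zero_of_le hi.ge)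
    have := a.2
    rw [FactorAlg.el_mul_el (by omega) (by omega) (by omega),
      FactorAlg.el_mul_el (by omega) (by omega) (by omega)]

/-- The algebra homomorphism `Π_m → A_{m + 1} / ⟨e(m + 1)⟩`. -/
def preprojToFactor : PreprojA k m →ₐ[k] FactorAlg k (m + 1) :=
  RingQuot.liftAlgHom k
    ⟨FreeAlgebra.lift k (genToFactor k m), fun _ _ h => lift_genToFactor_rel k m h⟩

variable {k m}

theorem preprojToFactor_gen (g : DoubleGen (Fin m) (ArrowA m)) :
    preprojToFactor k m (RingQuot.mkAlgHom k _ (FreeAlgebra.ι k g)) = genToFactor k m g := by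
  rw [preprojToFactor, RingQuot.liftAlgHom_mkAlgHom_apply, FreeAlgebra.lift_ι_apply]

theorem preprojToFactor_vertexIdem (i : Fin m) :
    preprojToFactor k m (PreprojA.vertexIdem k i) = FactorAlg.el k m i.val i.val 0 :=
  preprojToFactor_gen _

theorem preprojToFactor_down_pow {b i : ℕ} (h : i + b < m) :
    preprojToFactor k m (PreprojA.monom k m 0 b (i + b)) = FactorAlg.el k m i (i + b) b := by
  induction b generalizing i with
  | zero =>
    rw [PreprojA.monom, pow_zero, pow_zero, one_mul, one_mul, PreprojA.e_of_lt h]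
    exact preprojToFactor_vertexIdem _
  | succ b ih =>
    have h1 : PreprojA.monom k m 0 (b + 1) (i + (b + 1)) =
        PreprojA.star k ⟨(⟨i, by omega⟩, ⟨i + 1, by omega⟩), rfl⟩ *
          PreprojA.monom k m 0 b (i + 1 + b) := by
      rw [← PreprojA.down_mul_e_target, mul_assoc, PreprojA.e_mul_monom,
        if_pos (by dsimp only; omega), PreprojA.down_mul_monom,
        show i + (b + 1) = i + 1 + b by omega]
    rw [h1, map_mul, ih (by omega), PreprojA.star, preprojToFactor_gen, genToFactor]
    dsimp only
    rw [FactorAlg.el_mul_el (by omega) (by omega) (by omega)]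
    congr 1 <;> omega

theorem preprojToFactor_monom {a b i : ℕ} (h : i + b + a < m) :
    preprojToFactor k m (PreprojA.monom k m a b (i + b)) =
      FactorAlg.el k m (i + a) (i + b) b := by
  induction a with
  | zero => exact preprojToFactor_down_pow h
  | succ a ih =>
    have h1 : PreprojA.monom k m (a + 1) b (i + b) =
        PreprojA.arrow k ⟨(⟨i + a, by omega⟩, ⟨i + a + 1, by omega⟩), rfl⟩ *
          PreprojA.monom k m a b (i + b) := by
      rw [← PreprojA.up_mul_e_source, mul_assoc, PreprojA.e_mul_monom,
        if_pos (by dsimp only; omega), PreprojA.up_mul_monom]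
    rw [h1, map_mul, ih (by omega), PreprojA.arrow, preprojToFactor_gen, genToFactor]
    dsimp only
    rw [FactorAlg.el_mul_el (by omega) (by omega) (by omega), zero_add]
    rfl

theorem preprojToFactor_normal (p : PreprojA.NormalIdx m) :
    preprojToFactor k m (PreprojA.monom k m (p.1.1.val + p.1.2.2.val - p.1.2.1.val) p.1.2.2.val
      p.1.2.1.val) = FactorAlg.el k m p.1.1.val p.1.2.1.val p.1.2.2.val := by
  obtain ⟨⟨t, s, b⟩, h1, h2, h3⟩ := p
  dsimp only at h1 h2 h3 ⊢
  have h := preprojToFactor_monom (k := k) (m := m) (a := t.val + b.val - s.val) (b := b.val)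
    (i := s.val - b.val) (by omega)
  rw [Nat.sub_add_cancel h2] at h
  rw [h]
  congr 1
  omega

theorem preprojToFactor_surjective : Function.Surjective (preprojToFactor k m) := by
  have hel : ∀ t s b, FactorAlg.el k m t s b ∈ (preprojToFactor k m).range := by
    intro t s b
    by_cases h1 : s ≤ t + b
    · by_cases h2 : b ≤ s
      · by_cases h3 : t + b < m
        · exact ⟨_, preprojToFactor_normal
            ⟨(⟨t, by omega⟩, ⟨s, by omega⟩, ⟨b, by omega⟩), h1, h2, h3⟩⟩
        · rw [FactorAlg.el_eq_zero_of_le (not_lt.1 h3)]; exact zero_mem _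
      · rw [FactorAlg.el_eq_zero_of_lt (not_le.1 h2)]; exact zero_mem _
    · rw [FactorAlg.el_eq_zero h1]; exact zero_mem _
  intro y
  obtain ⟨f, rfl⟩ := Ideal.Quotient.mkₐ_surjective k _ y
  have hf := AusAlg.mem_span_el f
  refine Submodule.span_induction (p := fun f _ => Ideal.Quotient.mkₐ k
    (idealOf (AusAlg.idem k (m + 1) (m + 1))) f ∈ (preprojToFactor k m).range) ?_ ?_ ?_ ?_ hf
  · rintro _ ⟨p, rfl⟩
    exact hel _ _ _
  · rw [map_zero]; exact zero_mem _
  · intro f g _ _ hf hg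
    rw [map_add]; exact add_mem hf hg
  · intro c f _ hf
    rw [map_smul]; exact Subalgebra.smul_mem _ hf c

/-- The residue classes of the maps `AusAlg.el` with index in `NormalIdx` are linearly
independent. -/
theorem coeff_eq_zero_of_sum_mem (c : PreprojA.NormalIdx m → k)
    (h : ∑ p : PreprojA.NormalIdx m, c p •
      AusAlg.el k (m + 1) p.1.1.val p.1.2.1.val p.1.2.2.val ∈
        idealOf (AusAlg.idem k (m + 1) (m + 1))) (p : PreprojA.NormalIdx m) : c p = 0 := by
  obtain ⟨⟨t, s, b⟩, h1, h2, h3⟩ := p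
  dsimp only at h1 h2 h3
  -- the component `[t + 1] → [s + 1]` of the sum is given by this polynomial
  let q : Polynomial k := ∑ p : PreprojA.NormalIdx m,
    if p.1.1 = t ∧ p.1.2.1 = s then Polynomial.C (c p) * Polynomial.X ^ p.1.2.2.val else 0
  have hq : q.coeff b.val = c ⟨(t, s, b), h1, h2, h3⟩ := by
    rw [Polynomial.finsetSum_coeff, Finset.sum_eq_single ⟨(t, s, b), h1, h2, h3⟩]
    · rw [if_pos ⟨rfl, rfl⟩, Polynomial.coeff_C_mul_X_pow, if_pos rfl]
    · rintro ⟨⟨t', s', b'⟩, h'⟩ _ hne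
      split_ifs with hts
      · obtain ⟨rfl, rfl⟩ := hts
        rw [Polynomial.coeff_C_mul_X_pow, if_neg]
        rintro hb
        exact hne (Subtype.ext (Prod.ext rfl (Prod.ext rfl (Fin.ext hb.symm))))
      · exact Polynomial.coeff_zero _
    · exact fun h => absurd (Finset.mem_univ _) h
  obtain ⟨z, hz⟩ := AusAlg.exists_eq_x_pow_smul_of_mem (Nat.le_add_left 1 m) h
    (j := t.val + 1) (by omega) (x_pow_smul_ausGen (s := t.castSucc) le_rfl)
  have zero_gen : (0 : Lam k (m + 1)) • (Cyc.gen (s.val + 1) : Cyc k (m + 1) (s.val + 1)) = 0 :=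
    zero_smul (Lam k (m + 1)) (Cyc.gen (s.val + 1) : Cyc k (m + 1) (s.val + 1))
  have hs : (Ideal.Quotient.mk _ q : Lam k (m + 1)) •
      (Cyc.gen (s.val + 1) : Cyc k (m + 1) (s.val + 1)) =
        Lam.x k (m + 1) ^ (m - t.val) • z s.castSucc := by
    have := congrFun hz s.castSucc
    refine Eq.trans ?_ (this.trans ?_)
    · rw [Finset.unop_sum, LinearMap.sum_apply, Finset.sum_apply, map_sum, Finset.sum_smul]
      refine Finset.sum_congr rfl fun p _ => ?_
      have hp := AusAlg.unop_el_ausGen (k := k) (n := m + 1) (t := p.1.1.castSucc)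
        (s := p.1.2.1.castSucc) (b := p.1.2.2.val) p.2.1 t.castSucc
      refine Eq.symm ?_
      change c p • ((AusAlg.el k (m + 1) p.1.1.val p.1.2.1.val p.1.2.2.val).unop
        (ausGen t.castSucc)) s.castSucc = _
      refine (congrArg (fun y : AusGen k (m + 1) => c p • y s.castSucc) hp).trans ?_
      by_cases ht : p.1.1 = t
      · rw [if_pos (congrArg Fin.castSucc ht)]
        change c p • Lam.x k (m + 1) ^ p.1.2.2.val •
          (ausGen p.1.2.1.castSucc : AusGen k (m + 1)) s.castSucc = _
        by_cases hs : p.1.2.1 = s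
        · rw [if_pos ⟨ht, hs⟩, hs, ausGen_apply_self, AusAlg.algebra_smul_eq]
          rfl
        · rw [if_neg (fun h => hs h.2), ausGen_apply_ne
            (fun h => hs (Fin.castSucc_injective m h).symm), smul_zero, smul_zero, map_zero]
          exact zero_gen.symm
      · rw [if_neg (fun h => ht (Fin.castSucc_injective m h)), if_neg (fun h => ht h.1), map_zero]
        exact (smul_zero _).trans zero_gen.symm
    · rw [Nat.add_sub_add_right]
      rfl
  obtain ⟨d, hd⟩ := Cyc.exists_smul_gen (z s.castSucc)
  obtain ⟨r, rfl⟩ := Lam.mk_surjective d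
  rw [hd] at hs
  have hdvd : Polynomial.X ^ (s.val + 1) ∣ q - Polynomial.X ^ (m - t.val) * r := by
    rw [← Lam.x_pow_dvd_mk_iff (k := k) (n := m + 1) (by omega), ← Cyc.smul_gen_eq_zero_iff,
      map_sub, sub_smul, sub_eq_zero, map_mul, mul_smul, ← Lam.x_pow]
    exact hs
  have h0 := Polynomial.X_pow_dvd_iff.1 hdvd b.val (by omega)
  rw [Polynomial.coeff_sub, Polynomial.coeff_X_pow_mul', if_neg (by omega), sub_zero, hq] at h0
  exact h0

theorem preprojToFactor_injective : Function.Injective (preprojToFactor k m) := by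
  rw [injective_iff_map_eq_zero]
  intro y hy
  obtain ⟨c, rfl⟩ := PreprojA.exists_sum_monom y
  refine Finset.sum_eq_zero fun p _ => ?_
  rw [coeff_eq_zero_of_sum_mem c ?_ p, zero_smul]
  rw [← Ideal.Quotient.eq_zero_iff_mem]
  refine Eq.trans ?_ hy
  change Ideal.Quotient.mkₐ k _ _ = _
  rw [map_sum, map_sum]
  refine Finset.sum_congr rfl fun p _ => ?_
  rw [map_smul, map_smul, preprojToFactor_normal]
  rfl

end PreprojIso

theorem exists_preproj_equiv_factorAlg (k : Type u) [Field k] (n : ℕ) (hn : 1 ≤ n) :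
    ∃ φ : PreprojA k (n - 1) ≃ₐ[k] FactorAlg k n,
      ∀ i : Fin (n - 1), φ (PreprojA.vertexIdem k i) =
        Ideal.Quotient.mk _ (AusAlg.idem k n (i.val + 1)) := by
  obtain ⟨m, rfl⟩ := Nat.exists_eq_add_of_le' hn
  refine ⟨AlgEquiv.ofBijective (preprojToFactor k m)
    ⟨preprojToFactor_injective, preprojToFactor_surjective⟩, fun i => ?_⟩
  refine (preprojToFactor_vertexIdem i).trans ?_
  have := AusAlg.idem_eq_el (k := k) (n := m + 1) i.castSucc
  exact congrArg (Ideal.Quotient.mk _) this.symm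

end

end SubmoduleCat

theorem theorem1 (k : Type*) [Field k] (n : ℕ) (hn : 1 ≤ n) :
    -- `Π_{n-1}` is the factor algebra `A_n / ⟨e(n)⟩`, vertex `i` corresponding to `e(i)`
    (∃ φ : PreprojA k (n - 1) ≃ₐ[k] FactorAlg k n,
      ∀ i : Fin (n - 1), φ (PreprojA.vertexIdem k i) =
        Ideal.Quotient.mk _ (AusAlg.idem k n (i.val + 1))) ∧
    -- for every such identification, the functors `F` and `G` have the asserted properties
    (∀ φ : PreprojA k (n - 1) ≃ₐ[k] FactorAlg k n,
      ((functorF φ).Additive ∧ (functorF φ).Full ∧ (functorF φ).EssSurj ∧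
        IsObjective (functorF φ) ∧ index (functorF φ) = ((2 * n : ℕ) : ℕ∞) ∧
        (∀ ⦃P Q : S k n⦄ (f : P ⟶ Q), (functorF φ).map f = 0 ↔ InIdeal (setU k n) f) ∧
        ∃ e : FactorCat (setU k n) ≌ FinMod (PreprojA k (n - 1)),
          e.functor.Additive ∧ Nonempty (factorFunctor (setU k n) ⋙ e.functor ≅ functorF φ)) ∧
      ((functorG φ).Additive ∧ (functorG φ).Full ∧ (functorG φ).EssSurj ∧
        IsObjective (functorG φ) ∧ index (functorG φ) = ((2 * n : ℕ) : ℕ∞) ∧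
        (∀ ⦃P Q : S k n⦄ (f : P ⟶ Q), (functorG φ).map f = 0 ↔ InIdeal (setV k n) f) ∧
        ∃ e : FactorCat (setV k n) ≌ FinMod (PreprojA k (n - 1)),
          e.functor.Additive ∧ Nonempty (factorFunctor (setV k n) ⋙ e.functor ≅ functorG φ))) ∧
    -- the factor categories are abelian with enough projective objects
    ((∃ h : Abelian (FactorCat (setU k n)), h.toPreadditive = factorPreadditive (setU k n)) ∧
      EnoughProjectives (FactorCat (setU k n))) ∧
    ((∃ h : Abelian (FactorCat (setV k n)), h.toPreadditive = factorPreadditive (setV k n)) ∧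
      EnoughProjectives (FactorCat (setV k n))) ∧
    -- the indecomposable projective objects of the factor categories
    (∀ P : FactorCat (setU k n), (Indecomposable P ∧ Projective P) ↔
      ∃ (Z : S k n) (j : ℕ), 1 ≤ j ∧ j ≤ n - 1 ∧ IsPicket 0 j Z ∧
        Nonempty (P ≅ (factorFunctor (setU k n)).obj Z)) ∧
    (∀ P : FactorCat (setV k n), (Indecomposable P ∧ Projective P) ↔
      ∃ (Z : S k n) (i : ℕ), 1 ≤ i ∧ i ≤ n - 1 ∧ IsPicket i n Z ∧
        Nonempty (P ≅ (factorFunctor (setV k n)).obj Z)) :=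
  ⟨exists_preproj_equiv_factorAlg k n hn,
    fun φ => ⟨cokerIncl_properties φ.toRingEquiv hn, cokerProj_properties φ.toRingEquiv hn⟩,
    factorCat_setU_abelian k n hn, factorCat_setV_abelian k n hn,
    indecomposable_projective_setU_iff k n hn, indecomposable_projective_setV_iff k n hn⟩
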